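/- Let $n\ge 1$, $0<\alpha<n$ and $1<p_1,p_2,q_1,q_2<\infty$. Fix a window $\varphi\in\mathcal S(\mathbb R^n)\setminus\{0\}$. For $f\in\mathcal S'(\mathbb R^n)$ let $$V_\varphi f(x,\xi)=(f,M_\xi T_x\varphi),\qquad M_\xi T_x\varphi(t)=e^{i\xi\cdot t}\varphi(t-x),$$ be its short-time Fourier transform, where $(\cdot,\cdot)$ extends the inner product of $L^2(\mathbb R^n)$, and for $1\le p,q<\infty$ let $M^{p,q}(\mathbb R^n)$ be the space of all $f\in\mathcal S'(\mathbb R^n)$ with $$\|f\|_{M^{p,q}}=\Big\{\int_{\mathbb R^n}\Big(\int_{\mathbb R^n}|V_\varphi f(x,\xi)|^p\,dx\Big)^{q/p}d\xi\Big\}^{1/q}<\infty .$$ For $f\in\mathcal S(\mathbb R^n)$ let $$I_\alpha f(x)=\frac1{\gamma(\alpha)}\int_{\mathbb R^n}\frac{f(y)}{|x-y|^{n-\alpha}}\,dy,\qquad \gamma(\alpha)=\frac{\pi^{n/2}2^\alpha\Gamma(\alpha/2)}{\Gamma((n-\alpha)/2)} .$$ Then $I_\alpha$ is bounded from $M^{p_1,q_1}(\mathbb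 R^n)$ to $M^{p_2,q_2}(\mathbb R^n)$, i.e. there is a linear operator $T:M^{p_1,q_1}(\mathbb R^n)\to M^{p_2,q_2}(\mathbb R^n)$ and a constant $C$ such that $\|Tf\|_{M^{p_2,q_2}}\le C\|f\|_{M^{p_1,q_1}}$ for all $f\in M^{p_1,q_1}(\mathbb R^n)$ and $Tf=I_\alpha f$ for all $f\in\mathcal S(\mathbb R^n)$, if and only if $$\frac1{p_2}\le\frac1{p_1}-\frac{\alpha}{n}\qquad\text{and}\qquad\frac1{q_2}<\frac1{q_1}+\frac{\alpha}{n}.$$ -/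

import Mathlib

open MeasureTheory SchwartzMap Filter Topology
open scoped ENNReal NNReal FourierTransform RealInnerProductSpace

namespace FracMod

/-- The Euclidean space `ℝⁿ`. -/
abbrev Rn (n : ℕ) := EuclideanSpace ℝ (Fin n)

noncomputable section

variable {n : ℕ}

theorem hasTemperateGrowth_expReal :
    (fun s : ℝ => Complex.exp (-Complex.I * s)).HasTemperateGrowth := by
  refine ⟨(contDiff_const.mul Complex.ofRealCLM.contDiff).cexp, fun k => ⟨0, 1, fun s => ?_⟩⟩
  rw [norm_iteratedFDeriv_eq_norm_iteratedDeriv]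
  have h : iteratedDeriv k (fun s : ℝ => Complex.exp (-Complex.I * s))
      = fun s : ℝ => (-Complex.I) ^ k * Complex.exp (-Complex.I * s) := by
    induction k with
    | zero => simp
    | succ k ih =>
      rw [iteratedDeriv_succ, ih]
      funext s
      have h1 : HasDerivAt (fun s : ℝ => Complex.exp (-Complex.I * s))
          (Complex.exp (-Complex.I * s) * (-Complex.I * 1)) s :=
        ((Complex.ofRealCLM.hasDerivAt (x := s)).const_mul (-Complex.I)).cexp
      rw [(h1.const_mul _).deriv]
      ring
  rw [h]
  simp [Complex.norm_exp]

theorem hasTemperateGrowth_char (ξ : Rn n) :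
    (fun t : Rn n => Complex.exp (-Complex.I * (⟪ξ, t⟫ : ℝ))).HasTemperateGrowth :=
  hasTemperateGrowth_expReal.comp (Function.hasTemperateGrowth_inner_right ξ)

/-- The Schwartz function `t ↦ conj (e^{i ξ·t} φ(t - x))`, i.e. the complex conjugate of the
time-frequency shift `M_ξ T_x φ`; see `conjTimeFreqShift_apply`. -/
def conjTimeFreqShift (φ : 𝓢(Rn n, ℂ)) (x ξ : Rn n) : 𝓢(Rn n, ℂ) :=
  smulLeftCLM ℂ (fun t : Rn n => Complex.exp (-Complex.I * (⟪ξ, t⟫ : ℝ)))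
    (compSubConstCLM ℂ x (postcompCLM (Complex.conjCLE : ℂ →L[ℝ] ℂ) φ))

theorem conjTimeFreqShift_apply (φ : 𝓢(Rn n, ℂ)) (x ξ t : Rn n) :
    conjTimeFreqShift φ x ξ t
      = (starRingEnd ℂ) (Complex.exp (Complex.I * (⟪ξ, t⟫ : ℝ)) * φ (t - x)) := by
  rw [conjTimeFreqShift, smulLeftCLM_apply_apply (hasTemperateGrowth_char ξ)]
  simp [← Complex.exp_conj]

/-- The short-time Fourier transform `V_φ f(x, ξ) = (f, M_ξ T_x φ)` of a tempered distribution,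
where `(·,·)` is the duality extending the (conjugate-linear in the second slot) `L²` product. -/
def stft (φ : 𝓢(Rn n, ℂ)) (f : 𝓢'(Rn n, ℂ)) (x ξ : Rn n) : ℂ :=
  f (conjTimeFreqShift φ x ξ)

theorem exists_seminorm_translate_sub_le (θ : 𝓢(Rn n, ℂ)) (k m : ℕ) :
    ∃ B : ℝ, ∀ h : Rn n, ‖h‖ ≤ 1 →
      SchwartzMap.seminorm ℂ k m (compSubConstCLM ℂ h θ - θ) ≤ B * ‖h‖ := by
  set B : ℝ := 2 ^ k * (Finset.Iic (k, m + 1)).sup (schwartzSeminormFamily ℂ (Rn n) ℂ) θ with hBdef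
  have hB0 : 0 ≤ B := by positivity
  refine ⟨B, fun h hh => ?_⟩
  refine SchwartzMap.seminorm_le_bound ℂ k m _ (by positivity) fun t => ?_
  have hfun : (⇑(compSubConstCLM ℂ h θ - θ) : Rn n → ℂ)
      = (fun z => θ (z - h)) - ⇑θ := by
    ext z; simp
  have hθ : ∀ z : Rn n, DifferentiableAt ℝ (iteratedFDeriv ℝ m θ) z := fun z =>
    ((θ.smooth ⊤).differentiable_iteratedFDeriv (mod_cast WithTop.coe_lt_top _)) z
  rw [hfun, iteratedFDeriv_sub_apply, iteratedFDeriv_comp_sub]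
  rotate_left
  · exact ((θ.smooth m).comp (contDiff_id.sub contDiff_const)).contDiffAt
  · exact (θ.smooth m).contDiffAt
  have hmv := (convex_closedBall t 1).norm_image_sub_le_of_norm_fderiv_le (𝕜 := ℝ)
    (f := fun z => ‖t‖ ^ k • iteratedFDeriv ℝ m θ z) (C := B) (x := t) (y := t - h)
    (fun z _ => (hθ z).fun_const_smul _) (fun z hz => ?_) (by simp) (by simpa using hh)
  · rw [← smul_sub, norm_smul] at hmv
    simpa using hmv
  · rw [fderiv_fun_const_smul (hθ z), norm_smul, norm_fderiv_iteratedFDeriv]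
    have htz : ‖t‖ ≤ 1 + ‖z‖ := by
      have : ‖t - z‖ ≤ 1 := by simpa [dist_eq_norm, norm_sub_rev] using hz
      have := norm_add_le (t - z) z
      simp only [sub_add_cancel] at this
      linarith
    have h3 := one_add_le_sup_seminorm_apply (𝕜 := ℂ) (m := (k, m + 1)) le_rfl le_rfl θ z
    refine le_trans ?_ h3
    simp only [norm_pow, norm_norm]
    gcongr

theorem continuous_translate (ψ : 𝓢(Rn n, ℂ)) :
    Continuous fun x : Rn n => compSubConstCLM ℂ x ψ := by
  rw [continuous_iff_continuousAt]
  intro x₀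
  rw [ContinuousAt, (schwartz_withSeminorms ℂ (Rn n) ℂ).tendsto_nhds]
  rintro ⟨k, m⟩ ε hε
  set θ : 𝓢(Rn n, ℂ) := compSubConstCLM ℂ x₀ ψ with hθ
  obtain ⟨B, hB⟩ := exists_seminorm_translate_sub_le θ k m
  have hB' : Tendsto (fun x : Rn n => B * ‖x - x₀‖) (𝓝 x₀) (𝓝 0) := by
    have : Continuous fun x : Rn n => B * ‖x - x₀‖ := by fun_prop
    simpa using this.tendsto x₀
  have h1 : ∀ᶠ x in 𝓝 x₀, ‖x - x₀‖ ≤ 1 := by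
    have := Metric.closedBall_mem_nhds x₀ (one_pos)
    filter_upwards [this] with x hx
    simpa [dist_eq_norm] using hx
  filter_upwards [hB'.eventually_lt_const hε, h1] with x hx hx1
  have h2 : compSubConstCLM ℂ x ψ = compSubConstCLM ℂ (x - x₀) θ := by
    rw [hθ, compSubConstCLM_comp]; simp
  rw [h2]
  exact (hB _ hx1).trans_lt hx

theorem continuous_modulate (ψ : 𝓢(Rn n, ℂ)) :
    Continuous fun ξ : Rn n =>
      smulLeftCLM ℂ (fun t : Rn n => Complex.exp (-Complex.I * (⟪ξ, t⟫ : ℝ))) ψ := by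
  have key : (fun ξ : Rn n =>
      smulLeftCLM ℂ (fun t : Rn n => Complex.exp (-Complex.I * (⟪ξ, t⟫ : ℝ))) ψ)
      = fun ξ : Rn n => 𝓕⁻ (compSubConstCLM ℂ (-(2 * Real.pi)⁻¹ • ξ) (𝓕 ψ)) := by
    funext ξ
    rw [← FourierTransform.fourierInv_fourier_eq (F := 𝓢(Rn n, ℂ))
      (smulLeftCLM ℂ (fun t : Rn n => Complex.exp (-Complex.I * (⟪ξ, t⟫ : ℝ))) ψ)]
    congr 1
    ext η
    rw [compSubConstCLM_apply, fourier_coe, fourier_coe, Real.fourier_eq', Real.fourier_eq']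
    congr 1
    funext t
    rw [smulLeftCLM_apply_apply (hasTemperateGrowth_char ξ)]
    simp only [smul_eq_mul]
    rw [← mul_assoc, ← Complex.exp_add]
    congr 2
    simp only [inner_sub_right, inner_smul_right, real_inner_comm]
    have := Real.pi_ne_zero
    push_cast
    field_simp
    ring
  rw [key]
  exact (FourierTransform.continuous_fourierInv (F := 𝓢(Rn n, ℂ)) ).comp
    ((continuous_translate (𝓕 ψ)).comp (by fun_prop))

theorem measurable_stft (φ : 𝓢(Rn n, ℂ)) (f : 𝓢'(Rn n, ℂ)) :
    Measurable (Function.uncurry fun ξ x : Rn n => stft φ f x ξ) := by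
  refine measurable_uncurry_of_continuous_of_measurable (fun x => ?_) (fun ξ => ?_)
  · exact (map_continuous f).comp (continuous_modulate _)
  · refine Continuous.measurable ?_
    exact (map_continuous f).comp
      ((ContinuousLinearMap.continuous _).comp (continuous_translate _))

/-- The modulation norm `‖V_φ f‖_{L^{p,q}}`, with values in `[0, ∞]`: inner `L^p` norm in `x`,
outer `L^q` norm in `ξ`. -/
def modulationNorm (φ : 𝓢(Rn n, ℂ)) (p q : ℝ) (f : 𝓢'(Rn n, ℂ)) : ℝ≥0∞ :=
  (∫⁻ ξ, (∫⁻ x, ‖stft φ f x ξ‖ₑ ^ p) ^ (q / p)) ^ (1 / q)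

theorem modulationNorm_add_le (φ : 𝓢(Rn n, ℂ)) {p q : ℝ} (hp : 1 ≤ p) (hq : 1 ≤ q)
    (f g : 𝓢'(Rn n, ℂ)) :
    modulationNorm φ p q (f + g) ≤ modulationNorm φ p q f + modulationNorm φ p q g := by
  have hp0 : 0 < p := by linarith
  have hq0 : 0 < q := by linarith
  have hrw : ∀ u : 𝓢'(Rn n, ℂ), modulationNorm φ p q u
      = (∫⁻ ξ, ((∫⁻ x, ‖stft φ u x ξ‖ₑ ^ p) ^ (1 / p)) ^ q) ^ (1 / q) := by
    intro u
    simp only [modulationNorm, ← ENNReal.rpow_mul]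
    congr! 4
    ring
  have hmeas : ∀ u : 𝓢'(Rn n, ℂ),
      Measurable fun ξ => (∫⁻ x, ‖stft φ u x ξ‖ₑ ^ p) ^ (1 / p) := by
    intro u
    refine Measurable.pow_const ?_ _
    exact Measurable.lintegral_prod_right'
      (f := fun z : Rn n × Rn n => ‖stft φ u z.2 z.1‖ₑ ^ p)
      ((measurable_stft φ u).enorm.pow_const p)
  have hmeas1 : ∀ (u : 𝓢'(Rn n, ℂ)) (ξ : Rn n), Measurable fun x => ‖stft φ u x ξ‖ₑ := by
    intro u ξ
    exact ((measurable_stft φ u).comp (measurable_prodMk_left (x := ξ))).enorm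
  rw [hrw, hrw, hrw]
  refine le_trans ?_ (ENNReal.lintegral_Lp_add_le (hmeas f).aemeasurable
    (hmeas g).aemeasurable hq)
  gcongr with ξ
  refine le_trans ?_ (ENNReal.lintegral_Lp_add_le (hmeas1 f ξ).aemeasurable
    (hmeas1 g ξ).aemeasurable hp)
  gcongr with x
  exact enorm_add_le _ _

theorem modulationNorm_smul (φ : 𝓢(Rn n, ℂ)) {p q : ℝ} (hp : 1 ≤ p) (hq : 1 ≤ q)
    (c : ℂ) (f : 𝓢'(Rn n, ℂ)) :
    modulationNorm φ p q (c • f) = ‖c‖ₑ * modulationNorm φ p q f := by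
  have hp0 : 0 < p := by linarith
  have hq0 : 0 < q := by linarith
  have h1 : ∀ x ξ : Rn n, stft φ (c • f) x ξ = c * stft φ f x ξ := fun x ξ => rfl
  simp only [modulationNorm, h1, enorm_mul, ENNReal.mul_rpow_of_nonneg _ _ hp0.le]
  have hc : ∀ {r : ℝ}, 0 ≤ r → ‖c‖ₑ ^ r ≠ ∞ := fun hr =>
    ENNReal.rpow_ne_top_of_nonneg hr enorm_ne_top
  simp only [lintegral_const_mul' _ _ (hc hp0.le),
    ENNReal.mul_rpow_of_nonneg _ _ (div_nonneg hq0.le hp0.le), ← ENNReal.rpow_mul]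
  rw [mul_div_cancel₀ _ hp0.ne', lintegral_const_mul' _ _ (hc hq0.le),
    ENNReal.mul_rpow_of_nonneg _ _ (by positivity), ← ENNReal.rpow_mul,
    mul_one_div_cancel hq0.ne', ENNReal.rpow_one]

/-- The modulation space `M^{p,q}(ℝⁿ)` of all tempered distributions with finite modulation norm
with respect to the window `φ`. -/
def modulationSpace (φ : 𝓢(Rn n, ℂ)) (p q : ℝ) (hp : 1 ≤ p) (hq : 1 ≤ q) :
    Submodule ℂ 𝓢'(Rn n, ℂ) where
  carrier := {f | modulationNorm φ p q f < ∞}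
  zero_mem' := by
    change modulationNorm φ p q 0 < ∞
    have h0 : ∀ x ξ : Rn n, stft φ 0 x ξ = 0 := fun _ _ => rfl
    have hp0 : 0 < p := by linarith
    have hq0 : 0 < q := by linarith
    simp [modulationNorm, h0, hp0, hq0]
  add_mem' {f g} hf hg :=
    (modulationNorm_add_le φ hp hq f g).trans_lt (ENNReal.add_lt_top.2 ⟨hf, hg⟩)
  smul_mem' c f hf := by
    change modulationNorm φ p q (c • f) < ∞
    rw [modulationNorm_smul φ hp hq]
    exact ENNReal.mul_lt_top enorm_lt_top hf

/-- `γ(α) = π^{n/2} 2^α Γ(α/2) / Γ((n-α)/2)`. -/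
def rieszConstant (n : ℕ) (α : ℝ) : ℝ :=
  Real.pi ^ ((n : ℝ) / 2) * 2 ^ α * Real.Gamma (α / 2) / Real.Gamma ((n - α) / 2)

/-- The fractional integral `I_α f(x) = γ(α)⁻¹ ∫ f(y) |x - y|^{-(n-α)} dy`. -/
def fractionalIntegral (α : ℝ) (f : Rn n → ℂ) (x : Rn n) : ℂ :=
  ((rieszConstant n α)⁻¹ : ℝ) * ∫ y, f y / ((‖x - y‖ ^ (n - α) : ℝ) : ℂ)

/-- `I_α` is bounded from `M^{p₁,q₁}` to `M^{p₂,q₂}`: there is a bounded linear operator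
`T : M^{p₁,q₁} → M^{p₂,q₂}` such that, for every Schwartz function `f`, `T f` is the tempered
distribution given by the function `I_α f`. (All Schwartz functions belong to `M^{p₁,q₁}` and are
dense in it for finite exponents, so such a `T` is unique.) -/
def FractionalIntegralBounded (φ : 𝓢(Rn n, ℂ)) (α p₁ q₁ p₂ q₂ : ℝ)
    (hp₁ : 1 ≤ p₁) (hq₁ : 1 ≤ q₁) (hp₂ : 1 ≤ p₂) (hq₂ : 1 ≤ q₂) : Prop :=
  ∃ T : modulationSpace φ p₁ q₁ hp₁ hq₁ →ₗ[ℂ] modulationSpace φ p₂ q₂ hp₂ hq₂,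
    (∃ C : ℝ≥0, ∀ f, modulationNorm φ p₂ q₂ (T f) ≤ C * modulationNorm φ p₁ q₁ f) ∧
    ∀ (f : 𝓢(Rn n, ℂ)) (hf : (f : 𝓢'(Rn n, ℂ)) ∈ modulationSpace φ p₁ q₁ hp₁ hq₁)
      (g : 𝓢(Rn n, ℂ)),
      (T ⟨(f : 𝓢'(Rn n, ℂ)), hf⟩ : 𝓢'(Rn n, ℂ)) g = ∫ x, g x * fractionalIntegral α f x

end
end FracMod

namespace FracMod

/-- The dual characterisation of the `L^q` norm of a nonnegative function. -/
theorem lintegral_rpow_le_of_dual {X : Type*} [MeasurableSpace X] {μ : Measure X} [SigmaFinite μ]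
    {q r : ℝ} (hqr : q.HolderConjugate r) {A : X → ℝ≥0∞} (hA : Measurable A) {C : ℝ≥0∞}
    (h : ∀ g : X → ℝ≥0∞, Measurable g → ∫⁻ x, A x * g x ∂μ ≤ C * (∫⁻ x, g x ^ r ∂μ) ^ (1 / r)) :
    (∫⁻ x, A x ^ q ∂μ) ^ (1 / q) ≤ C := by
  have hq0 : 0 < q := hqr.pos
  have hr0 : 0 < r := hqr.symm.pos
  set B : ℕ → X → ℝ≥0∞ := fun N => (spanningSets μ N).indicator (fun x => min (A x) N) with hB
  have hBm : ∀ N, Measurable (B N) := fun N =>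
    (hA.min measurable_const).indicator (measurableSet_spanningSets μ N)
  have hBA : ∀ N x, B N x ≤ A x := fun N x =>
    (Set.indicator_le_self' (fun _ _ => zero_le) x).trans (min_le_left _ _)
  have hBN : ∀ N x, B N x ≤ (spanningSets μ N).indicator (fun _ => (N : ℝ≥0∞)) x := fun N x =>
    Set.indicator_le_indicator (min_le_right _ _)
  have hmono : Monotone B := by
    intro N M hNM x
    refine Set.indicator_le_indicator_of_subset (monotone_spanningSets μ hNM)
      (fun _ => zero_le) x |>.trans ?_
    refine Set.indicator_le_indicator ?_
    exact min_le_min_left _ (by exact_mod_cast hNM)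
  have hlim : ∀ x, ⨆ N, B N x = A x := by
    intro x
    refine le_antisymm (iSup_le fun N => hBA N x) ?_
    refine le_of_forall_lt fun c hc => ?_
    obtain ⟨N, hN⟩ := ENNReal.exists_nat_gt hc.ne_top
    obtain ⟨M, hM⟩ : ∃ M, x ∈ spanningSets μ M := by
      rw [← Set.mem_iUnion, iUnion_spanningSets]; trivial
    refine lt_of_lt_of_le ?_ (le_iSup _ (max N M))
    have hx : x ∈ spanningSets μ (max N M) := monotone_spanningSets μ (le_max_right _ _) hM
    simp only [hB, Set.indicator_of_mem hx]
    refine lt_min hc (hN.trans_le ?_)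
    exact_mod_cast le_max_left N M
  have hfin : ∀ N, ∫⁻ x, B N x ^ q ∂μ ≠ ∞ := by
    intro N
    have : ∫⁻ x, B N x ^ q ∂μ ≤ ∫⁻ x in spanningSets μ N, (N : ℝ≥0∞) ^ q ∂μ := by
      rw [← lintegral_indicator (measurableSet_spanningSets μ N)]
      refine lintegral_mono fun x => ?_
      by_cases hx : x ∈ spanningSets μ N
      · simp only [Set.indicator_of_mem hx]
        gcongr
        simpa [Set.indicator_of_mem hx] using hBN N x
      · simp [hB, Set.indicator_of_notMem hx, hq0]
    refine ne_top_of_le_ne_top ?_ this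
    rw [setLIntegral_const]
    exact ENNReal.mul_ne_top (ENNReal.rpow_ne_top_of_nonneg hq0.le (by simp))
      (measure_spanningSets_lt_top μ N).ne
  have hstep : ∀ N, ∫⁻ x, B N x ^ q ∂μ ≤ C ^ q := by
    intro N
    set I := ∫⁻ x, B N x ^ q ∂μ with hI
    have h1 := h (fun x => B N x ^ (q - 1)) ((hBm N).pow_const _)
    have h2 : ∀ x, (B N x ^ (q - 1)) ^ r = B N x ^ q := by
      intro x
      rw [← ENNReal.rpow_mul]
      congr 1
      exact hqr.sub_one_mul_conj
    simp only [h2] at h1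
    have h3 : I ≤ C * I ^ (1 / r) := by
      refine le_trans (lintegral_mono fun x => ?_) h1
      have : B N x ^ q = B N x * B N x ^ (q - 1) := by
        conv_rhs => rw [← ENNReal.rpow_one (B N x), ← ENNReal.rpow_mul, one_mul]
        rw [← ENNReal.rpow_add_of_nonneg _ _ zero_le_one (by linarith [hqr.lt])]
        congr 1; ring
      rw [this]
      gcongr
      exact hBA N x
    rcases eq_or_ne I 0 with h0 | h0
    · rw [h0]; exact zero_le
    have hIr : I ^ (1 / r) ≠ 0 := by simp [h0, hr0.le]
    have hIr' : I ^ (1 / r) ≠ ∞ := ENNReal.rpow_ne_top_of_nonneg (by positivity) (hfin N)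
    have h4 : I = I ^ (1 / q) * I ^ (1 / r) := by
      rw [← ENNReal.rpow_add _ _ h0 (hfin N)]
      simp [hqr.inv_add_inv_eq_one]
    have h5 : I ^ (1 / q) ≤ C := by
      have h6 : I ^ (1 / q) * I ^ (1 / r) ≤ C * I ^ (1 / r) := h4.symm.trans_le h3
      exact (ENNReal.mul_le_mul_iff_left hIr hIr').1 h6
    calc I = (I ^ (1 / q)) ^ q := by rw [← ENNReal.rpow_mul]; simp [hq0.ne']
      _ ≤ C ^ q := by gcongr
  have hsup : ∫⁻ x, A x ^ q ∂μ = ⨆ N, ∫⁻ x, B N x ^ q ∂μ := by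
    rw [← lintegral_iSup (fun N => (hBm N).pow_const q)
      (fun N M hNM x => ENNReal.rpow_le_rpow (hmono hNM x) hq0.le)]
    congr 1; funext x
    rw [← hlim x]
    exact (ENNReal.orderIsoRpow q hq0).map_iSup _
  calc (∫⁻ x, A x ^ q ∂μ) ^ (1 / q) ≤ (C ^ q) ^ (1 / q) := by
        gcongr
        rw [hsup]; exact iSup_le hstep
    _ = C := by rw [← ENNReal.rpow_mul]; simp [hq0.ne']

/-- Minkowski's integral inequality. -/
theorem lintegral_rpow_lintegral_le {X Y : Type*} [MeasurableSpace X] [MeasurableSpace Y]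
    {μ : Measure X} {ν : Measure Y} [SigmaFinite μ] [SigmaFinite ν] {p : ℝ} (hp : 1 < p)
    {F : X → Y → ℝ≥0∞} (hF : Measurable (Function.uncurry F)) :
    (∫⁻ x, (∫⁻ y, F x y ∂ν) ^ p ∂μ) ^ (1 / p) ≤ ∫⁻ y, (∫⁻ x, F x y ^ p ∂μ) ^ (1 / p) ∂ν := by
  have hpr := Real.HolderConjugate.conjExponent hp
  refine lintegral_rpow_le_of_dual hpr hF.lintegral_prod_right' fun g hg => ?_
  have hFy : ∀ y, Measurable fun x => F x y := fun y => hF.comp measurable_prodMk_right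
  calc ∫⁻ x, (∫⁻ y, F x y ∂ν) * g x ∂μ = ∫⁻ x, ∫⁻ y, F x y * g x ∂ν ∂μ := by
        congr 1; funext x
        rw [lintegral_mul_const]
        exact hF.comp measurable_prodMk_left
    _ = ∫⁻ y, ∫⁻ x, F x y * g x ∂μ ∂ν :=
        lintegral_lintegral_swap (hF.mul (hg.comp measurable_fst)).aemeasurable
    _ ≤ ∫⁻ y, (∫⁻ x, F x y ^ p ∂μ) ^ (1 / p) *
          (∫⁻ x, g x ^ p.conjExponent ∂μ) ^ (1 / p.conjExponent) ∂ν := by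
        refine lintegral_mono fun y => ?_
        exact ENNReal.lintegral_mul_le_Lp_mul_Lq μ hpr (hFy y).aemeasurable hg.aemeasurable
    _ = _ := by
        refine lintegral_mul_const _ ?_
        refine Measurable.pow_const ?_ _
        exact Measurable.lintegral_prod_left' (hF.pow_const p)

/-- Scaling of the Lebesgue integral on `ℝⁿ`. -/
theorem lintegral_comp_smul {n : ℕ} {c : ℝ} (hc : 0 < c) (f : Rn n → ℝ≥0∞) :
    ∫⁻ x, f (c • x) = ENNReal.ofReal ((c ^ n)⁻¹) * ∫⁻ x, f x := by
  have h1 := Measure.map_addHaar_smul (volume : Measure (Rn n)) hc.ne'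
  have h2 := lintegral_map_equiv (μ := (volume : Measure (Rn n))) f (MeasurableEquiv.smul₀ c hc.ne')
  simp only [MeasurableEquiv.coe_smul₀] at h2
  rw [← h2, h1, lintegral_smul_measure]
  simp [abs_of_pos hc]

theorem nontrivial_Rn {n : ℕ} (hn : 0 < n) : Nontrivial (Rn n) := by
  have : Nonempty (Fin n) := ⟨⟨0, hn⟩⟩
  infer_instance

/-- The measurable nonnegative kernel `|x|^{-l}`. -/
noncomputable def powerKernel {n : ℕ} (l : ℝ) (x : Rn n) : ℝ≥0∞ := ENNReal.ofReal (‖x‖ ^ (-l))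

theorem measurable_powerKernel {n : ℕ} (l : ℝ) : Measurable (powerKernel (n := n) l) := by
  unfold powerKernel
  exact (measurable_norm.pow_const _).ennreal_ofReal

theorem integrableOn_norm_rpow_ball {n : ℕ} {l : ℝ} (hl : l < n) (hn : 0 < n) (R : ℝ) :
    IntegrableOn (fun x : Rn n => ‖x‖ ^ (-l)) (Metric.ball 0 R) := by
  have := nontrivial_Rn hn
  have hn1 : ((n - 1 : ℕ) : ℝ) = n - 1 := by rw [Nat.cast_sub hn]; simp
  rw [integrableOn_fun_norm_addHaar (volume : Measure (Rn n)) (f := fun y : ℝ => y ^ (-l))]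
  have h1 : IntervalIntegrable (fun y : ℝ => y ^ ((n : ℝ) - 1 - l)) volume 0 (max R 0) :=
    intervalIntegral.intervalIntegrable_rpow' (by linarith)
  rw [intervalIntegrable_iff_integrableOn_Ioc_of_le (le_max_right _ _)] at h1
  refine (h1.mono_set (t := Set.Ioc 0 (max R 0)) (s := Set.Ioo 0 R)
    (fun y hy => ⟨hy.1, hy.2.le.trans (le_max_left _ _)⟩)).congr_fun (fun y hy => ?_)
    measurableSet_Ioo
  simp only [finrank_euclideanSpace, Fintype.card_fin, smul_eq_mul]
  rw [← Real.rpow_natCast, ← Real.rpow_add hy.1, hn1]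
  congr 1

theorem setLIntegral_powerKernel_ball_lt_top {n : ℕ} {l : ℝ} (hl : l < n) (hn : 0 < n) (R : ℝ) :
    ∫⁻ x in Metric.ball (0 : Rn n) R, powerKernel l x < ∞ :=
  (integrableOn_norm_rpow_ball hl hn R).lintegral_lt_top

theorem powerKernel_smul {n : ℕ} (l : ℝ) {c : ℝ} (hc : 0 < c) (x : Rn n) :
    powerKernel l (c • x) = ENNReal.ofReal (c ^ (-l)) * powerKernel l x := by
  rw [powerKernel, powerKernel, ← ENNReal.ofReal_mul (by positivity), norm_smul,
    Real.norm_of_nonneg hc.le, Real.mul_rpow hc.le (norm_nonneg _)]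

theorem setLIntegral_powerKernel_ball {n : ℕ} {l : ℝ} {R : ℝ} (hR : 0 < R) :
    ∫⁻ x in Metric.ball (0 : Rn n) R, powerKernel l x
      = ENNReal.ofReal (R ^ (n - l)) * ∫⁻ x in Metric.ball (0 : Rn n) 1, powerKernel l x := by
  have h := lintegral_comp_smul hR ((Metric.ball (0 : Rn n) R).indicator (powerKernel l))
  have h2 : ∀ x : Rn n, (Metric.ball (0 : Rn n) R).indicator (powerKernel l) (R • x)
      = ENNReal.ofReal (R ^ (-l)) * (Metric.ball (0 : Rn n) 1).indicator (powerKernel l) x := by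
    intro x
    have hiff : R • x ∈ Metric.ball (0 : Rn n) R ↔ x ∈ Metric.ball (0 : Rn n) 1 := by
      simp [norm_smul, abs_of_pos hR, hR]
    by_cases hx : x ∈ Metric.ball (0 : Rn n) 1
    · rw [Set.indicator_of_mem hx, Set.indicator_of_mem (hiff.2 hx), powerKernel_smul l hR]
    · rw [Set.indicator_of_notMem hx, Set.indicator_of_notMem (fun h => hx (hiff.1 h)), mul_zero]
  simp only [h2] at h
  rw [lintegral_const_mul' _ _ ENNReal.ofReal_ne_top,
    lintegral_indicator measurableSet_ball, lintegral_indicator measurableSet_ball] at h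
  have h3 : ENNReal.ofReal (R ^ n) * ENNReal.ofReal ((R ^ n)⁻¹) = 1 := by
    rw [← ENNReal.ofReal_mul (by positivity), mul_inv_cancel₀ (by positivity), ENNReal.ofReal_one]
  rw [← one_mul (∫⁻ x in Metric.ball (0 : Rn n) R, powerKernel l x), ← h3, mul_assoc, ← h,
    ← mul_assoc, ← ENNReal.ofReal_mul (by positivity), ← Real.rpow_natCast, ← Real.rpow_add hR]
  rfl

/-- The integral of `|x-y|^{-l}` over a set is controlled by a power of its measure. -/
theorem exists_setLIntegral_powerKernel_le {n : ℕ} {l : ℝ} (hl0 : 0 < l) (hl : l < n)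
    (hn : 0 < n) :
    ∃ C : ℝ≥0, ∀ (F : Set (Rn n)) (x : Rn n), MeasurableSet F →
      ∫⁻ y in F, powerKernel l (x - y) ≤ C * volume F ^ (1 - l / n) := by
  have hnR : (0 : ℝ) < n := by exact_mod_cast hn
  have hθ : 0 < 1 - l / n := by rw [sub_pos, div_lt_one hnR]; exact hl
  set D := ∫⁻ x in Metric.ball (0 : Rn n) 1, powerKernel l x with hD
  have hDfin : D ≠ ∞ := (setLIntegral_powerKernel_ball_lt_top hl hn 1).ne
  refine ⟨D.toNNReal + 1, fun F x hF => ?_⟩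
  rw [ENNReal.coe_add, ENNReal.coe_toNNReal hDfin, ENNReal.coe_one]
  rcases eq_or_ne (volume F) ∞ with h | h
  · rw [h, ENNReal.top_rpow_of_pos hθ, ENNReal.mul_top (by simp)]
    exact le_top
  rcases eq_or_ne (volume F) 0 with h0 | h0
  · rw [setLIntegral_measure_zero _ _ h0]; exact zero_le
  set v := (volume F).toReal with hv
  have hv0 : 0 < v := ENNReal.toReal_pos h0 h
  set R := v ^ (1 / (n : ℝ)) with hR
  have hR0 : 0 < R := by positivity
  have hvol : volume F = ENNReal.ofReal v := (ENNReal.ofReal_toReal h).symm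
  have hnl : R ^ ((n : ℝ) - l) = v ^ (1 - l / n) := by
    rw [hR, ← Real.rpow_mul hv0.le]; congr 1; field_simp
  have hRl : R ^ (-l) * v = v ^ (1 - l / n) := by
    rw [hR, ← Real.rpow_mul hv0.le, ← Real.rpow_add_one hv0.ne']; congr 1; field_simp; ring
  have hpt : ∀ y, F.indicator (fun y => powerKernel l (x - y)) y
      ≤ (Metric.ball (0 : Rn n) R).indicator (powerKernel l) (x - y)
        + F.indicator (fun _ => ENNReal.ofReal (R ^ (-l))) y := by
    intro y
    by_cases hy : y ∈ F
    · rw [Set.indicator_of_mem hy, Set.indicator_of_mem hy]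
      by_cases hxy : x - y ∈ Metric.ball (0 : Rn n) R
      · rw [Set.indicator_of_mem hxy]; exact le_self_add
      · refine le_add_left (ENNReal.ofReal_le_ofReal ?_)
        have : R ≤ ‖x - y‖ := by simpa using hxy
        exact Real.rpow_le_rpow_of_nonpos hR0 this (by linarith)
    · rw [Set.indicator_of_notMem hy]; exact zero_le
  calc ∫⁻ y in F, powerKernel l (x - y)
      = ∫⁻ y, F.indicator (fun y => powerKernel l (x - y)) y := (lintegral_indicator hF _).symm
    _ ≤ ∫⁻ y, ((Metric.ball (0 : Rn n) R).indicator (powerKernel l) (x - y)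
        + F.indicator (fun _ => ENNReal.ofReal (R ^ (-l))) y) := lintegral_mono hpt
    _ = ENNReal.ofReal (R ^ (n - l)) * D + ENNReal.ofReal (R ^ (-l)) * volume F := by
        rw [lintegral_add_right _ (measurable_const.indicator hF),
          lintegral_sub_left_eq_self, lintegral_indicator measurableSet_ball,
          setLIntegral_powerKernel_ball hR0, lintegral_indicator hF, setLIntegral_const]
    _ = (D + 1) * volume F ^ (1 - l / n) := by
        rw [hvol, ← ENNReal.ofReal_mul (by positivity), hRl, hnl,
          ENNReal.ofReal_rpow_of_pos hv0]
        ring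

/-- A Hardy-type inequality for truncated integrals of `v^θ`. -/
theorem exists_setLIntegral_rpow_le {r θ : ℝ} (hθ0 : 0 < θ) (hθ1 : θ < 1)
    (hrθ : r * θ < 1) :
    ∃ C : ℝ≥0, ∀ v : ℝ → ℝ≥0∞, Measurable v →
      ∫⁻ b in Set.Ioi 0, v b * ENNReal.ofReal (b ^ (r - 1)) ≤ 1 →
      ∀ T : ℝ, 0 < T →
        ∫⁻ b in Set.Ioc 0 T, v b ^ θ ≤ C * ENNReal.ofReal (T ^ (1 - r * θ)) := by
  set e := (r - 1) * θ / (1 - θ) with he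
  have h1θ : 0 < 1 - θ := by linarith
  have he1 : e < 1 := by rw [he, div_lt_one h1θ]; linarith
  refine ⟨((1 - e)⁻¹ ^ (1 - θ)).toNNReal, fun v hv hv1 T hT => ?_⟩
  have hconj : (1 / θ).HolderConjugate (1 / (1 - θ)) := by
    rw [Real.holderConjugate_iff]
    refine ⟨by rw [lt_div_iff₀ hθ0]; linarith, ?_⟩
    simp
  have hsplit : ∫⁻ b in Set.Ioc 0 T, v b ^ θ
      = ∫⁻ b in Set.Ioc 0 T, ((fun b => (v b * ENNReal.ofReal (b ^ (r - 1))) ^ θ)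
        * (fun b => ENNReal.ofReal (b ^ (-((r - 1) * θ))))) b := by
    refine setLIntegral_congr_fun measurableSet_Ioc fun b hb => ?_
    have hb0 : 0 < b := hb.1
    simp only [Pi.mul_apply]
    rw [ENNReal.mul_rpow_of_nonneg _ _ hθ0.le, mul_assoc,
      ENNReal.ofReal_rpow_of_pos (by positivity), ← ENNReal.ofReal_mul (by positivity),
      ← Real.rpow_mul hb0.le, ← Real.rpow_add hb0]
    simp
  rw [hsplit]
  have hm1 : Measurable fun b : ℝ => v b * ENNReal.ofReal (b ^ (r - 1)) :=
    hv.mul (measurable_id.pow_const _).ennreal_ofReal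
  refine (ENNReal.lintegral_mul_le_Lp_mul_Lq _ hconj (hm1.pow_const _).aemeasurable
    (measurable_id.pow_const _).ennreal_ofReal.aemeasurable).trans ?_
  have hA : (∫⁻ b in Set.Ioc 0 T, ((v b * ENNReal.ofReal (b ^ (r - 1))) ^ θ) ^ (1 / θ)) ^ (1 / (1 / θ))
      ≤ 1 := by
    simp only [← ENNReal.rpow_mul, mul_one_div_cancel hθ0.ne', ENNReal.rpow_one]
    refine ENNReal.rpow_le_one ?_ (by positivity)
    exact (lintegral_mono_set Set.Ioc_subset_Ioi_self).trans hv1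
  have hB : ∫⁻ b in Set.Ioc 0 T, (ENNReal.ofReal (b ^ (-((r - 1) * θ)))) ^ (1 / (1 - θ))
      = ENNReal.ofReal (T ^ (1 - e) / (1 - e)) := by
    have h1 : ∫⁻ b in Set.Ioc 0 T, (ENNReal.ofReal (b ^ (-((r - 1) * θ)))) ^ (1 / (1 - θ))
        = ∫⁻ b in Set.Ioc 0 T, ENNReal.ofReal (b ^ (-e)) := by
      refine setLIntegral_congr_fun measurableSet_Ioc fun b hb => ?_
      have hb0 : 0 < b := hb.1
      rw [ENNReal.ofReal_rpow_of_pos (by positivity), ← Real.rpow_mul hb0.le]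
      congr 2
      rw [he]; ring
    have h2 : IntervalIntegrable (fun b : ℝ => b ^ (-e)) volume 0 T :=
      intervalIntegral.intervalIntegrable_rpow' (by linarith)
    rw [intervalIntegrable_iff_integrableOn_Ioc_of_le hT.le] at h2
    rw [h1, ← ofReal_integral_eq_lintegral_ofReal h2, ← intervalIntegral.integral_of_le hT.le,
      integral_rpow (Or.inl (by linarith))]
    · congr 1
      rw [show -e + 1 = 1 - e by ring, Real.zero_rpow (by linarith), sub_zero]
    · filter_upwards [ae_restrict_mem measurableSet_Ioc] with b hb
      exact Real.rpow_nonneg hb.1.le _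
  simp only [id]
  rw [hB]
  refine (mul_le_mul_left hA _).trans ?_
  have h1e : 0 < 1 - e := by linarith
  rw [one_mul, one_div_one_div, ENNReal.ofReal_rpow_of_nonneg (by positivity) h1θ.le,
    ← ENNReal.ofReal, ← ENNReal.ofReal_mul (by positivity)]
  refine ENNReal.ofReal_le_ofReal (le_of_eq ?_)
  rw [div_eq_mul_inv, Real.mul_rpow (by positivity) (by positivity), ← Real.rpow_mul hT.le, mul_comm]
  congr 2
  rw [he]; field_simp; ring

theorem lintegral_mul_ofReal_eq_lintegral_superlevel {X : Type*} [MeasurableSpace X]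
    (μ : Measure X) {w : X → ℝ≥0∞} (hw : Measurable w) {g : X → ℝ} (hg : Measurable g)
    (hg0 : ∀ x, 0 ≤ g x) :
    ∫⁻ y, w y * ENNReal.ofReal (g y) ∂μ = ∫⁻ b in Set.Ioi 0, ∫⁻ y in {y | b < g y}, w y ∂μ := by
  have h := lintegral_eq_lintegral_meas_lt (μ.withDensity w) (ae_of_all _ hg0) hg.aemeasurable
  rw [lintegral_withDensity_eq_lintegral_mul _ hw hg.ennreal_ofReal] at h
  simp only [Pi.mul_apply] at h
  rw [h]
  congr 1; funext b
  exact withDensity_apply _ (measurableSet_lt measurable_const hg)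

theorem lintegral_superlevel_rpow_le_one {X : Type*} [MeasurableSpace X] (μ : Measure X)
    {f : X → ℝ} (hf : Measurable f) (hf0 : ∀ x, 0 ≤ f x) {p : ℝ} (hp : 1 < p)
    (h : ∫⁻ x, ENNReal.ofReal (f x ^ p) ∂μ ≤ 1) :
    ∫⁻ a in Set.Ioi 0, μ {x | a < f x} * ENNReal.ofReal (a ^ (p - 1)) ≤ 1 := by
  rw [lintegral_rpow_eq_lintegral_meas_lt_mul μ (ae_of_all _ hf0) hf.aemeasurable
    (by linarith : 0 < p)] at h
  refine le_trans ?_ h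
  conv_lhs => rw [← one_mul (lintegral _ _)]
  gcongr
  rw [ENNReal.one_le_ofReal]
  exact hp.le

theorem measurable_meas_superlevel {X : Type*} [MeasurableSpace X] (μ : Measure X) (f : X → ℝ) :
    Measurable fun a : ℝ => μ {x | a < f x} :=
  Antitone.measurable fun _ _ hab => measure_mono fun _ hx => lt_of_le_of_lt hab hx

/-- The diagonal half of the level-set estimate. -/
theorem exists_lintegral_lintegral_Ioc_le {p r θ : ℝ} (hp : 1 < p) (hr : 1 < r) (hθ0 : 0 < θ)
    (hθ1 : θ < 1) (h : 1 / p + 1 / r = 1 + θ) :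
    ∃ C : ℝ≥0, ∀ u v : ℝ → ℝ≥0∞, Measurable u → Measurable v →
      ∫⁻ a in Set.Ioi 0, u a * ENNReal.ofReal (a ^ (p - 1)) ≤ 1 →
      ∫⁻ b in Set.Ioi 0, v b * ENNReal.ofReal (b ^ (r - 1)) ≤ 1 →
      ∫⁻ a in Set.Ioi 0, ∫⁻ b in Set.Ioc 0 (a ^ (p / r)), u a * v b ^ θ ≤ C := by
  have hp0 : 0 < p := by linarith
  have hr0 : 0 < r := by linarith
  have hrθ : r * θ < 1 := by
    have h1 : 1 / p < 1 := by rw [div_lt_one hp0]; exact hp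
    have h2 : θ < 1 / r := by linarith
    rwa [lt_div_iff₀ hr0, mul_comm] at h2
  obtain ⟨C, hC⟩ := exists_setLIntegral_rpow_le hθ0 hθ1 hrθ
  refine ⟨C, fun u v hu hv hu1 hv1 => ?_⟩
  calc ∫⁻ a in Set.Ioi 0, ∫⁻ b in Set.Ioc 0 (a ^ (p / r)), u a * v b ^ θ
      ≤ ∫⁻ a in Set.Ioi 0, C * (u a * ENNReal.ofReal (a ^ (p - 1))) := by
        refine setLIntegral_mono ?_ fun a ha => ?_
        · exact (hu.mul (measurable_id.pow_const _).ennreal_ofReal).const_mul _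
        have ha0 : (0 : ℝ) < a := ha
        rw [lintegral_const_mul _ (hv.pow_const _)]
        have h3 := hC v hv hv1 (a ^ (p / r)) (by positivity)
        rw [← Real.rpow_mul ha0.le] at h3
        have h4 : p / r * (1 - r * θ) = p - 1 := by
          have : θ = 1 / p + 1 / r - 1 := by linarith
          rw [this]; field_simp; ring
        rw [h4] at h3
        calc _ ≤ u a * (C * ENNReal.ofReal (a ^ (p - 1))) := by gcongr
          _ = _ := by ring
    _ = C * ∫⁻ a in Set.Ioi 0, u a * ENNReal.ofReal (a ^ (p - 1)) :=
        lintegral_const_mul' _ _ ENNReal.coe_ne_top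
    _ ≤ C * 1 := by gcongr
    _ = C := mul_one _

/-- The normalised bilinear Hardy–Littlewood–Sobolev inequality. -/
theorem exists_bilinear_powerKernel_le {n : ℕ} (hn : 0 < n) {p r l : ℝ} (hl0 : 0 < l) (hl : l < n)
    (hp : 1 < p) (hr : 1 < r) (h : 1 / p + 1 / r = 1 + (1 - l / n)) :
    ∃ C : ℝ≥0, ∀ f g : Rn n → ℝ, Measurable f → Measurable g → (∀ x, 0 ≤ f x) → (∀ x, 0 ≤ g x) →
      ∫⁻ x, ENNReal.ofReal (f x ^ p) ≤ 1 → ∫⁻ x, ENNReal.ofReal (g x ^ r) ≤ 1 →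
      ∫⁻ x, (∫⁻ y, powerKernel l (x - y) * ENNReal.ofReal (g y)) * ENNReal.ofReal (f x) ≤ C := by
  have hnR : (0 : ℝ) < n := by exact_mod_cast hn
  set θ := 1 - l / n with hθ
  have hθ0 : 0 < θ := by rw [hθ, sub_pos, div_lt_one hnR]; exact hl
  have hθ1 : θ < 1 := by rw [hθ]; linarith [div_pos hl0 hnR]
  have hp0 : 0 < p := by linarith
  have hr0 : 0 < r := by linarith
  obtain ⟨K, hK⟩ := exists_setLIntegral_powerKernel_le hl0 hl hn
  obtain ⟨C₁, hC₁⟩ := exists_lintegral_lintegral_Ioc_le hp hr hθ0 hθ1 h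
  obtain ⟨C₂, hC₂⟩ := exists_lintegral_lintegral_Ioc_le hr hp hθ0 hθ1 (by linarith)
  refine ⟨K * (C₁ + C₂), fun f g hf hg hf0 hg0 hf1 hg1 => ?_⟩
  set u : ℝ → ℝ≥0∞ := fun a => volume {x | a < f x} with hu
  set v : ℝ → ℝ≥0∞ := fun b => volume {y | b < g y} with hv
  have hum : Measurable u := measurable_meas_superlevel _ f
  have hvm : Measurable v := measurable_meas_superlevel _ g
  have hE : ∀ a, MeasurableSet {x | a < f x} := fun a => measurableSet_lt measurable_const hf
  have hF : ∀ b, MeasurableSet {y | b < g y} := fun b => measurableSet_lt measurable_const hg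
  set H : Rn n → ℝ → ℝ≥0∞ := fun x b => ∫⁻ y in {y | b < g y}, powerKernel l (x - y) with hH
  have hkm : ∀ x : Rn n, Measurable fun y => powerKernel l (x - y) := fun x =>
    (measurable_powerKernel l).comp (measurable_const.sub measurable_id)
  have hHm : Measurable (Function.uncurry H) := by
    have h1 : Function.uncurry H = fun z : Rn n × ℝ => ∫⁻ y,
        {w : (Rn n × ℝ) × Rn n | w.1.2 < g w.2}.indicator
          (fun w => powerKernel l (w.1.1 - w.2)) (z, y) := by
      funext ⟨x, b⟩
      simp only [Function.uncurry, hH]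
      rw [← lintegral_indicator (hF b)]
      rfl
    rw [h1]
    refine Measurable.lintegral_prod_right' ?_
    refine Measurable.indicator ?_ ?_
    · exact (measurable_powerKernel l).comp
        ((measurable_fst.comp measurable_fst).sub measurable_snd)
    · exact measurableSet_lt (measurable_snd.comp measurable_fst) (hg.comp measurable_snd)
  have hbound : ∀ a b, ∫⁻ x in {x | a < f x}, H x b ≤ K * (u a * v b ^ θ) := by
    intro a b
    calc ∫⁻ x in {x | a < f x}, H x b ≤ ∫⁻ x in {x | a < f x}, K * v b ^ θ :=
          lintegral_mono fun x => hK _ _ (hF b)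
      _ = K * (u a * v b ^ θ) := by rw [setLIntegral_const]; ring
  have hbound' : ∀ a b, ∫⁻ x in {x | a < f x}, H x b ≤ K * (v b * u a ^ θ) := by
    intro a b
    have hswap : ∫⁻ x in {x | a < f x}, H x b
        = ∫⁻ y in {y | b < g y}, ∫⁻ x in {x | a < f x}, powerKernel l (y - x) := by
      rw [lintegral_lintegral_swap]
      · simp only [powerKernel, norm_sub_rev]
      · exact ((measurable_powerKernel l).comp (measurable_fst.sub measurable_snd)).aemeasurable
    rw [hswap]
    calc _ ≤ ∫⁻ y in {y | b < g y}, K * u a ^ θ := lintegral_mono fun y => hK _ _ (hE a)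
      _ = K * (v b * u a ^ θ) := by rw [setLIntegral_const]; ring
  have hpt : ∀ a ∈ Set.Ioi (0 : ℝ), ∀ b ∈ Set.Ioi (0 : ℝ), ∫⁻ x in {x | a < f x}, H x b
      ≤ K * ({z : ℝ × ℝ | z.2 ≤ z.1 ^ (p / r)}.indicator (fun z => u z.1 * v z.2 ^ θ) (a, b)
        + {z : ℝ × ℝ | z.1 ≤ z.2 ^ (r / p)}.indicator (fun z => v z.2 * u z.1 ^ θ) (a, b)) := by
    intro a ha b hb
    have ha0 : (0 : ℝ) < a := ha
    have hb0 : (0 : ℝ) < b := hb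
    by_cases hab : b ≤ a ^ (p / r)
    · rw [Set.indicator_of_mem (show (a, b) ∈ {z : ℝ × ℝ | z.2 ≤ z.1 ^ (p / r)} from hab)]
      exact (hbound a b).trans (by gcongr; exact le_self_add)
    · have hab' : a ≤ b ^ (r / p) := by
        have h1 : (a ^ (p / r)) ^ (r / p) ≤ b ^ (r / p) :=
          Real.rpow_le_rpow (by positivity) (not_le.1 hab).le (by positivity)
        rwa [← Real.rpow_mul ha0.le, show p / r * (r / p) = 1 by field_simp, Real.rpow_one] at h1
      rw [Set.indicator_of_mem (show (a, b) ∈ {z : ℝ × ℝ | z.1 ≤ z.2 ^ (r / p)} from hab')]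
      exact (hbound' a b).trans (by gcongr; exact le_add_self)
  have hm1 : Measurable ({z : ℝ × ℝ | z.2 ≤ z.1 ^ (p / r)}.indicator
      (fun z => u z.1 * v z.2 ^ θ)) := by
    refine Measurable.indicator ?_ ?_
    · exact (hum.comp measurable_fst).mul ((hvm.comp measurable_snd).pow_const _)
    · exact measurableSet_le measurable_snd (measurable_fst.pow_const _)
  have hm2 : Measurable ({z : ℝ × ℝ | z.1 ≤ z.2 ^ (r / p)}.indicator
      (fun z => v z.2 * u z.1 ^ θ)) := by
    refine Measurable.indicator ?_ ?_
    · exact (hvm.comp measurable_snd).mul ((hum.comp measurable_fst).pow_const _)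
    · exact measurableSet_le measurable_fst (measurable_snd.pow_const _)
  have hJ : ∫⁻ x, (∫⁻ y, powerKernel l (x - y) * ENNReal.ofReal (g y)) * ENNReal.ofReal (f x)
      = ∫⁻ a in Set.Ioi 0, ∫⁻ b in Set.Ioi 0, ∫⁻ x in {x | a < f x}, H x b := by
    have h1 : ∀ x, ∫⁻ y, powerKernel l (x - y) * ENNReal.ofReal (g y)
        = ∫⁻ b in Set.Ioi 0, H x b := fun x =>
      lintegral_mul_ofReal_eq_lintegral_superlevel _ (hkm x) hg hg0
    simp only [h1]
    rw [lintegral_mul_ofReal_eq_lintegral_superlevel _ (w := fun x => ∫⁻ b in Set.Ioi 0, H x b)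
      hHm.lintegral_prod_right' hf hf0]
    congr 1; funext a
    exact lintegral_lintegral_swap hHm.aemeasurable
  rw [hJ]
  calc ∫⁻ a in Set.Ioi 0, ∫⁻ b in Set.Ioi 0, ∫⁻ x in {x | a < f x}, H x b
      ≤ ∫⁻ a in Set.Ioi (0 : ℝ), ∫⁻ b in Set.Ioi (0 : ℝ), K *
        ({z : ℝ × ℝ | z.2 ≤ z.1 ^ (p / r)}.indicator (fun z => u z.1 * v z.2 ^ θ) (a, b)
        + {z : ℝ × ℝ | z.1 ≤ z.2 ^ (r / p)}.indicator (fun z => v z.2 * u z.1 ^ θ) (a, b)) := by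
        refine setLIntegral_mono' measurableSet_Ioi fun a ha => ?_
        exact setLIntegral_mono' measurableSet_Ioi fun b hb => hpt a ha b hb
    _ = K * ((∫⁻ a in Set.Ioi (0 : ℝ), ∫⁻ b in Set.Ioi (0 : ℝ),
          {z : ℝ × ℝ | z.2 ≤ z.1 ^ (p / r)}.indicator (fun z => u z.1 * v z.2 ^ θ) (a, b))
        + ∫⁻ a in Set.Ioi (0 : ℝ), ∫⁻ b in Set.Ioi (0 : ℝ),
          {z : ℝ × ℝ | z.1 ≤ z.2 ^ (r / p)}.indicator (fun z => v z.2 * u z.1 ^ θ) (a, b)) := by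
        rw [← lintegral_add_left hm1.lintegral_prod_right',
          ← lintegral_const_mul' _ _ ENNReal.coe_ne_top]
        congr 1; funext a
        rw [lintegral_const_mul' _ _ ENNReal.coe_ne_top, lintegral_add_left]
        exact hm1.comp measurable_prodMk_left
    _ ≤ K * (C₁ + C₂) := by
        gcongr
        · refine le_trans (le_of_eq ?_) (hC₁ u v hum hvm
            (lintegral_superlevel_rpow_le_one _ hf hf0 hp hf1)
            (lintegral_superlevel_rpow_le_one _ hg hg0 hr hg1))
          congr 1; funext a
          rw [← Set.Ioi_inter_Iic, ← Set.inter_comm, ← Measure.restrict_restrict measurableSet_Iic,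
            ← lintegral_indicator measurableSet_Iic]
          rfl
        · rw [lintegral_lintegral_swap (f := fun a b =>
            {z : ℝ × ℝ | z.1 ≤ z.2 ^ (r / p)}.indicator (fun z => v z.2 * u z.1 ^ θ) (a, b))
            hm2.aemeasurable]
          refine le_trans (le_of_eq ?_) (hC₂ v u hvm hum
            (lintegral_superlevel_rpow_le_one _ hg hg0 hr hg1)
            (lintegral_superlevel_rpow_le_one _ hf hf0 hp hf1))
          congr 1; funext b
          rw [← Set.Ioi_inter_Iic, ← Set.inter_comm, ← Measure.restrict_restrict measurableSet_Iic,
            ← lintegral_indicator measurableSet_Iic]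
          rfl
    _ = _ := by push_cast; ring

theorem exists_normalized {X : Type*} [MeasurableSpace X] {μ : Measure X} {p : ℝ} (hp : 0 < p)
    {h : X → ℝ≥0∞} (hh : Measurable h) (h0 : (∫⁻ x, h x ^ p ∂μ) ^ (1 / p) ≠ 0)
    (htop : (∫⁻ x, h x ^ p ∂μ) ^ (1 / p) ≠ ∞) :
    ∃ g : X → ℝ, Measurable g ∧ (∀ x, 0 ≤ g x) ∧ ∫⁻ x, ENNReal.ofReal (g x ^ p) ∂μ ≤ 1 ∧
      h =ᵐ[μ] fun x => (∫⁻ x, h x ^ p ∂μ) ^ (1 / p) * ENNReal.ofReal (g x) := by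
  set N := (∫⁻ x, h x ^ p ∂μ) ^ (1 / p) with hN
  have hInt : ∫⁻ x, h x ^ p ∂μ = N ^ p := by
    rw [hN, ← ENNReal.rpow_mul, one_div_mul_cancel hp.ne', ENNReal.rpow_one]
  have hfin : ∀ᵐ x ∂μ, h x < ∞ := by
    have h1 : ∫⁻ x, h x ^ p ∂μ ≠ ∞ := by
      rw [hInt]; exact ENNReal.rpow_ne_top_of_nonneg hp.le htop
    filter_upwards [ae_lt_top (hh.pow_const p) h1] with x hx
    by_contra hcon
    simp [not_lt_top_iff.1 hcon, hp] at hx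
  have hreal : ∀ x, h x < ∞ → ENNReal.ofReal (h x / N).toReal = h x / N := fun x hx =>
    ENNReal.ofReal_toReal (ENNReal.div_ne_top hx.ne h0)
  refine ⟨fun x => (h x / N).toReal, (hh.div_const N).ennreal_toReal,
    fun x => ENNReal.toReal_nonneg, ?_, ?_⟩
  · calc ∫⁻ x, ENNReal.ofReal ((h x / N).toReal ^ p) ∂μ
        = ∫⁻ x, h x ^ p * (N ^ p)⁻¹ ∂μ := by
          refine lintegral_congr_ae ?_
          filter_upwards [hfin] with x hx
          rw [← ENNReal.ofReal_rpow_of_nonneg ENNReal.toReal_nonneg hp.le, hreal x hx,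
            ENNReal.div_rpow_of_nonneg _ _ hp.le, div_eq_mul_inv]
      _ = N ^ p * (N ^ p)⁻¹ := by rw [lintegral_mul_const _ (hh.pow_const p), hInt]
      _ ≤ 1 := ENNReal.mul_inv_le_one _
  · filter_upwards [hfin] with x hx
    rw [hreal x hx, ENNReal.mul_div_cancel h0 htop]

theorem ae_eq_zero_of_rpow_norm_eq_zero {X : Type*} [MeasurableSpace X] {μ : Measure X} {p : ℝ}
    (hp : 0 < p) {h : X → ℝ≥0∞} (hh : Measurable h) (h0 : (∫⁻ x, h x ^ p ∂μ) ^ (1 / p) = 0) :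
    h =ᵐ[μ] 0 := by
  have h1 : ∫⁻ x, h x ^ p ∂μ = 0 := by
    rcases ENNReal.rpow_eq_zero_iff.1 h0 with h | h
    · exact h.1
    · exact absurd h.2 (not_lt.2 (by positivity))
  rw [lintegral_eq_zero_iff (hh.pow_const p)] at h1
  filter_upwards [h1] with x hx
  simpa [hp, hp.le, not_lt.2 hp.le] using hx

/-- The Hardy–Littlewood–Sobolev inequality. -/
theorem exists_hardyLittlewoodSobolev {n : ℕ} (hn : 0 < n) {p q l : ℝ} (hl0 : 0 < l) (hl : l < n)
    (hp : 1 < p) (hq : 1 < q) (h : 1 / q = 1 / p - (1 - l / n)) :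
    ∃ C : ℝ≥0, ∀ f : Rn n → ℝ≥0∞, Measurable f →
      (∫⁻ x, (∫⁻ y, powerKernel l (x - y) * f y) ^ q) ^ (1 / q)
        ≤ C * (∫⁻ x, f x ^ p) ^ (1 / p) := by
  have hqr := Real.HolderConjugate.conjExponent hq
  set r := q.conjExponent with hr
  have hr1 : 1 < r := hqr.symm.lt
  have hp0 : 0 < p := by linarith
  obtain ⟨C, hC⟩ := exists_bilinear_powerKernel_le hn hl0 hl hr1 hp (by
    have := hqr.inv_add_inv_eq_one
    rw [← one_div, ← one_div] at this
    linarith)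
  refine ⟨C + 1, fun f hf => ?_⟩
  rw [ENNReal.coe_add, ENNReal.coe_one]
  have hC1 : (C : ℝ≥0∞) + 1 ≠ 0 := by simp
  have hkm : Measurable (Function.uncurry fun x y : Rn n => powerKernel l (x - y) * f y) :=
    ((measurable_powerKernel l).comp (measurable_fst.sub measurable_snd)).mul
      (hf.comp measurable_snd)
  rcases eq_or_ne ((∫⁻ x, f x ^ p) ^ (1 / p)) ∞ with htop | htop
  · rw [htop, ENNReal.mul_top hC1]; exact le_top
  rcases eq_or_ne ((∫⁻ x, f x ^ p) ^ (1 / p)) 0 with h0 | h0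
  · have hf0 := ae_eq_zero_of_rpow_norm_eq_zero hp0 hf h0
    have : ∀ x : Rn n, ∫⁻ y, powerKernel l (x - y) * f y = 0 := by
      intro x
      rw [← lintegral_zero (α := Rn n) (μ := volume)]
      refine lintegral_congr_ae ?_
      filter_upwards [hf0] with y hy
      simp [hy]
    simp [this, show 0 < q by linarith]
  obtain ⟨f', hmf, hzf, hof, hf'⟩ := exists_normalized hp0 hf h0 htop
  set N := (∫⁻ x, f x ^ p) ^ (1 / p) with hN
  refine lintegral_rpow_le_of_dual hqr hkm.lintegral_prod_right' fun g hg => ?_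
  rcases eq_or_ne ((∫⁻ x, g x ^ r) ^ (1 / r)) ∞ with gtop | gtop
  · rw [gtop, ENNReal.mul_top (mul_ne_zero hC1 h0)]; exact le_top
  rcases eq_or_ne ((∫⁻ x, g x ^ r) ^ (1 / r)) 0 with g0 | g0
  · have hg0 := ae_eq_zero_of_rpow_norm_eq_zero (by linarith) hg g0
    rw [lintegral_congr_ae (g := fun _ => 0), lintegral_zero]
    · exact zero_le
    · filter_upwards [hg0] with x hx
      simp [hx]
  obtain ⟨g', hmg, hzg, hog, hg'⟩ := exists_normalized (by linarith) hg g0 gtop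
  set Ng := (∫⁻ x, g x ^ r) ^ (1 / r) with hNg
  have hin : ∀ x : Rn n, ∫⁻ y, powerKernel l (x - y) * f y
      = N * ∫⁻ y, powerKernel l (x - y) * ENNReal.ofReal (f' y) := by
    intro x
    rw [← lintegral_const_mul' _ _ htop]
    refine lintegral_congr_ae ?_
    filter_upwards [hf'] with y hy
    rw [hy]; ring
  calc ∫⁻ x, (∫⁻ y, powerKernel l (x - y) * f y) * g x
      = ∫⁻ x, (N * Ng) * ((∫⁻ y, powerKernel l (x - y) * ENNReal.ofReal (f' y))
          * ENNReal.ofReal (g' x)) := by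
        refine lintegral_congr_ae ?_
        filter_upwards [hg'] with x hx
        rw [hin, hx]; ring
    _ = (N * Ng) * ∫⁻ x, (∫⁻ y, powerKernel l (x - y) * ENNReal.ofReal (f' y))
          * ENNReal.ofReal (g' x) := lintegral_const_mul' _ _ (ENNReal.mul_ne_top htop gtop)
    _ ≤ (N * Ng) * (C + 1) := by
        gcongr
        exact (hC g' f' hmg hmf hzg hzf hog hof).trans le_self_add
    _ = (C + 1) * N * Ng := by ring

/-- The weight `(1+|x|)^{-s}` with values in `[0,∞]`. -/
noncomputable def polyWeight {n : ℕ} (s : ℝ) (x : Rn n) : ℝ≥0∞ := ENNReal.ofReal ((1 + ‖x‖) ^ (-s))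

theorem measurable_polyWeight {n : ℕ} (s : ℝ) : Measurable (polyWeight (n := n) s) := by
  unfold polyWeight
  exact ((measurable_const.add measurable_norm).pow_const _).ennreal_ofReal

theorem lintegral_polyWeight_lt_top {n : ℕ} {s : ℝ} (hs : n < s) :
    ∫⁻ x : Rn n, polyWeight s x < ∞ :=
  (integrable_one_add_norm (by simpa using hs)).lintegral_lt_top

theorem polyWeight_rpow {n : ℕ} (s r : ℝ) (x : Rn n) :
    polyWeight s x ^ r = polyWeight (s * r) x := by
  have : 0 < 1 + ‖x‖ := by positivity
  rw [polyWeight, polyWeight, ENNReal.ofReal_rpow_of_pos (by positivity), ← Real.rpow_mul this.le,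
    neg_mul]

theorem polyWeight_le_one {n : ℕ} {s : ℝ} (hs : 0 ≤ s) (x : Rn n) : polyWeight s x ≤ 1 := by
  rw [polyWeight, ENNReal.ofReal_le_one]
  exact Real.rpow_le_one_of_one_le_of_nonpos (by simp) (by linarith)

theorem lintegral_polyWeight_rpow_ne_top {n : ℕ} {s r : ℝ} (h : n < s * r) (hr : 0 < r) :
    (∫⁻ x : Rn n, polyWeight s x ^ r) ^ (1 / r) ≠ ∞ := by
  simp only [polyWeight_rpow]
  exact ENNReal.rpow_ne_top_of_nonneg (by positivity) (lintegral_polyWeight_lt_top h).ne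

/-- Young's inequality for convolution with an `L¹` kernel. -/
theorem lintegral_convolution_rpow_le {n : ℕ} {q : ℝ} (hq : 1 < q) {k F : Rn n → ℝ≥0∞}
    (hk : Measurable k) (hF : Measurable F) :
    (∫⁻ y, (∫⁻ x, k (x - y) * F x) ^ q) ^ (1 / q) ≤ (∫⁻ x, k x) * (∫⁻ x, F x ^ q) ^ (1 / q) := by
  have hq0 : 0 < q := by linarith
  have h1 : ∀ y, ∫⁻ x, k (x - y) * F x = ∫⁻ z, k z * F (z + y) := by
    intro y
    rw [← lintegral_add_right_eq_self _ y]
    simp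
  simp only [h1]
  refine (lintegral_rpow_lintegral_le hq (F := fun y z => k z * F (z + y)) ?_).trans ?_
  · exact (hk.comp measurable_snd).mul (hF.comp (measurable_snd.add measurable_fst))
  rw [← lintegral_mul_const _ hk]
  refine lintegral_mono fun z => le_of_eq ?_
  simp only [ENNReal.mul_rpow_of_nonneg _ _ hq0.le]
  have hm : Measurable fun x => F (z + x) ^ q :=
    (hF.comp (measurable_const.add measurable_id)).pow_const q
  rw [lintegral_const_mul _ hm,
    ENNReal.mul_rpow_of_nonneg _ _ (by positivity), ← ENNReal.rpow_mul,
    mul_one_div_cancel hq0.ne', ENNReal.rpow_one,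
    lintegral_add_left_eq_self (fun y => F y ^ q) z]

/-- The frequency side estimate. -/
theorem exists_polyWeight_convolution_le {n : ℕ} (hn : 0 < n) {s N q₁ q₂ : ℝ} (hs : 0 ≤ s)
    (hN : n < N) (hq₁ : 1 < q₁) (hq₂ : 1 < q₂) (h : 1 / q₂ < 1 / q₁ + s / n) :
    ∃ C : ℝ≥0, ∀ F : Rn n → ℝ≥0∞, Measurable F →
      (∫⁻ y, (∫⁻ x, polyWeight s x * polyWeight N (x - y) * F x) ^ q₂) ^ (1 / q₂)
        ≤ C * (∫⁻ x, F x ^ q₁) ^ (1 / q₁) := by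
  have hnR : (0 : ℝ) < n := by exact_mod_cast hn
  have hq₁0 : 0 < q₁ := by linarith
  have hq₂0 : 0 < q₂ := by linarith
  set D := ∫⁻ x : Rn n, polyWeight N x with hD
  have hDtop : D ≠ ∞ := (lintegral_polyWeight_lt_top hN).ne
  rcases lt_or_ge q₂ q₁ with hlt | hge
  · set r := (1 / q₂ - 1 / q₁)⁻¹ with hr
    have hpos : 0 < 1 / q₂ - 1 / q₁ := by
      have := one_div_lt_one_div_of_lt hq₂0 hlt
      linarith
    have hr0 : 0 < r := by positivity
    have hrinv : 1 / r = 1 / q₂ - 1 / q₁ := by rw [hr, one_div, inv_inv]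
    have hsr : (n : ℝ) < s * r := by
      have h1 : 1 / r < s / n := by linarith
      rwa [div_lt_div_iff₀ hr0 hnR, one_mul] at h1
    set E := (∫⁻ x : Rn n, polyWeight s x ^ r) ^ (1 / r) with hE
    have hEtop : E ≠ ∞ := lintegral_polyWeight_rpow_ne_top hsr hr0
    refine ⟨(D * E).toNNReal, fun F hF => ?_⟩
    rw [ENNReal.coe_toNNReal (ENNReal.mul_ne_top hDtop hEtop)]
    have h1 := lintegral_convolution_rpow_le hq₂ (measurable_polyWeight N)
      (hF.mul (measurable_polyWeight s))
    have h2 := ENNReal.lintegral_Lp_mul_le_Lq_mul_Lr hq₂0 hlt (r := r) (by linarith) volume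
      hF.aemeasurable (measurable_polyWeight (n := n) s).aemeasurable
    calc _ = (∫⁻ y, (∫⁻ x, polyWeight N (x - y) * (F * polyWeight s : Rn n → ℝ≥0∞) x) ^ q₂) ^ (1 / q₂) := by
          congr 3; funext y; congr 2; funext x
          simp only [Pi.mul_apply]; ring
      _ ≤ D * (∫⁻ x, (F * polyWeight s : Rn n → ℝ≥0∞) x ^ q₂) ^ (1 / q₂) := h1
      _ ≤ D * ((∫⁻ x, F x ^ q₁) ^ (1 / q₁) * E) := by gcongr
      _ = _ := by ring
  · have hqr := Real.HolderConjugate.conjExponent hq₁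
    set r := q₁.conjExponent with hr
    have hr1 : 1 < r := hqr.symm.lt
    have hr0 : 0 < r := by linarith
    set E := (∫⁻ x : Rn n, polyWeight N x ^ r) ^ (1 / r) with hE
    have hEtop : E ≠ ∞ := lintegral_polyWeight_rpow_ne_top (by nlinarith) hr0
    have hdiff : 0 ≤ q₂ - q₁ := by linarith
    refine ⟨(E ^ ((q₂ - q₁) / q₂) * D ^ (q₁ / q₂)).toNNReal, fun F hF => ?_⟩
    rw [ENNReal.coe_toNNReal (ENNReal.mul_ne_top
      (ENNReal.rpow_ne_top_of_nonneg (by positivity) hEtop)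
      (ENNReal.rpow_ne_top_of_nonneg (by positivity) hDtop))]
    set NF := (∫⁻ x, F x ^ q₁) ^ (1 / q₁) with hNF
    set G : Rn n → ℝ≥0∞ := fun y => ∫⁻ x, polyWeight N (x - y) * F x with hG
    have hle : ∀ y, ∫⁻ x, polyWeight s x * polyWeight N (x - y) * F x ≤ G y := by
      intro y
      refine lintegral_mono fun x => ?_
      gcongr
      exact mul_le_of_le_one_left zero_le (polyWeight_le_one hs x)
    have hsup : ∀ y, G y ≤ NF * E := by
      intro y
      have h1 := ENNReal.lintegral_mul_le_Lp_mul_Lq volume hqr hF.aemeasurable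
        ((measurable_polyWeight (n := n) N).comp
          (measurable_id.sub (measurable_const (a := y)))).aemeasurable
      refine le_trans (le_of_eq ?_) (h1.trans (le_of_eq ?_))
      · refine lintegral_congr fun x => ?_
        simp [mul_comm]
      · congr 2
        exact lintegral_sub_right_eq_self (fun x => polyWeight N x ^ r) y
    have hY := lintegral_convolution_rpow_le hq₁ (measurable_polyWeight N) hF
    have hY' : ∫⁻ y, G y ^ q₁ ≤ (D * NF) ^ q₁ := by
      calc ∫⁻ y, G y ^ q₁ = ((∫⁻ y, G y ^ q₁) ^ (1 / q₁)) ^ q₁ := by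
            rw [← ENNReal.rpow_mul, one_div_mul_cancel hq₁0.ne', ENNReal.rpow_one]
        _ ≤ _ := by gcongr
    calc _ ≤ (∫⁻ y, G y ^ q₂) ^ (1 / q₂) := by gcongr with y; exact hle y
      _ ≤ (∫⁻ y, (NF * E) ^ (q₂ - q₁) * G y ^ q₁) ^ (1 / q₂) := by
          gcongr with y
          calc G y ^ q₂ = G y ^ (q₂ - q₁) * G y ^ q₁ := by
                rw [← ENNReal.rpow_add_of_nonneg _ _ hdiff hq₁0.le]; congr 1; ring
            _ ≤ _ := by gcongr; exact hsup y
      _ = ((NF * E) ^ (q₂ - q₁) * ∫⁻ y, G y ^ q₁) ^ (1 / q₂) := by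
          congr 1
          refine lintegral_const_mul _ (Measurable.pow_const ?_ _)
          exact Measurable.lintegral_prod_right' (f := fun z : Rn n × Rn n =>
            polyWeight N (z.2 - z.1) * F z.2) (((measurable_polyWeight N).comp
              (measurable_snd.sub measurable_fst)).mul (hF.comp measurable_snd))
      _ ≤ ((NF * E) ^ (q₂ - q₁) * (D * NF) ^ q₁) ^ (1 / q₂) := by gcongr
      _ = _ := by
          rw [ENNReal.mul_rpow_of_nonneg _ _ (by positivity), ← ENNReal.rpow_mul,
            ← ENNReal.rpow_mul, mul_one_div, mul_one_div,
            ENNReal.mul_rpow_of_nonneg _ _ (by positivity),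
            ENNReal.mul_rpow_of_nonneg _ _ (by positivity)]
          have h3 : NF ^ ((q₂ - q₁) / q₂) * NF ^ (q₁ / q₂) = NF := by
            rw [← ENNReal.rpow_add_of_nonneg _ _ (by positivity) (by positivity),
              ← add_div, sub_add_cancel, div_self hq₂0.ne', ENNReal.rpow_one]
          calc _ = E ^ ((q₂ - q₁) / q₂) * D ^ (q₁ / q₂)
                * (NF ^ ((q₂ - q₁) / q₂) * NF ^ (q₁ / q₂)) := by ring
            _ = _ := by rw [h3]

/-- The mixed norm `L^q_ξ(L^p_x)` of a nonnegative function of `(x, ξ)`. -/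
noncomputable def mixedNorm {n : ℕ} (p q : ℝ) (Φ : Rn n → Rn n → ℝ≥0∞) : ℝ≥0∞ :=
  (∫⁻ ξ, ((∫⁻ x, Φ x ξ ^ p) ^ (1 / p)) ^ q) ^ (1 / q)

theorem measurable_lintegral_rpow {n : ℕ} {p : ℝ} {Φ : Rn n → Rn n → ℝ≥0∞}
    (hΦ : Measurable (Function.uncurry Φ)) :
    Measurable fun ξ => (∫⁻ x, Φ x ξ ^ p) ^ (1 / p) :=
  Measurable.pow_const (Measurable.lintegral_prod_left' (hΦ.pow_const p)) _

theorem mixedNorm_mono {n : ℕ} {p q : ℝ} (hp : 0 ≤ p) (hq : 0 ≤ q) {Φ Ψ : Rn n → Rn n → ℝ≥0∞}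
    (h : ∀ x ξ, Φ x ξ ≤ Ψ x ξ) : mixedNorm p q Φ ≤ mixedNorm p q Ψ := by
  unfold mixedNorm
  gcongr with ξ x
  exact h x ξ

/-- Hölder's inequality in mixed norm spaces. -/
theorem lintegral_mul_le_mixedNorm {n : ℕ} {p q : ℝ} (hp : 1 < p) (hq : 1 < q)
    {Φ Ψ : Rn n → Rn n → ℝ≥0∞} (hΦ : Measurable (Function.uncurry Φ))
    (hΨ : Measurable (Function.uncurry Ψ)) :
    ∫⁻ ξ, ∫⁻ x, Φ x ξ * Ψ x ξ
      ≤ mixedNorm p q Φ * mixedNorm p.conjExponent q.conjExponent Ψ := by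
  have hp' := Real.HolderConjugate.conjExponent hp
  have hq' := Real.HolderConjugate.conjExponent hq
  refine le_trans (lintegral_mono fun ξ => ?_) (ENNReal.lintegral_mul_le_Lp_mul_Lq volume hq'
    (measurable_lintegral_rpow (p := p) hΦ).aemeasurable
    (measurable_lintegral_rpow (p := p.conjExponent) hΨ).aemeasurable)
  exact ENNReal.lintegral_mul_le_Lp_mul_Lq volume hp'
    (hΦ.comp measurable_prodMk_right).aemeasurable (hΨ.comp measurable_prodMk_right).aemeasurable

theorem mixedNorm_mul {n : ℕ} {p q : ℝ} (hp : 0 < p) (hq : 0 < q) {a b : Rn n → ℝ≥0∞}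
    (ha : Measurable a) (hb : Measurable b) :
    mixedNorm p q (fun x ξ => a x * b ξ)
      = (∫⁻ x, a x ^ p) ^ (1 / p) * (∫⁻ ξ, b ξ ^ q) ^ (1 / q) := by
  unfold mixedNorm
  have h1 : ∀ ξ, (∫⁻ x, (a x * b ξ) ^ p) ^ (1 / p) = (∫⁻ x, a x ^ p) ^ (1 / p) * b ξ := by
    intro ξ
    simp only [ENNReal.mul_rpow_of_nonneg _ _ hp.le]
    rw [lintegral_mul_const _ (ha.pow_const p), ENNReal.mul_rpow_of_nonneg _ _ (by positivity),
      ← ENNReal.rpow_mul, mul_one_div_cancel hp.ne', ENNReal.rpow_one]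
  simp only [h1, ENNReal.mul_rpow_of_nonneg _ _ hq.le]
  rw [lintegral_const_mul _ (hb.pow_const q), ENNReal.mul_rpow_of_nonneg _ _ (by positivity),
    ← ENNReal.rpow_mul, mul_one_div_cancel hq.ne', ENNReal.rpow_one]

theorem polyWeight_le_powerKernel {n : ℕ} {s l : ℝ} (hl : 0 ≤ l) (hls : l ≤ s) {x : Rn n}
    (hx : x ≠ 0) : polyWeight s x ≤ powerKernel l x := by
  refine ENNReal.ofReal_le_ofReal ?_
  have hx0 : 0 < ‖x‖ := norm_pos_iff.2 hx
  calc (1 + ‖x‖) ^ (-s) ≤ (1 + ‖x‖) ^ (-l) :=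
        Real.rpow_le_rpow_of_exponent_le (by linarith) (by linarith)
    _ ≤ ‖x‖ ^ (-l) := Real.rpow_le_rpow_of_nonpos hx0 (by linarith) (by linarith)

/-- The boundedness on mixed norm spaces of the model operator. -/
theorem exists_mixedNorm_model_le {n : ℕ} (hn : 0 < n) {α N p₁ p₂ q₁ q₂ : ℝ} (hα : 0 < α)
    (hN : n < N) (hp₁ : 1 < p₁) (hp₂ : 1 < p₂) (hq₁ : 1 < q₁) (hq₂ : 1 < q₂)
    (hp : 1 / p₂ ≤ 1 / p₁ - α / n) (hq : 1 / q₂ < 1 / q₁ + α / n) :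
    ∃ C : ℝ≥0, ∀ Φ : Rn n → Rn n → ℝ≥0∞, Measurable (Function.uncurry Φ) →
      mixedNorm p₂ q₂ (fun y η => ∫⁻ ξ, ∫⁻ x,
        polyWeight α ξ * polyWeight N (ξ - η) * polyWeight (n - α) (y - x) * Φ x ξ)
        ≤ C * mixedNorm p₁ q₁ Φ := by
  have hnR : (0 : ℝ) < n := by exact_mod_cast hn
  set l := n * (1 - (1 / p₁ - 1 / p₂)) with hl
  have hl0 : 0 < l := by
    have h1 : 1 / p₁ < 1 := by rw [div_lt_one (by linarith)]; exact hp₁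
    have h2 : 0 < 1 / p₂ := by positivity
    have : 0 < 1 - (1 / p₁ - 1 / p₂) := by linarith
    positivity
  have hlα : l ≤ n - α := by
    have h1 : α / n ≤ 1 / p₁ - 1 / p₂ := by linarith
    rw [div_le_iff₀ hnR] at h1
    rw [hl]; linarith
  have hln : 1 - l / n = 1 / p₁ - 1 / p₂ := by rw [hl]; field_simp; ring
  obtain ⟨C₁, hC₁⟩ := exists_hardyLittlewoodSobolev hn hl0 (by linarith) hp₁ hp₂
    (by rw [hln]; ring)
  obtain ⟨C₂, hC₂⟩ := exists_polyWeight_convolution_le hn hα.le hN hq₁ hq₂ hq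
  refine ⟨C₁ * C₂, fun Φ hΦ => ?_⟩
  have hw : Measurable fun z : Rn n × Rn n => polyWeight α z.1 * polyWeight N (z.1 - z.2) :=
    ((measurable_polyWeight α).comp measurable_fst).mul
      ((measurable_polyWeight N).comp (measurable_fst.sub measurable_snd))
  set Ψ : Rn n → Rn n → ℝ≥0∞ := fun η x =>
    ∫⁻ ξ, polyWeight α ξ * polyWeight N (ξ - η) * Φ x ξ with hΨ
  have hInt : ∀ η, Measurable fun z : Rn n × Rn n =>
      polyWeight α z.2 * polyWeight N (z.2 - η) * Φ z.1 z.2 := fun η =>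
    (hw.comp (measurable_snd.prodMk measurable_const)).mul hΦ
  have hΨm : ∀ η, Measurable (Ψ η) := fun η => (hInt η).lintegral_prod_right'
  set P : Rn n → ℝ≥0∞ := fun ξ => (∫⁻ x, Φ x ξ ^ p₁) ^ (1 / p₁) with hP
  have hPm : Measurable P := measurable_lintegral_rpow hΦ
  have hinner : ∀ η, (∫⁻ y, (∫⁻ ξ, ∫⁻ x, polyWeight α ξ * polyWeight N (ξ - η)
      * polyWeight (n - α) (y - x) * Φ x ξ) ^ p₂) ^ (1 / p₂)
      ≤ C₁ * ∫⁻ ξ, polyWeight α ξ * polyWeight N (ξ - η) * P ξ := by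
    intro η
    have h1 : ∀ y, ∫⁻ ξ, ∫⁻ x, polyWeight α ξ * polyWeight N (ξ - η)
        * polyWeight (n - α) (y - x) * Φ x ξ ≤ ∫⁻ x, powerKernel l (y - x) * Ψ η x := by
      intro y
      rw [lintegral_lintegral_swap]
      · refine lintegral_mono_ae ?_
        have hae : ∀ᵐ x : Rn n, x ≠ y := by
          have := nontrivial_Rn hn
          exact Measure.ae_ne volume y
        filter_upwards [hae] with x hx
        rw [hΨ, ← lintegral_const_mul' _ _ (show powerKernel l (y - x) ≠ ∞ from
          ENNReal.ofReal_ne_top)]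
        refine lintegral_mono fun ξ => ?_
        calc _ = polyWeight (n - α) (y - x) * (polyWeight α ξ * polyWeight N (ξ - η) * Φ x ξ) := by
              ring
          _ ≤ _ := by
              gcongr
              exact polyWeight_le_powerKernel hl0.le hlα (sub_ne_zero.2 hx.symm)
      · exact ((hw.comp (measurable_fst.prodMk measurable_const)).mul
          ((measurable_polyWeight _).comp (measurable_const.sub measurable_snd))).mul
          (hΦ.comp measurable_swap) |>.aemeasurable
    calc _ ≤ (∫⁻ y, (∫⁻ x, powerKernel l (y - x) * Ψ η x) ^ p₂) ^ (1 / p₂) := by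
          exact ENNReal.rpow_le_rpow (lintegral_mono fun y =>
            ENNReal.rpow_le_rpow (h1 y) (by linarith)) (by positivity)
      _ ≤ C₁ * (∫⁻ x, Ψ η x ^ p₁) ^ (1 / p₁) := hC₁ _ (hΨm η)
      _ ≤ C₁ * ∫⁻ ξ, (∫⁻ x, (polyWeight α ξ * polyWeight N (ξ - η) * Φ x ξ) ^ p₁) ^ (1 / p₁) := by
          gcongr
          exact lintegral_rpow_lintegral_le hp₁ (hInt η)
      _ = _ := by
          congr 2; funext ξ
          have hp0 : 0 < p₁ := by linarith
          simp only [ENNReal.mul_rpow_of_nonneg _ _ hp0.le]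
          have hm : Measurable fun x => Φ x ξ ^ p₁ :=
            (hΦ.comp measurable_prodMk_right).pow_const p₁
          rw [lintegral_const_mul _ hm,
            ENNReal.mul_rpow_of_nonneg _ _ (by positivity),
            ← ENNReal.mul_rpow_of_nonneg _ _ hp0.le, ← ENNReal.rpow_mul,
            mul_one_div_cancel hp0.ne', ENNReal.rpow_one]
  unfold mixedNorm
  have hq0 : 0 < q₂ := by linarith
  calc _ ≤ (∫⁻ η, (C₁ * ∫⁻ ξ, polyWeight α ξ * polyWeight N (ξ - η) * P ξ) ^ q₂) ^ (1 / q₂) := by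
        gcongr with η; exact hinner η
    _ = C₁ * (∫⁻ η, (∫⁻ ξ, polyWeight α ξ * polyWeight N (ξ - η) * P ξ) ^ q₂) ^ (1 / q₂) := by
        simp only [ENNReal.mul_rpow_of_nonneg _ _ hq0.le]
        rw [lintegral_const_mul' _ _ (ENNReal.rpow_ne_top_of_nonneg hq0.le ENNReal.coe_ne_top),
          ENNReal.mul_rpow_of_nonneg _ _ (by positivity), ← ENNReal.rpow_mul,
          mul_one_div_cancel hq0.ne', ENNReal.rpow_one]
    _ ≤ C₁ * (C₂ * (∫⁻ ξ, P ξ ^ q₁) ^ (1 / q₁)) := by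
        gcongr
        exact hC₂ P hPm
    _ = _ := by rw [ENNReal.coe_mul, mul_assoc]

variable {n : ℕ}

/-- The norm dominating all Schwartz seminorms of order at most `(k, m)`. -/
noncomputable abbrev schwartzNorm (k m : ℕ) : Seminorm ℂ 𝓢(Rn n, ℂ) :=
  (Finset.Iic (k, m)).sup (schwartzSeminormFamily ℂ (Rn n) ℂ)

theorem schwartzNorm_mono {k m k' m' : ℕ} (hk : k ≤ k') (hm : m ≤ m') (f : 𝓢(Rn n, ℂ)) :
    schwartzNorm k m f ≤ schwartzNorm k' m' f :=
  Finset.sup_mono (f := schwartzSeminormFamily ℂ (Rn n) ℂ)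
    (Finset.Iic_subset_Iic.2 (Prod.mk_le_mk.2 ⟨hk, hm⟩)) f

theorem one_add_pow_mul_norm_iteratedFDeriv_le {k m j : ℕ} (hj : j ≤ m) (f : 𝓢(Rn n, ℂ))
    (x : Rn n) :
    (1 + ‖x‖) ^ k * ‖iteratedFDeriv ℝ j f x‖ ≤ 2 ^ k * schwartzNorm k m f :=
  one_add_le_sup_seminorm_apply (𝕜 := ℂ) (m := (k, m)) le_rfl hj f x

theorem schwartzNorm_le_of_bound {k m : ℕ} {f : 𝓢(Rn n, ℂ)} {B : ℝ} (hB : 0 ≤ B)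
    (h : ∀ j ≤ m, ∀ x, (1 + ‖x‖) ^ k * ‖iteratedFDeriv ℝ j f x‖ ≤ B) :
    schwartzNorm k m f ≤ B := by
  refine Seminorm.finset_sup_apply_le hB fun i hi => ?_
  obtain ⟨k', j⟩ := i
  simp only [Finset.mem_Iic, Prod.mk_le_mk] at hi
  refine SchwartzMap.seminorm_le_bound ℂ k' j f hB fun x => le_trans ?_ (h j hi.2 x)
  gcongr
  calc ‖x‖ ^ k' ≤ (1 + ‖x‖) ^ k' := by gcongr; linarith
    _ ≤ (1 + ‖x‖) ^ k := pow_le_pow_right₀ (by linarith [norm_nonneg x]) hi.1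

theorem exists_schwartzNorm_clm_le (A : 𝓢(Rn n, ℂ) →L[ℂ] 𝓢(Rn n, ℂ)) (k m : ℕ) :
    ∃ (k' m' : ℕ) (C : ℝ), 0 ≤ C ∧ ∀ f, schwartzNorm k m (A f) ≤ C * schwartzNorm k' m' f := by
  have hcont : Continuous ((schwartzNorm k m).comp (A : 𝓢(Rn n, ℂ) →ₗ[ℂ] 𝓢(Rn n, ℂ))) := by
    have h1 : Continuous (schwartzNorm (n := n) k m) :=
      (schwartz_withSeminorms ℂ (Rn n) ℂ).finset_sups.continuous_seminorm (Finset.Iic (k, m))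
    exact h1.comp A.continuous
  obtain ⟨s, C, -, hs⟩ := Seminorm.bound_of_continuous (schwartz_withSeminorms ℂ (Rn n) ℂ) _ hcont
  refine ⟨s.sup Prod.fst, s.sup Prod.snd, C, C.2, fun f => (hs f).trans ?_⟩
  change (C : ℝ) * (s.sup (schwartzSeminormFamily ℂ (Rn n) ℂ)) f ≤ _
  refine mul_le_mul_of_nonneg_left ?_ C.2
  refine Finset.sup_mono (f := schwartzSeminormFamily ℂ (Rn n) ℂ) (fun i hi => ?_) f
  rw [Finset.mem_Iic]
  exact ⟨Finset.le_sup (f := Prod.fst) hi, Finset.le_sup (f := Prod.snd) hi⟩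

/-- `a` is smooth and its derivatives of order at most `m` are dominated by `ω`. -/
def DerivBound (m : ℕ) (a : Rn n → ℂ) (ω : Rn n → ℝ) : Prop :=
  ContDiff ℝ (⊤ : ℕ∞) a ∧ ∀ j ≤ m, ∀ w, ‖iteratedFDeriv ℝ j a w‖ ≤ ω w

theorem DerivBound.nonneg {m : ℕ} {a : Rn n → ℂ} {ω : Rn n → ℝ} (h : DerivBound m a ω)
    (w : Rn n) : 0 ≤ ω w := (norm_nonneg _).trans (h.2 0 (Nat.zero_le _) w)

theorem sum_choose_mul_le {j : ℕ} {a : ℕ → ℝ} {B : ℝ} (h : ∀ i ≤ j, a i ≤ B) :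
    ∑ i ∈ Finset.range (j + 1), (j.choose i : ℝ) * a i ≤ 2 ^ j * B := by
  have hs : (∑ i ∈ Finset.range (j + 1), (j.choose i : ℝ)) = 2 ^ j := by
    exact_mod_cast Nat.sum_range_choose j
  rw [← hs, Finset.sum_mul]
  refine Finset.sum_le_sum fun i hi => ?_
  have hi' : i ≤ j := by simpa [Nat.lt_succ_iff] using hi
  exact mul_le_mul_of_nonneg_left (h i hi') (by positivity)

theorem DerivBound.mul {m : ℕ} {a b : Rn n → ℂ} {ω ω' : Rn n → ℝ} (ha : DerivBound m a ω)
    (hb : DerivBound m b ω') :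
    DerivBound m (fun w => a w * b w) (fun w => 2 ^ m * (ω w * ω' w)) := by
  refine ⟨ha.1.mul hb.1, fun j hj w => ?_⟩
  refine (norm_iteratedFDeriv_mul_le ha.1 hb.1 w (n := j) (by exact_mod_cast le_top)).trans ?_
  simp only [mul_assoc]
  refine (sum_choose_mul_le (B := ω w * ω' w) fun i hi => ?_).trans ?_
  · exact mul_le_mul (ha.2 i (hi.trans hj) w) (hb.2 _ ((Nat.sub_le _ _).trans hj) w)
      (norm_nonneg _) (ha.nonneg w)
  · have := mul_nonneg (ha.nonneg w) (hb.nonneg w)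
    gcongr
    norm_num

/-- Schwartz norms of the product of a translated symbol with a Schwartz function. -/
theorem schwartzNorm_translate_mul_le {k m L : ℕ} {a : Rn n → ℂ} {ω : Rn n → ℝ}
    (ha : DerivBound m a ω) {X : Rn n} {B : ℝ} (hB : ∀ w, ω (w + X) ≤ B * (1 + ‖w‖) ^ L)
    {Q S : 𝓢(Rn n, ℂ)} (hS : ∀ w, S w = a (w + X) * Q w) :
    schwartzNorm k m S ≤ 2 ^ m * 2 ^ (k + L) * B * schwartzNorm (k + L) m Q := by
  have hB0 : 0 ≤ B := by simpa using (ha.nonneg (0 + X)).trans (hB 0)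
  have hQ0 : 0 ≤ schwartzNorm (k + L) m Q := apply_nonneg _ _
  refine schwartzNorm_le_of_bound (by positivity) fun j hj x => ?_
  have hfun : (S : Rn n → ℂ) = fun w => a (w + X) * Q w := funext hS
  have haX : ContDiff ℝ (⊤ : ℕ∞) fun w => a (w + X) := ha.1.comp (contDiff_id.add contDiff_const)
  have h1 := norm_iteratedFDeriv_mul_le haX (Q.smooth ⊤) x (n := j) (by exact_mod_cast le_top)
  rw [hfun]
  simp only [mul_assoc] at h1
  refine (mul_le_mul_of_nonneg_left (h1.trans (sum_choose_mul_le
    (B := B * (1 + ‖x‖) ^ L * ((2 ^ (k + L) * schwartzNorm (k + L) m Q)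
      / (1 + ‖x‖) ^ (k + L))) fun i hi => ?_)) (by positivity)).trans ?_
  · rw [iteratedFDeriv_comp_add_right]
    refine mul_le_mul ((ha.2 i (hi.trans hj) _).trans (hB x)) ?_ (norm_nonneg _) (by positivity)
    rw [le_div_iff₀ (by positivity), mul_comm]
    exact one_add_pow_mul_norm_iteratedFDeriv_le ((Nat.sub_le _ _).trans hj) Q x
  · calc (1 + ‖x‖) ^ k * (2 ^ j * (B * (1 + ‖x‖) ^ L * ((2 ^ (k + L) * schwartzNorm (k + L) m Q)
          / (1 + ‖x‖) ^ (k + L)))) = 2 ^ j * 2 ^ (k + L) * B * schwartzNorm (k + L) m Q := by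
          have : (1 + ‖x‖) ≠ 0 := by positivity
          field_simp
          ring
      _ ≤ _ := by
          gcongr
          norm_num

theorem exists_norm_fourier_le (M : ℕ) :
    ∃ (k m : ℕ) (C : ℝ), 0 ≤ C ∧ ∀ (S : 𝓢(Rn n, ℂ)) (ξ : Rn n),
      ‖𝓕 S ξ‖ ≤ C * schwartzNorm k m S * (1 + ‖ξ‖) ^ (-(M : ℝ)) := by
  obtain ⟨k, m, C, hC, h⟩ := exists_schwartzNorm_clm_le
    (FourierTransform.fourierCLM ℂ 𝓢(Rn n, ℂ)) M 0
  refine ⟨k, m, 2 ^ M * C, by positivity, fun S ξ => ?_⟩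
  have h1 := one_add_pow_mul_norm_iteratedFDeriv_le (k := M) (m := 0) le_rfl (𝓕 S) ξ
  have h2 := h S
  rw [FourierTransform.fourierCLM_apply] at h2
  rw [norm_iteratedFDeriv_zero] at h1
  rw [Real.rpow_neg (by positivity), Real.rpow_natCast, ← div_eq_mul_inv,
    le_div_iff₀ (by positivity), mul_comm]
  calc _ ≤ _ := h1
    _ ≤ 2 ^ M * (C * schwartzNorm k m S) := by gcongr
    _ = _ := by ring

/-- Decay of the Fourier transform of a translated symbol times a Schwartz function. -/
theorem exists_norm_fourier_translate_mul_le (M L : ℕ) :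
    ∃ (k m : ℕ) (C : ℝ), 0 ≤ C ∧ ∀ (a : Rn n → ℂ) (ω : Rn n → ℝ) (X : Rn n) (B : ℝ)
      (Q S : 𝓢(Rn n, ℂ)), DerivBound m a ω → (∀ w, ω (w + X) ≤ B * (1 + ‖w‖) ^ L) →
      (∀ w, S w = a (w + X) * Q w) →
      ∀ ξ, ‖𝓕 S ξ‖ ≤ C * B * schwartzNorm k m Q * (1 + ‖ξ‖) ^ (-(M : ℝ)) := by
  obtain ⟨k, m, C, hC, h⟩ := exists_norm_fourier_le (n := n) M
  refine ⟨k + L, m, C * (2 ^ m * 2 ^ (k + L)), by positivity,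
    fun a ω X B Q S ha hB hS ξ => (h S ξ).trans ?_⟩
  have h1 := schwartzNorm_translate_mul_le (k := k) ha hB hS
  calc _ ≤ C * (2 ^ m * 2 ^ (k + L) * B * schwartzNorm (k + L) m Q)
        * (1 + ‖ξ‖) ^ (-(M : ℝ)) := by gcongr
    _ = _ := by ring

/-- The weight `(1+|w|)^{-s}` is moderate. -/
theorem one_add_norm_rpow_le {s : ℝ} (hs : 0 ≤ s) {L : ℕ} (hL : s ≤ L) (w X : Rn n) :
    (1 + ‖w + X‖) ^ (-s) ≤ (1 + ‖X‖) ^ (-s) * (1 + ‖w‖) ^ L := by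
  have h1 : 1 + ‖X‖ ≤ (1 + ‖w + X‖) * (1 + ‖w‖) := by
    have : ‖X‖ ≤ ‖w + X‖ + ‖w‖ := by
      calc ‖X‖ = ‖(w + X) - w‖ := by simp
        _ ≤ _ := norm_sub_le _ _
    nlinarith [norm_nonneg (w + X), norm_nonneg w, mul_nonneg (norm_nonneg (w + X)) (norm_nonneg w)]
  have h2 : (1 + ‖X‖) ^ s ≤ (1 + ‖w + X‖) ^ s * (1 + ‖w‖) ^ L := by
    calc (1 + ‖X‖) ^ s ≤ ((1 + ‖w + X‖) * (1 + ‖w‖)) ^ s := Real.rpow_le_rpow (by positivity) h1 hs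
      _ = (1 + ‖w + X‖) ^ s * (1 + ‖w‖) ^ s := Real.mul_rpow (by positivity) (by positivity)
      _ ≤ _ := by
          gcongr
          rw [← Real.rpow_natCast]
          exact Real.rpow_le_rpow_of_exponent_le (by linarith [norm_nonneg w]) hL
  rw [Real.rpow_neg (by positivity), Real.rpow_neg (by positivity), inv_mul_eq_div,
    inv_eq_one_div, div_le_div_iff₀ (by positivity) (by positivity), one_mul]
  linarith

theorem derivBound_schwartz (m L : ℕ) (f : 𝓢(Rn n, ℂ)) :
    DerivBound m f (fun w => 2 ^ L * schwartzNorm L m f * (1 + ‖w‖) ^ (-(L : ℝ))) := by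
  refine ⟨f.smooth ⊤, fun j hj w => ?_⟩
  beta_reduce
  rw [Real.rpow_neg (by positivity), Real.rpow_natCast, ← div_eq_mul_inv,
    le_div_iff₀ (by positivity), mul_comm]
  exact one_add_pow_mul_norm_iteratedFDeriv_le hj f w

/-- A fixed smooth bump function, equal to `1` on the unit ball and supported in the ball of
radius `2`. -/
noncomputable def unitBump (n : ℕ) : ContDiffBump (0 : Rn n) := ⟨1, 2, one_pos, one_lt_two⟩

/-- The symbol `(1 - χ(ζ)) |ζ|^{-s}`. -/
noncomputable def highPass (s : ℝ) (ζ : Rn n) : ℂ := ((1 - unitBump n ζ) * ‖ζ‖ ^ (-s) : ℝ)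

theorem unitBump_eq_one {ζ : Rn n} (h : ‖ζ‖ ≤ 1) : unitBump n ζ = 1 :=
  (unitBump n).one_of_mem_closedBall (by simpa [unitBump] using h)

theorem unitBump_eq_zero {ζ : Rn n} (h : 2 ≤ ‖ζ‖) : unitBump n ζ = 0 :=
  (unitBump n).zero_of_le_dist (by simpa [unitBump] using h)

theorem highPass_of_two_le (s : ℝ) {ζ : Rn n} (h : 2 ≤ ‖ζ‖) :
    highPass s ζ = (‖ζ‖ ^ (-s) : ℝ) := by
  rw [highPass, unitBump_eq_zero h]; simp

theorem contDiff_highPass (s : ℝ) : ContDiff ℝ (⊤ : ℕ∞) (highPass (n := n) s) := by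
  rw [contDiff_iff_contDiffAt]
  intro ζ
  by_cases h : ζ = 0
  · have : highPass (n := n) s =ᶠ[𝓝 ζ] fun _ => 0 := by
      have hb : Metric.ball (0 : Rn n) 1 ∈ 𝓝 ζ := by
        rw [h]; exact Metric.ball_mem_nhds _ one_pos
      filter_upwards [hb] with z hz
      rw [highPass, unitBump_eq_one (by simpa using (Metric.mem_ball.1 hz).le)]
      simp
    exact contDiffAt_const.congr_of_eventuallyEq this
  · refine Complex.ofRealCLM.contDiff.contDiffAt.comp ζ ?_
    refine (contDiffAt_const.sub (unitBump n).contDiffAt).mul ?_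
    exact (contDiffAt_norm ℝ h).rpow_const_of_ne (norm_ne_zero_iff.2 h)

theorem highPass_eventuallyEq_smul (s : ℝ) {ζ : Rn n} {c : ℝ} (hc0 : 0 < c)
    (h : 2 < ‖ζ‖) (hc : 2 < ‖c • ζ‖) :
    highPass (n := n) s =ᶠ[𝓝 ζ] fun z => ((c ^ s : ℝ) : ℂ) * highPass s (c • z) := by
  have h1 : ∀ᶠ z in 𝓝 ζ, 2 < ‖z‖ := continuous_norm.continuousAt.eventually_const_lt h
  have h2 : ∀ᶠ z : Rn n in 𝓝 ζ, 2 < ‖c • z‖ :=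
    ((continuous_const_smul c).norm).continuousAt.eventually_const_lt hc
  filter_upwards [h1, h2] with z hz hz'
  rw [highPass_of_two_le s hz.le, highPass_of_two_le s hz'.le, norm_smul,
    Real.norm_of_nonneg hc0.le, Real.mul_rpow hc0.le (norm_nonneg _), ← Complex.ofReal_mul,
    ← mul_assoc, ← Real.rpow_add hc0, add_neg_cancel, Real.rpow_zero, one_mul]

/-- Symbol estimates for `highPass`. -/
theorem exists_derivBound_highPass {s : ℝ} (hs : 0 ≤ s) (m : ℕ) :
    ∃ C : ℝ, 0 < C ∧ DerivBound m (highPass (n := n) s) (fun ζ => C * (1 + ‖ζ‖) ^ (-s)) := by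
  have hsm := contDiff_highPass (n := n) s
  have hcomp : ∀ j : ℕ, ∃ K : ℝ, ∀ ζ ∈ Metric.closedBall (0 : Rn n) 3,
      ‖iteratedFDeriv ℝ j (highPass (n := n) s) ζ‖ ≤ K := fun j =>
    (isCompact_closedBall _ _).exists_bound_of_continuousOn
      (hsm.continuous_iteratedFDeriv (m := j) (by exact_mod_cast le_top)).continuousOn
  choose K hK using hcomp
  set D : ℝ := 1 + ∑ j ∈ Finset.range (m + 1), |K j| with hD
  have hD0 : 0 < D := by
    have : 0 ≤ ∑ j ∈ Finset.range (m + 1), |K j| := Finset.sum_nonneg fun _ _ => abs_nonneg _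
    linarith
  have hKD : ∀ j ≤ m, K j ≤ D := by
    intro j hj
    have := Finset.single_le_sum (f := fun j => |K j|) (fun _ _ => abs_nonneg _)
      (Finset.mem_range.2 (Nat.lt_succ_of_le hj))
    have h2 := le_abs_self (K j)
    linarith
  refine ⟨D * 4 ^ s, by positivity, hsm, fun j hj ζ => ?_⟩
  have hw : ∀ t : ℝ, 0 ≤ t → t ≤ 3 → 1 ≤ (4 : ℝ) ^ s * (1 + t) ^ (-s) := by
    intro t ht0 ht
    rw [Real.rpow_neg (by positivity), ← div_eq_mul_inv, one_le_div (by positivity)]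
    exact Real.rpow_le_rpow (by positivity) (by linarith) hs
  rcases le_or_gt ‖ζ‖ 3 with h | h
  · calc _ ≤ K j := hK j ζ (by simpa using h)
      _ ≤ D := hKD j hj
      _ ≤ D * (4 ^ s * (1 + ‖ζ‖) ^ (-s)) := le_mul_of_one_le_right hD0.le (hw _ (norm_nonneg _) h)
      _ = _ := by ring
  · set c : ℝ := 3 / ‖ζ‖ with hc
    have hζ0 : 0 < ‖ζ‖ := by linarith
    have hc0 : 0 < c := by positivity
    have hc1 : c ≤ 1 := by rw [hc, div_le_one hζ0]; exact h.le
    have hcζ : ‖c • ζ‖ = 3 := by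
      rw [norm_smul, Real.norm_of_nonneg hc0.le, hc, div_mul_cancel₀ _ hζ0.ne']
    have he := highPass_eventuallyEq_smul s hc0 (by linarith : 2 < ‖ζ‖) (by rw [hcζ]; norm_num)
    have hsm' : ContDiff ℝ j (highPass (n := n) s) := hsm.of_le (by exact_mod_cast le_top)
    rw [(he.iteratedFDeriv ℝ j).eq_of_nhds]
    have hcs : ContDiffAt ℝ j (fun z : Rn n => highPass s (c • z)) ζ :=
      (hsm'.comp (contDiff_const_smul c)).contDiffAt
    have h2 := iteratedFDeriv_const_smul_apply' (𝕜 := ℝ) (a := ((c ^ s : ℝ) : ℂ)) hcs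
    simp only [smul_eq_mul] at h2
    rw [h2, norm_smul, iteratedFDeriv_comp_const_smul c hsm', norm_smul, Complex.norm_real,
      Real.norm_of_nonneg (by positivity), Real.norm_of_nonneg (by positivity)]
    have h3 : ‖iteratedFDeriv ℝ j (highPass (n := n) s) (c • ζ)‖ ≤ D :=
      (hK j _ (by simp [hcζ])).trans (hKD j hj)
    have h4 : c ^ s ≤ 4 ^ s * (1 + ‖ζ‖) ^ (-s) := by
      rw [Real.rpow_neg (by positivity), ← div_eq_mul_inv, ← Real.div_rpow (by positivity)
        (by positivity)]
      refine Real.rpow_le_rpow hc0.le ?_ hs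
      rw [hc, div_le_div_iff₀ hζ0 (by positivity)]
      linarith
    have h5 : c ^ j ≤ 1 := pow_le_one₀ hc0.le hc1
    calc c ^ s * (c ^ j * _) ≤ (4 ^ s * (1 + ‖ζ‖) ^ (-s)) * (1 * D) := by gcongr
      _ = _ := by ring

theorem hasTemperateGrowth_highPass {s : ℝ} (hs : 0 ≤ s) :
    (highPass (n := n) s).HasTemperateGrowth := by
  refine ⟨contDiff_highPass s, fun j => ?_⟩
  obtain ⟨C, hC, h⟩ := exists_derivBound_highPass (n := n) hs j
  refine ⟨0, C, fun x => (h.2 j le_rfl x).trans ?_⟩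
  rw [pow_zero, mul_one]
  refine mul_le_of_le_one_right hC.le ?_
  exact Real.rpow_le_one_of_one_le_of_nonpos (by simp) (by linarith)

/-- The character `r ↦ e^{2πir}`. -/
noncomputable def phase (r : ℝ) : ℂ := Complex.exp ((2 * Real.pi * r : ℝ) * Complex.I)

theorem phase_add (r s : ℝ) : phase (r + s) = phase r * phase s := by
  rw [phase, phase, phase, ← Complex.exp_add]; congr 1; push_cast; ring

theorem phase_zero : phase 0 = 1 := by simp [phase]

theorem norm_phase (r : ℝ) : ‖phase r‖ = 1 := by
  rw [phase, Complex.norm_exp_ofReal_mul_I]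

theorem continuous_phase : Continuous phase := by
  unfold phase; fun_prop

theorem fourier_eq_phase (f : Rn n → ℂ) (w : Rn n) :
    𝓕 f w = ∫ v, phase (-⟪v, w⟫) * f v := by
  rw [Real.fourier_eq']
  refine integral_congr_ae (ae_of_all _ fun v => ?_)
  simp only [phase, smul_eq_mul]
  congr 2; push_cast; ring

theorem fourierInv_eq_phase (f : Rn n → ℂ) (w : Rn n) :
    𝓕⁻ f w = ∫ v, phase ⟪v, w⟫ * f v := by
  rw [Real.fourierInv_eq']
  rfl

theorem integral_fourier_mul_eq_flip {f g : Rn n → ℂ} (hf : Integrable f) (hg : Integrable g) :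
    ∫ ξ, 𝓕 f ξ * g ξ = ∫ x, f x * 𝓕 g x := by
  simpa using! VectorFourier.integral_fourierIntegral_smul_eq_flip (L := innerₗ (Rn n))
      Real.continuous_fourierChar continuous_inner hf hg

theorem integral_fourierInv_mul_eq_flip {f g : Rn n → ℂ} (hf : Integrable f) (hg : Integrable g) :
    ∫ ξ, 𝓕⁻ f ξ * g ξ = ∫ x, f x * 𝓕⁻ g x := by
  have h1 : ∀ x, 𝓕⁻ g x = 𝓕 g (-x) := Real.fourierInv_eq_fourier_neg g
  have h2 := integral_fourier_mul_eq_flip hf.comp_neg hg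
  rw [Real.fourierInv_eq_fourier_comp_neg f, h2]
  simp only [h1]
  rw [← integral_neg_eq_self]
  simp

theorem norm_fourier_le_integral (f : Rn n → ℂ) (w : Rn n) : ‖𝓕 f w‖ ≤ ∫ v, ‖f v‖ := by
  rw [fourier_eq_phase]
  refine (norm_integral_le_integral_norm _).trans (le_of_eq ?_)
  simp [norm_phase]

theorem norm_fourierInv_le_integral (f : Rn n → ℂ) (w : Rn n) : ‖𝓕⁻ f w‖ ≤ ∫ v, ‖f v‖ := by
  rw [Real.fourierInv_eq_fourier_neg]
  exact norm_fourier_le_integral f _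

theorem continuous_fourier {f : Rn n → ℂ} (hf : Integrable f) : Continuous (𝓕 f) := by
  exact VectorFourier.fourierIntegral_continuous Real.continuous_fourierChar
    (L := innerₗ (Rn n)) continuous_inner hf

theorem continuous_fourierInv {f : Rn n → ℂ} (hf : Integrable f) : Continuous (𝓕⁻ f) := by
  have : (𝓕⁻ f) = fun w => 𝓕 f (-w) := funext (Real.fourierInv_eq_fourier_neg f)
  rw [this]
  exact (continuous_fourier hf).comp continuous_neg

/-- Integrability and size of a power singularity against a polynomially decaying function. -/
theorem exists_integral_norm_rpow_mul_le (hn : 0 < n) {s M : ℝ} (hs0 : 0 ≤ s) (hs : s < n)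
    (hM : n + s < M) :
    ∃ C : ℝ, 0 ≤ C ∧ ∀ X : Rn n,
      Integrable (fun w : Rn n => ‖w‖ ^ (-s) * (1 + ‖w - X‖) ^ (-M)) ∧
      ∫ w : Rn n, ‖w‖ ^ (-s) * (1 + ‖w - X‖) ^ (-M) ≤ C * (1 + ‖X‖) ^ (-s) := by
  set b : Rn n → ℝ := (Metric.ball 0 1).indicator fun w => ‖w‖ ^ (-s) with hb
  have hbi : Integrable b := (integrable_indicator_iff measurableSet_ball).2
    (integrableOn_norm_rpow_ball hs hn 1)
  have hci : Integrable fun w : Rn n => (1 + ‖w‖) ^ (-(M - s)) :=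
    integrable_one_add_norm (by simpa using (by linarith : (n : ℝ) < M - s))
  have hb0 : ∀ w, 0 ≤ b w := fun w => Set.indicator_nonneg (fun w _ => by positivity) w
  refine ⟨2 ^ s * ((∫ w, b w) + ∫ w : Rn n, (1 + ‖w‖) ^ (-(M - s))), ?_, fun X => ?_⟩
  · have h1 : 0 ≤ ∫ w, b w := integral_nonneg hb0
    have h2 : 0 ≤ ∫ w : Rn n, (1 + ‖w‖) ^ (-(M - s)) := integral_nonneg fun w => by positivity
    positivity
  have hpt : ∀ w, ‖w‖ ^ (-s) * (1 + ‖w - X‖) ^ (-M)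
      ≤ 2 ^ s * (b w + (1 + ‖w - X‖) ^ (-(M - s))) * (1 + ‖X‖) ^ (-s) := by
    intro w
    set u := 1 + ‖w - X‖ with hu
    have hu1 : 1 ≤ u := by rw [hu]; linarith [norm_nonneg (w - X)]
    have hu0 : 0 < u := by linarith
    have hX : 1 + ‖X‖ ≤ (1 + ‖w‖) * u := by
      have : ‖X‖ ≤ ‖w‖ + ‖w - X‖ := by
        calc ‖X‖ = ‖w - (w - X)‖ := by simp
          _ ≤ _ := norm_sub_le _ _
      rw [hu]
      nlinarith [norm_nonneg w, norm_nonneg (w - X), mul_nonneg (norm_nonneg w) (norm_nonneg (w - X))]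
    have hXs : (1 + ‖X‖) ^ s ≤ (1 + ‖w‖) ^ s * u ^ s := by
      rw [← Real.mul_rpow (by positivity) hu0.le]
      exact Real.rpow_le_rpow (by positivity) hX hs0
    have huM : u ^ s * u ^ (-M) = u ^ (-(M - s)) := by
      rw [← Real.rpow_add hu0]; congr 1; ring
    have hkey : (1 + ‖X‖) ^ s * (‖w‖ ^ (-s) * u ^ (-M)) ≤ 2 ^ s * (b w + u ^ (-(M - s))) := by
      have h1 : (1 + ‖X‖) ^ s * (‖w‖ ^ (-s) * u ^ (-M))
          ≤ ‖w‖ ^ (-s) * (1 + ‖w‖) ^ s * u ^ (-(M - s)) := by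
        calc _ ≤ ((1 + ‖w‖) ^ s * u ^ s) * (‖w‖ ^ (-s) * u ^ (-M)) := by gcongr
          _ = ‖w‖ ^ (-s) * (1 + ‖w‖) ^ s * (u ^ s * u ^ (-M)) := by ring
          _ = _ := by rw [huM]
      refine h1.trans ?_
      by_cases hw : w ∈ Metric.ball (0 : Rn n) 1
      · have hw1 : ‖w‖ < 1 := by simpa using hw
        have hbw : b w = ‖w‖ ^ (-s) := Set.indicator_of_mem hw _
        have hu2 : u ^ (-(M - s)) ≤ 1 :=
          Real.rpow_le_one_of_one_le_of_nonpos hu1 (by linarith)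
        have h2 : (1 + ‖w‖) ^ s ≤ 2 ^ s := Real.rpow_le_rpow (by positivity) (by linarith) hs0
        calc _ ≤ ‖w‖ ^ (-s) * 2 ^ s * 1 := by gcongr
          _ = 2 ^ s * b w := by rw [hbw]; ring
          _ ≤ _ := by
              gcongr
              have : 0 ≤ u ^ (-(M - s)) := by positivity
              linarith
      · have hw1 : 1 ≤ ‖w‖ := by simpa using hw
        have hw0 : 0 < ‖w‖ := by linarith
        have h2 : ‖w‖ ^ (-s) * (1 + ‖w‖) ^ s ≤ 2 ^ s := by
          rw [Real.rpow_neg hw0.le, inv_mul_eq_div, ← Real.div_rpow (by positivity) hw0.le]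
          refine Real.rpow_le_rpow (by positivity) ?_ hs0
          rw [div_le_iff₀ hw0]; linarith
        calc _ ≤ 2 ^ s * u ^ (-(M - s)) := by gcongr
          _ ≤ _ := by
              gcongr
              linarith [hb0 w]
    rw [Real.rpow_neg (by positivity : 0 ≤ 1 + ‖X‖), ← div_eq_mul_inv, le_div_iff₀ (by positivity),
      mul_comm]
    exact hkey
  have hmaj : Integrable fun w => 2 ^ s * (b w + (1 + ‖w - X‖) ^ (-(M - s))) * (1 + ‖X‖) ^ (-s) :=
    ((hbi.add (hci.comp_sub_right X)).const_mul _).mul_const _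
  have hInt : Integrable (fun w : Rn n => ‖w‖ ^ (-s) * (1 + ‖w - X‖) ^ (-M)) := by
    refine hmaj.mono' ?_ (ae_of_all _ fun w => ?_)
    · refine Measurable.aestronglyMeasurable ?_
      exact (measurable_norm.pow_const _).mul
        ((measurable_const.add (measurable_id.sub measurable_const).norm).pow_const _)
    · rw [Real.norm_of_nonneg (by positivity)]
      exact hpt w
  refine ⟨hInt, (integral_mono hInt hmaj hpt).trans (le_of_eq ?_)⟩
  rw [integral_mul_const, integral_const_mul, integral_add hbi (hci.comp_sub_right X),
    integral_sub_right_eq_self (fun w : Rn n => (1 + ‖w‖) ^ (-(M - s))) X]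

theorem schwartz_norm_le_rpow (f : 𝓢(Rn n, ℂ)) (M : ℕ) (x : Rn n) :
    ‖f x‖ ≤ 2 ^ M * schwartzNorm M 0 f * (1 + ‖x‖) ^ (-(M : ℝ)) := by
  simpa using (derivBound_schwartz 0 M f).2 0 le_rfl x

theorem integrable_norm_rpow_mul (hn : 0 < n) {s : ℝ} (hs0 : 0 ≤ s) (hs : s < n)
    (f : 𝓢(Rn n, ℂ)) : Integrable fun w => ((‖w‖ ^ (-s) : ℝ) : ℂ) * f w := by
  obtain ⟨C, -, hC⟩ := exists_integral_norm_rpow_mul_le hn hs0 hs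
    (M := (2 * n + 1 : ℕ)) (by push_cast; linarith)
  have h1 := ((hC 0).1.const_mul (2 ^ (2 * n + 1) * schwartzNorm (2 * n + 1) 0 f))
  refine h1.mono' ?_ (ae_of_all _ fun w => ?_)
  · refine AEStronglyMeasurable.mul ?_ f.continuous.aestronglyMeasurable
    exact (Complex.measurable_ofReal.comp (measurable_norm.pow_const _)).aestronglyMeasurable
  · rw [norm_mul, Complex.norm_real, Real.norm_of_nonneg (by positivity)]
    have h2 := schwartz_norm_le_rpow f (2 * n + 1) w
    rw [sub_zero]
    refine (mul_le_mul_of_nonneg_left h2 (by positivity)).trans (le_of_eq ?_)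
    ring

/-- The Gamma-function representation of `|ζ|^{-2a}` integrated against a Schwartz function. -/
theorem integral_rpow_mul_gaussian (hn : 0 < n) {a : ℝ} (ha : 0 < a) (han : 2 * a < n)
    (f : 𝓢(Rn n, ℂ)) :
    ∫ t in Set.Ioi (0 : ℝ), ((t ^ (a - 1) : ℝ) : ℂ)
        * ∫ ζ, ((Real.exp (-(Real.pi * ‖ζ‖ ^ 2 * t)) : ℝ) : ℂ) * f ζ
      = ((Real.pi ^ (-a) * Real.Gamma a : ℝ) : ℂ)
        * ∫ ζ, ((‖ζ‖ ^ (-(2 * a)) : ℝ) : ℂ) * f ζ := by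
  have := nontrivial_Rn hn
  have hΓ := Real.Gamma_pos_of_pos ha
  set k : Rn n → ℝ → ℝ := fun ζ t => t ^ (a - 1) * Real.exp (-(Real.pi * ‖ζ‖ ^ 2 * t)) with hk
  have hkint : ∀ ζ : Rn n, ζ ≠ 0 → ∫ t in Set.Ioi (0 : ℝ), k ζ t
      = Real.pi ^ (-a) * Real.Gamma a * ‖ζ‖ ^ (-(2 * a)) := by
    intro ζ hζ
    have hζ0 : 0 < ‖ζ‖ := norm_pos_iff.2 hζ
    simp only [hk]
    rw [Real.integral_rpow_mul_exp_neg_mul_Ioi ha (by positivity), one_div,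
      Real.inv_rpow (by positivity), ← Real.rpow_neg (by positivity),
      Real.mul_rpow Real.pi_pos.le (by positivity), ← Real.rpow_natCast, ← Real.rpow_mul hζ0.le]
    rw [show ((2 : ℕ) : ℝ) * -a = -(2 * a) by push_cast; ring]
    ring
  have hki : ∀ ζ : Rn n, ζ ≠ 0 → IntegrableOn (k ζ) (Set.Ioi 0) := by
    intro ζ hζ
    have hζ0 : 0 < ‖ζ‖ := norm_pos_iff.2 hζ
    refine .of_integral_ne_zero ?_
    rw [hkint ζ hζ]
    positivity
  have hae : ∀ᵐ ζ : Rn n, ζ ≠ 0 := Measure.ae_ne volume 0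
  have hmeas : Measurable (Function.uncurry k) := by
    simp only [hk]
    exact (measurable_snd.pow_const _).mul (Real.measurable_exp.comp
      (((measurable_const.mul (measurable_fst.norm.pow_const _)).mul measurable_snd).neg))
  have hprod : Integrable (Function.uncurry fun (ζ : Rn n) (t : ℝ) => ((k ζ t : ℝ) : ℂ) * f ζ)
      (volume.prod (volume.restrict (Set.Ioi 0))) := by
    have hm : AEStronglyMeasurable (Function.uncurry fun (ζ : Rn n) (t : ℝ) =>
        ((k ζ t : ℝ) : ℂ) * f ζ) (volume.prod (volume.restrict (Set.Ioi 0))) :=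
      ((Complex.measurable_ofReal.comp hmeas).mul
        (f.continuous.measurable.comp measurable_fst)).aestronglyMeasurable
    rw [integrable_prod_iff hm]
    constructor
    · filter_upwards [hae] with ζ hζ
      exact (Integrable.ofReal (𝕜 := ℂ) (hki ζ hζ)).mul_const (f ζ)
    · have h1 : Integrable fun ζ : Rn n => Real.pi ^ (-a) * Real.Gamma a
          * ‖((‖ζ‖ ^ (-(2 * a)) : ℝ) : ℂ) * f ζ‖ :=
        ((integrable_norm_rpow_mul hn (by linarith) han f).norm).const_mul _
      refine h1.congr ?_
      filter_upwards [hae] with ζ hζ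
      simp only [Function.uncurry, norm_mul, Complex.norm_real]
      rw [integral_mul_const, Real.norm_of_nonneg (by positivity : 0 ≤ ‖ζ‖ ^ (-(2 * a))),
        ← mul_assoc, ← hkint ζ hζ]
      congr 1
      refine setIntegral_congr_fun measurableSet_Ioi fun t ht => ?_
      have ht0 : (0 : ℝ) < t := ht
      rw [Real.norm_of_nonneg (by positivity)]
  calc _ = ∫ t in Set.Ioi (0 : ℝ), ∫ ζ, ((k ζ t : ℝ) : ℂ) * f ζ := by
        congr 1; funext t
        rw [← integral_const_mul]
        congr 1; funext ζ
        simp only [hk]; push_cast; ring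
    _ = ∫ ζ, ∫ t in Set.Ioi (0 : ℝ), ((k ζ t : ℝ) : ℂ) * f ζ :=
        (integral_integral_swap hprod).symm
    _ = ∫ ζ, ((Real.pi ^ (-a) * Real.Gamma a : ℝ) : ℂ)
        * (((‖ζ‖ ^ (-(2 * a)) : ℝ) : ℂ) * f ζ) := by
        refine integral_congr_ae ?_
        filter_upwards [hae] with ζ hζ
        rw [integral_mul_const, integral_complex_ofReal, hkint ζ hζ]
        push_cast; ring
    _ = _ := integral_const_mul _ _

theorem integral_gaussian_mul_fourier (f : 𝓢(Rn n, ℂ)) {t : ℝ} (ht : 0 < t) :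
    ∫ ζ, ((Real.exp (-(Real.pi * ‖ζ‖ ^ 2 * t)) : ℝ) : ℂ) * 𝓕 f ζ
      = ((t ^ (-(n : ℝ) / 2) : ℝ) : ℂ)
        * ∫ w, ((Real.exp (-(Real.pi * ‖w‖ ^ 2 * t⁻¹)) : ℝ) : ℂ) * f w := by
  have hb : 0 < ((Real.pi * t : ℝ) : ℂ).re := by simp; positivity
  have hg : ∀ ζ : Rn n, ((Real.exp (-(Real.pi * ‖ζ‖ ^ 2 * t)) : ℝ) : ℂ)
      = Complex.exp (-((Real.pi * t : ℝ) : ℂ) * ‖ζ‖ ^ 2) := by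
    intro ζ; push_cast; congr 1; ring
  have hgi : Integrable fun ζ : Rn n => Complex.exp (-((Real.pi * t : ℝ) : ℂ) * ‖ζ‖ ^ 2) := by
    simpa using GaussianFourier.integrable_cexp_neg_mul_sq_norm_add (V := Rn n) hb 0 0
  have hflip := integral_fourier_mul_eq_flip hgi f.integrable
  simp only [hg]
  rw [fourier_coe, ← hflip, ← integral_const_mul]
  congr 1; funext w
  rw [fourier_gaussian_innerProductSpace hb w, ← mul_assoc]
  congr 1
  have hπ := Real.pi_ne_zero
  congr 1
  · have h1 : (Real.pi : ℂ) / ((Real.pi * t : ℝ) : ℂ) = ((t⁻¹ : ℝ) : ℂ) := by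
      push_cast; field_simp
    rw [h1, show -(n : ℝ) / 2 = -((n : ℝ) / 2) by ring, Real.rpow_neg ht.le, ← Real.inv_rpow ht.le,
      Complex.ofReal_cpow (by positivity)]
    simp
  · push_cast
    congr 1
    field_simp

/-- The Fourier transform of a Riesz kernel, tested against Schwartz functions. -/
theorem exists_integral_norm_rpow_mul_fourier {α : ℝ} (hα : 0 < α) (hαn : α < n) :
    ∃ c : ℝ, 0 < c ∧ ∀ f : 𝓢(Rn n, ℂ),
      ∫ w, ((‖w‖ ^ (-(n - α)) : ℝ) : ℂ) * f w
        = c * ∫ ζ, ((‖ζ‖ ^ (-α) : ℝ) : ℂ) * 𝓕 f ζ := by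
  have hnR : (0 : ℝ) < n := by linarith
  have hn : 0 < n := by exact_mod_cast hnR
  set a := α / 2 with ha
  set b := (n - α) / 2 with hb
  have ha0 : 0 < a := by positivity
  have hb0 : 0 < b := by rw [hb]; linarith
  have h2a : 2 * a = α := by rw [ha]; ring
  have h2b : 2 * b = n - α := by rw [hb]; ring
  have hΓa := Real.Gamma_pos_of_pos ha0
  have hΓb := Real.Gamma_pos_of_pos hb0
  have hA : 0 < Real.pi ^ (-a) * Real.Gamma a := by positivity
  have hB : 0 < Real.pi ^ (-b) * Real.Gamma b := by positivity
  refine ⟨(Real.pi ^ (-b) * Real.Gamma b)⁻¹ * (Real.pi ^ (-a) * Real.Gamma a), by positivity,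
    fun f => ?_⟩
  have h1 := integral_rpow_mul_gaussian hn ha0 (by linarith) (𝓕 f)
  have h2 := integral_rpow_mul_gaussian hn hb0 (by linarith) f
  rw [h2a] at h1
  rw [h2b] at h2
  set G : ℝ → ℂ := fun t => ((t ^ (b - 1) : ℝ) : ℂ)
    * ∫ ζ, ((Real.exp (-(Real.pi * ‖ζ‖ ^ 2 * t)) : ℝ) : ℂ) * f ζ with hG
  have h3 : ∫ t in Set.Ioi (0 : ℝ), ((t ^ (a - 1) : ℝ) : ℂ)
        * ∫ ζ, ((Real.exp (-(Real.pi * ‖ζ‖ ^ 2 * t)) : ℝ) : ℂ) * 𝓕 f ζ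
      = ∫ t in Set.Ioi (0 : ℝ), G t := by
    rw [← integral_comp_rpow_Ioi G (p := -1) (by norm_num)]
    refine setIntegral_congr_fun measurableSet_Ioi fun t ht => ?_
    have ht0 : (0 : ℝ) < t := ht
    simp only [hG]
    rw [integral_gaussian_mul_fourier f ht0, Real.rpow_neg_one, ← mul_assoc,
      Complex.real_smul, ← mul_assoc, ← Complex.ofReal_mul, ← Complex.ofReal_mul]
    congr 2
    rw [Real.inv_rpow ht0.le, ← Real.rpow_neg ht0.le, abs_neg, abs_one, one_mul,
      ← Real.rpow_add ht0, ← Real.rpow_add ht0]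
    congr 1
    rw [ha, hb]; ring
  rw [h3, h2] at h1
  have hBc : ((Real.pi ^ (-b) * Real.Gamma b : ℝ) : ℂ) ≠ 0 := by exact_mod_cast hB.ne'
  rw [Complex.ofReal_mul, Complex.ofReal_inv, mul_assoc, ← h1, inv_mul_cancel_left₀ hBc]

theorem fourier_compSubConst (f : 𝓢(Rn n, ℂ)) (x ζ : Rn n) :
    𝓕 (compSubConstCLM ℂ x f) ζ = phase (-⟪x, ζ⟫) * 𝓕 f ζ := by
  rw [fourier_coe, fourier_coe, fourier_eq_phase, fourier_eq_phase, ← integral_const_mul,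
    ← integral_add_right_eq_self _ x]
  congr 1; funext v
  simp only [compSubConstCLM_apply, add_sub_cancel_right]
  rw [← mul_assoc, ← phase_add, inner_add_left]
  congr 2; ring

/-- The Fourier representation of the fractional integral. -/
theorem exists_fractionalIntegral_eq {α : ℝ} (hα : 0 < α) (hαn : α < n) :
    ∃ κ : ℝ, 0 < κ ∧ ∀ (f : 𝓢(Rn n, ℂ)) (x : Rn n),
      fractionalIntegral α f x = κ * 𝓕⁻ (fun ζ => ((‖ζ‖ ^ (-α) : ℝ) : ℂ) * 𝓕 f ζ) x := by
  obtain ⟨c, hc, h⟩ := exists_integral_norm_rpow_mul_fourier hα hαn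
  have hγ : 0 < rieszConstant n α := by
    have h1 := Real.Gamma_pos_of_pos (by linarith : 0 < α / 2)
    have h2 := Real.Gamma_pos_of_pos (by linarith : 0 < (n - α) / 2)
    have := Real.pi_pos
    unfold rieszConstant
    positivity
  refine ⟨(rieszConstant n α)⁻¹ * c, by positivity, fun f x => ?_⟩
  rw [fractionalIntegral, Complex.ofReal_mul, mul_assoc]
  congr 1
  have h1 := h (compSubConstCLM ℂ (-x) f)
  have h2 : ∫ y, f y / ((‖x - y‖ ^ (n - α) : ℝ) : ℂ)
      = ∫ w, ((‖w‖ ^ (-(n - α)) : ℝ) : ℂ) * compSubConstCLM ℂ (-x) f w := by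
    rw [← integral_add_right_eq_self _ x]
    congr 1; funext w
    simp only [compSubConstCLM_apply, sub_neg_eq_add]
    rw [show x - (w + x) = -w by abel, norm_neg, Real.rpow_neg (norm_nonneg _), div_eq_mul_inv,
      mul_comm, Complex.ofReal_inv]
  rw [h2, h1, fourierInv_eq_phase]
  congr 2; funext ζ
  rw [fourier_compSubConst, inner_neg_left, neg_neg, real_inner_comm]
  ring

theorem integrable_rieszSymbol_mul {α : ℝ} (hα : 0 < α) (hαn : α < n) (f : 𝓢(Rn n, ℂ)) :
    Integrable fun ζ => ((‖ζ‖ ^ (-α) : ℝ) : ℂ) * f ζ := by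
  have hn : 0 < n := by
    have : (0 : ℝ) < n := by linarith
    exact_mod_cast this
  exact integrable_norm_rpow_mul hn hα.le hαn f

theorem continuous_fractionalIntegral {α : ℝ} (hα : 0 < α) (hαn : α < n) (f : 𝓢(Rn n, ℂ)) :
    Continuous (fractionalIntegral α f) := by
  obtain ⟨κ, -, h⟩ := exists_fractionalIntegral_eq hα hαn
  have : fractionalIntegral α f
      = fun x => κ * 𝓕⁻ (fun ζ => ((‖ζ‖ ^ (-α) : ℝ) : ℂ) * 𝓕 f ζ) x := funext (h f)
  rw [this]
  exact continuous_const.mul (continuous_fourierInv (integrable_rieszSymbol_mul hα hαn (𝓕 f)))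

theorem exists_norm_fractionalIntegral_le {α : ℝ} (hα : 0 < α) (hαn : α < n) (f : 𝓢(Rn n, ℂ)) :
    ∃ B : ℝ, ∀ x, ‖fractionalIntegral α f x‖ ≤ B := by
  obtain ⟨κ, hκ, h⟩ := exists_fractionalIntegral_eq hα hαn
  refine ⟨κ * ∫ ζ, ‖((‖ζ‖ ^ (-α) : ℝ) : ℂ) * 𝓕 f ζ‖, fun x => ?_⟩
  rw [h, norm_mul, Complex.norm_real, Real.norm_of_nonneg hκ.le]
  gcongr
  exact norm_fourierInv_le_integral _ _

theorem integrable_mul_fractionalIntegral {α : ℝ} (hα : 0 < α) (hαn : α < n)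
    (f : 𝓢(Rn n, ℂ)) {g : Rn n → ℂ} (hg : Integrable g) :
    Integrable fun x => g x * fractionalIntegral α f x := by
  obtain ⟨B, hB⟩ := exists_norm_fractionalIntegral_le hα hαn f
  exact hg.mul_bdd (c := B) (continuous_fractionalIntegral hα hαn f).aestronglyMeasurable
    (ae_of_all _ hB)

/-- The bilinear form of the fractional integral on the Fourier side. -/
theorem exists_integral_mul_fractionalIntegral_eq {α : ℝ} (hα : 0 < α) (hαn : α < n) :
    ∃ κ : ℝ, 0 < κ ∧ ∀ f g : 𝓢(Rn n, ℂ),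
      ∫ x, g x * fractionalIntegral α f x
        = κ * ∫ ζ, ((‖ζ‖ ^ (-α) : ℝ) : ℂ) * (𝓕 f ζ * 𝓕⁻ g ζ) := by
  obtain ⟨κ, hκ, h⟩ := exists_fractionalIntegral_eq hα hαn
  refine ⟨κ, hκ, fun f g => ?_⟩
  have h1 := integral_fourierInv_mul_eq_flip (integrable_rieszSymbol_mul hα hαn (𝓕 f))
    g.integrable
  simp only [h]
  calc _ = ∫ x, (κ : ℂ) * (𝓕⁻ (fun ζ => ((‖ζ‖ ^ (-α) : ℝ) : ℂ) * 𝓕 f ζ) x * g x) := by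
        congr 1; funext x; ring
    _ = _ := by
        rw [integral_const_mul, h1]
        congr 2; funext ζ
        rw [fourierInv_coe, mul_assoc]

theorem integral_mul_fractionalIntegral_comm {α : ℝ} (hα : 0 < α) (hαn : α < n)
    (f g : 𝓢(Rn n, ℂ)) :
    ∫ x, g x * fractionalIntegral α f x = ∫ x, f x * fractionalIntegral α g x := by
  obtain ⟨κ, -, h⟩ := exists_integral_mul_fractionalIntegral_eq hα hαn
  rw [h, h]
  congr 1
  rw [← integral_neg_eq_self]
  congr 1; funext ζ
  rw [norm_neg, fourierInv_coe, fourierInv_coe, Real.fourierInv_eq_fourier_neg,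
    Real.fourierInv_eq_fourier_neg, neg_neg, fourier_coe, fourier_coe]
  ring

theorem norm_fourierInv_schwartz (S : 𝓢(Rn n, ℂ)) (v : Rn n) : ‖𝓕⁻ S v‖ = ‖𝓕 S (-v)‖ := by
  rw [fourierInv_coe, Real.fourierInv_eq_fourier_neg, fourier_coe]

/-- The localized part of the oscillatory integral with the symbol `|ζ|^{-α}`. -/
theorem exists_norm_integral_phase_riesz_le {α : ℝ} (hα : 0 < α) (hαn : α < n) :
    ∃ (k m : ℕ) (C : ℝ), 0 ≤ C ∧ ∀ (S : 𝓢(Rn n, ℂ)) (X : Rn n),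
      ‖∫ ζ, phase (-⟪ζ, X⟫) * (((‖ζ‖ ^ (-α) : ℝ) : ℂ) * S ζ)‖
        ≤ C * schwartzNorm k m S * (1 + ‖X‖) ^ (-(n - α)) := by
  have hnR : (0 : ℝ) < n := by linarith
  have hn : 0 < n := by exact_mod_cast hnR
  obtain ⟨c, hc, h⟩ := exists_integral_norm_rpow_mul_fourier hα hαn
  obtain ⟨k, m, C₁, hC₁, h₁⟩ := exists_norm_fourier_le (n := n) (2 * n)
  obtain ⟨C₂, hC₂, h₂⟩ := exists_integral_norm_rpow_mul_le (n := n) hn (s := n - α) (by linarith)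
    (by linarith) (M := (2 * n : ℕ)) (by push_cast; linarith)
  refine ⟨k, m, c⁻¹ * C₁ * C₂, by positivity, fun S X => ?_⟩
  set f : 𝓢(Rn n, ℂ) := compSubConstCLM ℂ X (𝓕⁻ S) with hf
  have hF : ∀ ζ, 𝓕 f ζ = phase (-⟪ζ, X⟫) * S ζ := by
    intro ζ
    rw [hf, fourier_compSubConst, FourierTransform.fourier_fourierInv_eq, real_inner_comm]
  have h3 : ∫ ζ, phase (-⟪ζ, X⟫) * (((‖ζ‖ ^ (-α) : ℝ) : ℂ) * S ζ)
      = (c⁻¹ : ℝ) * ∫ w, ((‖w‖ ^ (-(n - α)) : ℝ) : ℂ) * f w := by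
    rw [h f, ← mul_assoc, ← Complex.ofReal_mul, inv_mul_cancel₀ hc.ne', Complex.ofReal_one, one_mul]
    congr 1; funext ζ
    rw [hF]; ring
  rw [h3, norm_mul, Complex.norm_real, Real.norm_of_nonneg (by positivity)]
  have h4 : ‖∫ w, ((‖w‖ ^ (-(n - α)) : ℝ) : ℂ) * f w‖
      ≤ ∫ w : Rn n, C₁ * schwartzNorm k m S
        * (‖w‖ ^ (-(n - α)) * (1 + ‖w - X‖) ^ (-((2 * n : ℕ) : ℝ))) := by
    refine norm_integral_le_of_norm_le ((h₂ X).1.const_mul _) (ae_of_all _ fun w => ?_)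
    rw [norm_mul, Complex.norm_real, Real.norm_of_nonneg (by positivity)]
    have h5 := h₁ S (-(w - X))
    rw [← norm_fourierInv_schwartz, norm_neg] at h5
    refine (mul_le_mul_of_nonneg_left h5 (by positivity)).trans (le_of_eq ?_)
    ring
  have h6 : 0 ≤ schwartzNorm k m S := apply_nonneg _ _
  calc _ ≤ c⁻¹ * (C₁ * schwartzNorm k m S * (C₂ * (1 + ‖X‖) ^ (-(n - α)))) := by
        gcongr
        refine h4.trans ?_
        rw [integral_const_mul]
        gcongr
        exact (h₂ X).2
    _ = _ := by ring

/-- The oscillatory integral with the symbol `|ζ|^{-α}` against a translated Schwartz function. -/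
theorem exists_norm_integral_phase_riesz_translate_le {α : ℝ} (hα : 0 < α) (hαn : α < n) :
    ∃ (k m : ℕ) (C : ℝ), 0 ≤ C ∧ ∀ (Q : 𝓢(Rn n, ℂ)) (X η : Rn n),
      ‖∫ ζ, phase (-⟪ζ, X⟫) * (((‖ζ‖ ^ (-α) : ℝ) : ℂ) * Q (ζ - η))‖
        ≤ C * schwartzNorm k m Q * (1 + ‖η‖) ^ (-α) * (1 + ‖X‖) ^ (-(n - α)) := by
  obtain ⟨k₁, m₁, C₁, hC₁, h₁⟩ := exists_norm_integral_phase_riesz_le (n := n) hα hαn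
  obtain ⟨k₂, m₂, C₂, hC₂, h₂⟩ := exists_norm_fourier_translate_mul_le (n := n) n n
  obtain ⟨D, hD, hDb⟩ := exists_derivBound_highPass (n := n) hα.le m₂
  set χ : 𝓢(Rn n, ℂ) := (HasCompactSupport.comp_left (g := Complex.ofReal)
    (unitBump n).hasCompactSupport Complex.ofReal_zero).toSchwartzMap
    (Complex.ofRealCLM.contDiff.comp (unitBump n).contDiff) with hχ
  have hχa : ∀ ζ, χ ζ = (unitBump n ζ : ℝ) := fun ζ => rfl
  have hχ0 : 0 ≤ schwartzNorm (k₁ + n) m₁ χ := apply_nonneg _ _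
  refine ⟨n + k₂, m₁ + m₂, C₁ * (2 ^ m₁ * 2 ^ (k₁ + n) * 2 ^ n * schwartzNorm (k₁ + n) m₁ χ)
    + C₂ * D, by positivity, fun Q X η => ?_⟩
  set P : 𝓢(Rn n, ℂ) := compSubConstCLM ℂ η Q with hP
  have hPa : ∀ ζ, P ζ = Q (ζ - η) := fun ζ => compSubConstCLM_apply Q η ζ
  set S : 𝓢(Rn n, ℂ) := smulLeftCLM ℂ (P : Rn n → ℂ) χ with hS
  have hSa : ∀ ζ, S ζ = Q (ζ + -η) * χ ζ := fun ζ => by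
    rw [hS, smulLeftCLM_apply_apply P.hasTemperateGrowth, hPa, smul_eq_mul, sub_eq_add_neg]
  set R : 𝓢(Rn n, ℂ) := smulLeftCLM ℂ (highPass (n := n) α) P with hR
  have hRa : ∀ ζ, R ζ = highPass α ζ * Q (ζ - η) := fun ζ => by
    rw [hR, smulLeftCLM_apply_apply (hasTemperateGrowth_highPass hα.le), hPa, smul_eq_mul]
  set R' : 𝓢(Rn n, ℂ) := compSubConstCLM ℂ (-η) R with hR'
  have hRa' : ∀ ζ, R' ζ = highPass α (ζ + η) * Q ζ := fun ζ => by
    rw [hR', compSubConstCLM_apply, hRa]; simp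
  have hηn : (1 + ‖η‖) ^ (-(n : ℝ)) ≤ (1 + ‖η‖) ^ (-α) :=
    Real.rpow_le_rpow_of_exponent_le (by linarith [norm_nonneg η]) (by linarith)
  have hXn : (1 + ‖X‖) ^ (-(n : ℝ)) ≤ (1 + ‖X‖) ^ (-(n - α)) :=
    Real.rpow_le_rpow_of_exponent_le (by linarith [norm_nonneg X]) (by linarith)
  have hQ0 : 0 ≤ schwartzNorm (n + k₂) (m₁ + m₂) Q := apply_nonneg _ _
  have hQ1 : schwartzNorm n m₁ Q ≤ schwartzNorm (n + k₂) (m₁ + m₂) Q :=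
    schwartzNorm_mono (by omega) (by omega) Q
  have hQ2 : schwartzNorm k₂ m₂ Q ≤ schwartzNorm (n + k₂) (m₁ + m₂) Q :=
    schwartzNorm_mono (by omega) (by omega) Q
  have hlow := h₁ S X
  have hSn : schwartzNorm k₁ m₁ S ≤ 2 ^ m₁ * 2 ^ (k₁ + n)
      * (2 ^ n * schwartzNorm n m₁ Q * (1 + ‖η‖) ^ (-(n : ℝ))) * schwartzNorm (k₁ + n) m₁ χ := by
    refine schwartzNorm_translate_mul_le (derivBound_schwartz m₁ n Q) (X := -η) (fun w => ?_) hSa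
    have h5 := one_add_norm_rpow_le (n := n) (s := n) (by positivity) (L := n) le_rfl w (-η)
    rw [norm_neg] at h5
    have h6 : 0 ≤ schwartzNorm n m₁ Q := apply_nonneg _ _
    calc _ ≤ 2 ^ n * schwartzNorm n m₁ Q * ((1 + ‖η‖) ^ (-(n : ℝ)) * (1 + ‖w‖) ^ n) := by gcongr
      _ = _ := by ring
  have hhigh := h₂ _ _ η (D * (1 + ‖η‖) ^ (-α)) Q R' hDb (fun w => by
    have h5 := one_add_norm_rpow_le (n := n) hα.le (L := n) hαn.le w η
    calc _ ≤ D * ((1 + ‖η‖) ^ (-α) * (1 + ‖w‖) ^ n) := by gcongr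
      _ = _ := by ring) hRa' X
  have hhigh' : ‖∫ ζ, phase (-⟪ζ, X⟫) * R ζ‖ = ‖𝓕 R' X‖ := by
    rw [hR', fourier_compSubConst, norm_mul, norm_phase, one_mul, fourier_coe, fourier_eq_phase]
  have hi₁ : Integrable fun ζ => phase (-⟪ζ, X⟫) * (((‖ζ‖ ^ (-α) : ℝ) : ℂ) * S ζ) := by
    refine (integrable_rieszSymbol_mul hα hαn S).bdd_mul (c := 1) ?_ (ae_of_all _ fun ζ => ?_)
    · exact (continuous_phase.comp (by fun_prop)).aestronglyMeasurable
    · exact (norm_phase _).le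
  have hi₂ : Integrable fun ζ => phase (-⟪ζ, X⟫) * R ζ := by
    refine R.integrable.bdd_mul (c := 1) ?_ (ae_of_all _ fun ζ => ?_)
    · exact (continuous_phase.comp (by fun_prop)).aestronglyMeasurable
    · exact (norm_phase _).le
  have hsplit : ∫ ζ, phase (-⟪ζ, X⟫) * (((‖ζ‖ ^ (-α) : ℝ) : ℂ) * Q (ζ - η))
      = (∫ ζ, phase (-⟪ζ, X⟫) * (((‖ζ‖ ^ (-α) : ℝ) : ℂ) * S ζ))
        + ∫ ζ, phase (-⟪ζ, X⟫) * R ζ := by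
    rw [← integral_add hi₁ hi₂]
    congr 1; funext ζ
    rw [hSa, hRa, hχa, highPass, sub_eq_add_neg]
    push_cast
    ring
  rw [hsplit]
  refine (norm_add_le _ _).trans ?_
  rw [hhigh', add_mul, add_mul, add_mul]
  refine add_le_add (hlow.trans ?_) (hhigh.trans ?_)
  · calc _ ≤ C₁ * (2 ^ m₁ * 2 ^ (k₁ + n) * (2 ^ n * schwartzNorm (n + k₂) (m₁ + m₂) Q
          * (1 + ‖η‖) ^ (-α)) * schwartzNorm (k₁ + n) m₁ χ) * (1 + ‖X‖) ^ (-(n - α)) := by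
          gcongr
          refine hSn.trans ?_
          gcongr
      _ = _ := by ring
  · calc _ ≤ C₂ * (D * (1 + ‖η‖) ^ (-α)) * schwartzNorm (n + k₂) (m₁ + m₂) Q
          * (1 + ‖X‖) ^ (-(n - α)) := by gcongr
      _ = _ := by ring

/-- The kernel estimate for the fractional integral in the time-frequency plane. -/
theorem exists_norm_integral_phase_riesz_mul_le {α : ℝ} (hα : 0 < α) (hαn : α < n) (N : ℕ) :
    ∃ (k m : ℕ) (C : ℝ), 0 ≤ C ∧ ∀ (u h : 𝓢(Rn n, ℂ)) (X η η' : Rn n),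
      ‖∫ ζ, phase (-⟪ζ, X⟫) * (((‖ζ‖ ^ (-α) : ℝ) : ℂ) * (u (ζ - η) * h (ζ - η')))‖
        ≤ C * schwartzNorm k m u * schwartzNorm k m h * (1 + ‖η‖) ^ (-α)
          * (1 + ‖η - η'‖) ^ (-(N : ℝ)) * (1 + ‖X‖) ^ (-(n - α)) := by
  obtain ⟨k, m, C, hC, hb⟩ := exists_norm_integral_phase_riesz_translate_le (n := n) hα hαn
  refine ⟨k + N, m, C * (2 ^ m * 2 ^ (k + N) * 2 ^ N), by positivity, fun u h X η η' => ?_⟩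
  set h' : 𝓢(Rn n, ℂ) := compSubConstCLM ℂ (η' - η) h with hh'
  set Q : 𝓢(Rn n, ℂ) := smulLeftCLM ℂ (h' : Rn n → ℂ) u with hQ
  have hQa : ∀ w, Q w = h (w + (η - η')) * u w := fun w => by
    rw [hQ, smulLeftCLM_apply_apply h'.hasTemperateGrowth, hh', compSubConstCLM_apply, smul_eq_mul]
    congr 2; abel
  have h0 : 0 ≤ schwartzNorm N m h := apply_nonneg _ _
  have hQn : schwartzNorm k m Q ≤ 2 ^ m * 2 ^ (k + N)
      * (2 ^ N * schwartzNorm N m h * (1 + ‖η - η'‖) ^ (-(N : ℝ))) * schwartzNorm (k + N) m u := by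
    refine schwartzNorm_translate_mul_le (derivBound_schwartz m N h) (fun w => ?_) hQa
    have h5 := one_add_norm_rpow_le (n := n) (s := N) (by positivity) (L := N) le_rfl w (η - η')
    calc _ ≤ 2 ^ N * schwartzNorm N m h * ((1 + ‖η - η'‖) ^ (-(N : ℝ)) * (1 + ‖w‖) ^ N) := by
          gcongr
      _ = _ := by ring
  have h1 := hb Q X η
  have h2 : (fun ζ => phase (-⟪ζ, X⟫) * (((‖ζ‖ ^ (-α) : ℝ) : ℂ) * (u (ζ - η) * h (ζ - η'))))
      = fun ζ => phase (-⟪ζ, X⟫) * (((‖ζ‖ ^ (-α) : ℝ) : ℂ) * Q (ζ - η)) := by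
    funext ζ
    rw [hQa, mul_comm (u _)]
    congr 4; abel
  rw [h2]
  have hu0 : 0 ≤ schwartzNorm (k + N) m u := apply_nonneg _ _
  calc _ ≤ _ := h1
    _ ≤ C * (2 ^ m * 2 ^ (k + N) * (2 ^ N * schwartzNorm (k + N) m h
          * (1 + ‖η - η'‖) ^ (-(N : ℝ))) * schwartzNorm (k + N) m u) * (1 + ‖η‖) ^ (-α)
          * (1 + ‖X‖) ^ (-(n - α)) := by
        gcongr
        refine hQn.trans ?_
        gcongr
        exact schwartzNorm_mono (by omega) le_rfl h
    _ = _ := by ring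

/-- The complex conjugate of a Schwartz function. -/
noncomputable def conjSchwartz (φ : 𝓢(Rn n, ℂ)) : 𝓢(Rn n, ℂ) :=
  postcompCLM (Complex.conjCLE : ℂ →L[ℝ] ℂ) φ

theorem conjSchwartz_apply (φ : 𝓢(Rn n, ℂ)) (t : Rn n) :
    conjSchwartz φ t = (starRingEnd ℂ) (φ t) := rfl

/-- The time-frequency shift `t ↦ e^{2πi η·t} ψ(t - x)`. -/
noncomputable def tfShift (ψ : 𝓢(Rn n, ℂ)) (x η : Rn n) : 𝓢(Rn n, ℂ) :=
  conjTimeFreqShift (conjSchwartz ψ) x (-((2 * Real.pi) • η))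

theorem tfShift_apply (ψ : 𝓢(Rn n, ℂ)) (x η t : Rn n) :
    tfShift ψ x η t = phase ⟪η, t⟫ * ψ (t - x) := by
  rw [tfShift, conjTimeFreqShift_apply, conjSchwartz_apply, map_mul, Complex.conj_conj,
    ← Complex.exp_conj, phase]
  congr 2
  rw [map_mul, Complex.conj_I, Complex.conj_ofReal, inner_neg_left, real_inner_smul_left]
  push_cast; ring

theorem conjTimeFreqShift_eq_tfShift (φ : 𝓢(Rn n, ℂ)) (x η : Rn n) :
    conjTimeFreqShift φ x ((2 * Real.pi) • η) = tfShift (conjSchwartz φ) x (-η) := by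
  ext t
  rw [conjTimeFreqShift_apply, tfShift_apply, conjSchwartz_apply, map_mul, ← Complex.exp_conj,
    phase]
  congr 2
  rw [map_mul, Complex.conj_I, Complex.conj_ofReal, inner_neg_left, real_inner_smul_left]
  push_cast; ring

theorem tfShift_zero_zero (ψ : 𝓢(Rn n, ℂ)) : tfShift ψ 0 0 = ψ := by
  ext t
  rw [tfShift_apply, inner_zero_left, phase_zero, one_mul, sub_zero]

theorem fourier_tfShift (ψ : 𝓢(Rn n, ℂ)) (x η ζ : Rn n) :
    𝓕 (tfShift ψ x η) ζ = phase (-⟪x, ζ - η⟫) * 𝓕 ψ (ζ - η) := by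
  rw [fourier_coe, fourier_coe, fourier_eq_phase, fourier_eq_phase, ← integral_const_mul,
    ← integral_add_right_eq_self _ x]
  congr 1; funext v
  simp only [tfShift_apply, add_sub_cancel_right]
  rw [← mul_assoc, ← mul_assoc, ← phase_add, ← phase_add]
  congr 2
  simp only [inner_add_left, inner_add_right, inner_sub_right, real_inner_comm η]
  ring

theorem fourierInv_tfShift (ψ : 𝓢(Rn n, ℂ)) (x η ζ : Rn n) :
    𝓕⁻ (tfShift ψ x η) ζ = phase ⟪x, ζ + η⟫ * 𝓕⁻ ψ (ζ + η) := by
  rw [fourierInv_coe, fourierInv_coe, Real.fourierInv_eq_fourier_neg,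
    Real.fourierInv_eq_fourier_neg, ← fourier_coe, ← fourier_coe, fourier_tfShift,
    ← inner_neg_right]
  congr 2
  · congr 2; abel
  · abel

/-- The modulation norm in terms of the mixed norm with the normalised frequency variable. -/
theorem modulationNorm_eq (φ : 𝓢(Rn n, ℂ)) {p q : ℝ} (hq : 0 < q)
    (f : 𝓢'(Rn n, ℂ)) :
    modulationNorm φ p q f = ENNReal.ofReal ((2 * Real.pi) ^ n) ^ (1 / q)
      * mixedNorm p q (fun x η => ‖stft φ f x ((2 * Real.pi) • η)‖ₑ) := by
  have hπ : 0 < 2 * Real.pi := by positivity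
  have h1 := lintegral_comp_smul hπ (fun ξ : Rn n => ((∫⁻ x, ‖stft φ f x ξ‖ₑ ^ p) ^ (1 / p)) ^ q)
  have h2 : ENNReal.ofReal ((2 * Real.pi) ^ n) * ENNReal.ofReal (((2 * Real.pi) ^ n)⁻¹) = 1 := by
    rw [← ENNReal.ofReal_mul (by positivity), mul_inv_cancel₀ (by positivity), ENNReal.ofReal_one]
  rw [mixedNorm, h1, ← ENNReal.mul_rpow_of_nonneg _ _ (by positivity), ← mul_assoc, h2, one_mul,
    modulationNorm]
  congr 2; funext ξ
  rw [← ENNReal.rpow_mul]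
  congr 1; ring

theorem measurable_stft_normalised (φ : 𝓢(Rn n, ℂ)) (f : 𝓢'(Rn n, ℂ)) :
    Measurable fun z : Rn n × Rn n => stft φ f z.2 ((2 * Real.pi) • z.1) := by
  have h1 : Continuous fun z : Rn n × Rn n => ((2 * Real.pi) • z.1, z.2) := by fun_prop
  have h2 := Measurable.comp (measurable_stft φ f) h1.measurable
  simpa only [Function.comp_def, Function.uncurry] using h2

/-- The matrix coefficient of the fractional integral with a time-frequency shift. -/
noncomputable def rieszCoeff (α : ℝ) (φ g : 𝓢(Rn n, ℂ)) (x η : Rn n) : ℂ :=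
  ∫ t, g t * fractionalIntegral α (tfShift φ x η) t

theorem exists_norm_rieszCoeff_le {α : ℝ} (hα : 0 < α) (hαn : α < n) (φ : 𝓢(Rn n, ℂ)) (N : ℕ) :
    ∃ (k m : ℕ) (C : ℝ), 0 ≤ C ∧ ∀ (θ : 𝓢(Rn n, ℂ)) (x η y η' : Rn n),
      ‖rieszCoeff α φ (tfShift θ y (-η')) x η‖ ≤ C * schwartzNorm k m θ * (1 + ‖η‖) ^ (-α)
        * (1 + ‖η - η'‖) ^ (-(N : ℝ)) * (1 + ‖y - x‖) ^ (-(n - α)) := by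
  obtain ⟨κ, hκ, hp⟩ := exists_integral_mul_fractionalIntegral_eq (n := n) hα hαn
  obtain ⟨k, m, C, hC, hb⟩ := exists_norm_integral_phase_riesz_mul_le (n := n) hα hαn N
  obtain ⟨k', m', C', hC', hb'⟩ := exists_schwartzNorm_clm_le
    (FourierTransform.fourierInvCLM ℂ 𝓢(Rn n, ℂ)) k m
  have hφ0 : 0 ≤ schwartzNorm k m (𝓕 φ) := apply_nonneg _ _
  refine ⟨k', m', κ * (C * schwartzNorm k m (𝓕 φ) * C'), by positivity, fun θ x η y η' => ?_⟩
  have h1 : ∫ ζ, ((‖ζ‖ ^ (-α) : ℝ) : ℂ) * (𝓕 (tfShift φ x η) ζ * 𝓕⁻ (tfShift θ y (-η')) ζ)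
      = (phase ⟪x, η⟫ * phase (-⟪y, η'⟫)) * ∫ ζ, phase (-⟪ζ, x - y⟫) *
        (((‖ζ‖ ^ (-α) : ℝ) : ℂ) * (𝓕 φ (ζ - η) * 𝓕⁻ θ (ζ - η'))) := by
    rw [← integral_const_mul]
    congr 1; funext ζ
    rw [fourier_tfShift, fourierInv_tfShift, ← sub_eq_add_neg]
    have h2 : phase (-⟪x, ζ - η⟫) * phase ⟪y, ζ - η'⟫
        = phase ⟪x, η⟫ * phase (-⟪y, η'⟫) * phase (-⟪ζ, x - y⟫) := by
      rw [← phase_add, ← phase_add, ← phase_add]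
      congr 1
      simp only [inner_sub_right, real_inner_comm ζ]
      ring
    generalize ((‖ζ‖ ^ (-α) : ℝ) : ℂ) = a
    generalize (𝓕 φ) (ζ - η) = b
    generalize (𝓕⁻ θ) (ζ - η') = c
    linear_combination a * b * c * h2
  rw [rieszCoeff, hp, h1, norm_mul, norm_mul, norm_mul, norm_phase, norm_phase, Complex.norm_real,
    Real.norm_of_nonneg hκ.le, one_mul, one_mul]
  have h3 := hb (𝓕 φ) (𝓕⁻ θ) (x - y) η η'
  have h4 := hb' θ
  rw [FourierTransform.fourierInvCLM_apply] at h4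
  refine (mul_le_mul_of_nonneg_left h3 hκ.le).trans ?_
  rw [norm_sub_rev x y]
  generalize schwartzNorm k m (𝓕 φ) = A at hφ0 ⊢
  generalize schwartzNorm k m (𝓕⁻ θ) = B at h4 ⊢
  generalize schwartzNorm k' m' θ = D at h4 ⊢
  have h5 : 0 ≤ κ * (C * A * (1 + ‖η‖) ^ (-α) * (1 + ‖η - η'‖) ^ (-(N : ℝ))
      * (1 + ‖y - x‖) ^ (-(n - α))) := by positivity
  have h6 := mul_le_mul_of_nonneg_left h4 h5
  linarith

theorem rieszCoeff_eq_fourierInv {α : ℝ} (hα : 0 < α) (hαn : α < n) (φ g : 𝓢(Rn n, ℂ))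
    (x η : Rn n) :
    rieszCoeff α φ g x η = 𝓕⁻ (fun t => φ (t - x) * fractionalIntegral α g t) η := by
  rw [rieszCoeff, integral_mul_fractionalIntegral_comm hα hαn, fourierInv_eq_phase]
  congr 1; funext t
  rw [tfShift_apply, real_inner_comm]; ring

theorem measurable_rieszCoeff {α : ℝ} (hα : 0 < α) (hαn : α < n) (φ g : 𝓢(Rn n, ℂ)) :
    Measurable fun z : Rn n × Rn n => rieszCoeff α φ g z.2 z.1 := by
  simp only [rieszCoeff_eq_fourierInv hα hαn, fourierInv_eq_phase]
  refine StronglyMeasurable.measurable ?_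
  refine StronglyMeasurable.integral_prod_right' (f := fun w : (Rn n × Rn n) × Rn n =>
    phase ⟪w.2, w.1.1⟫ * (φ (w.2 - w.1.2) * fractionalIntegral α g w.2)) ?_
  refine Continuous.stronglyMeasurable ?_
  have h1 := continuous_fractionalIntegral hα hαn g
  have h2 := φ.continuous
  have h3 := continuous_phase
  fun_prop

/-- The squared `L²` norm of the window. -/
noncomputable def windowEnergy (φ : 𝓢(Rn n, ℂ)) : ℂ := ∫ t, φ t * (starRingEnd ℂ) (φ t)

theorem integrable_mul_conj (φ : 𝓢(Rn n, ℂ)) :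
    Integrable fun t => φ t * (starRingEnd ℂ) (φ t) := by
  have h := (smulLeftCLM ℂ (φ : Rn n → ℂ) (conjSchwartz φ)).integrable (μ := volume)
  refine h.congr (ae_of_all _ fun t => ?_)
  simp only [smulLeftCLM_apply_apply φ.hasTemperateGrowth, conjSchwartz_apply, smul_eq_mul]

theorem windowEnergy_ne_zero {φ : 𝓢(Rn n, ℂ)} (hφ : φ ≠ 0) : windowEnergy φ ≠ 0 := by
  intro h
  have h1 : ∀ t, φ t * (starRingEnd ℂ) (φ t) = ((‖φ t‖ ^ 2 : ℝ) : ℂ) := fun t => by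
    rw [Complex.mul_conj, Complex.normSq_eq_norm_sq]
  have hi : Integrable fun t => ‖φ t‖ ^ 2 := by
    have := (integrable_mul_conj φ).norm
    refine this.congr (ae_of_all _ fun t => ?_)
    simp only [h1, Complex.norm_real]
    exact Real.norm_of_nonneg (by positivity)
  simp only [windowEnergy, h1] at h
  rw [integral_complex_ofReal, Complex.ofReal_eq_zero,
    integral_eq_zero_iff_of_nonneg (fun t => by positivity) hi] at h
  have hc : Continuous fun t => ‖φ t‖ ^ 2 := φ.continuous.norm.pow 2
  have h2 := (hc.ae_eq_iff_eq volume (continuous_const : Continuous fun _ => (0 : ℝ))).1 h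
  refine hφ (SchwartzMap.ext fun t => ?_)
  have h3 : ‖φ t‖ ^ 2 = 0 := congrFun h2 t
  simpa using h3

/-- Averaging over all translates of the window. -/
theorem integral_integral_window (φ : 𝓢(Rn n, ℂ)) {G : Rn n → ℂ} (hG : Integrable G) :
    ∫ x, ∫ t, G t * (φ (t - x) * (starRingEnd ℂ) (φ (t - x))) = windowEnergy φ * ∫ t, G t := by
  set w : Rn n → ℂ := fun s => φ (-s) * (starRingEnd ℂ) (φ (-s)) with hw
  have hwi : Integrable w := (integrable_mul_conj φ).comp_neg
  have h1 := hG.convolution_integrand (ContinuousLinearMap.mul ℂ ℂ) hwi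
  have h2 : Integrable (Function.uncurry fun x t : Rn n =>
      G t * (φ (t - x) * (starRingEnd ℂ) (φ (t - x)))) (volume.prod volume) := by
    refine h1.congr (ae_of_all _ fun p => ?_)
    simp only [hw, Function.uncurry, ContinuousLinearMap.mul_apply', neg_sub]
  rw [integral_integral_swap h2, mul_comm, ← integral_mul_const]
  congr 1; funext t
  rw [integral_const_mul, windowEnergy]
  congr 1
  exact integral_sub_left_eq_self (fun s => φ s * (starRingEnd ℂ) (φ s)) volume t

theorem integral_fourier_mul_fourierInv (v : 𝓢(Rn n, ℂ)) {u : Rn n → ℂ} (hu : Integrable u) :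
    ∫ η, 𝓕 v η * 𝓕⁻ u η = ∫ t, v t * u t := by
  have h := integral_fourierInv_mul_eq_flip (𝓕 v).integrable hu
  rw [← h, ← fourierInv_coe, FourierTransform.fourierInv_fourier_eq]

theorem integral_fourierInv_mul_fourier (v : 𝓢(Rn n, ℂ)) {u : Rn n → ℂ} (hu : Integrable u) :
    ∫ η, 𝓕⁻ v η * 𝓕 u η = ∫ t, v t * u t := by
  have h := integral_fourier_mul_eq_flip (𝓕⁻ v).integrable hu
  rw [← h, ← fourier_coe, FourierTransform.fourier_fourierInv_eq]

theorem exists_coe_eq {x : ℝ≥0∞} (h : x ≠ ∞) : ∃ a : ℝ≥0, (a : ℝ≥0∞) = x :=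
  ⟨_, ENNReal.coe_toNNReal h⟩

theorem mixedNorm_const_mul {p q : ℝ} (hp : 0 < p) (hq : 0 < q) (E : ℝ≥0)
    (Φ : Rn n → Rn n → ℝ≥0∞) :
    mixedNorm p q (fun x ξ => E * Φ x ξ) = E * mixedNorm p q Φ := by
  unfold mixedNorm
  have hEr : ∀ r : ℝ, 0 < r → (E : ℝ≥0∞) ^ r ≠ ∞ := fun r hr =>
    ENNReal.rpow_ne_top_of_nonneg hr.le ENNReal.coe_ne_top
  simp only [ENNReal.mul_rpow_of_nonneg _ _ hp.le, lintegral_const_mul' _ _ (hEr p hp),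
    ENNReal.mul_rpow_of_nonneg _ _ (one_div_pos.2 hp).le, ← ENNReal.rpow_mul,
    mul_one_div_cancel hp.ne', ENNReal.rpow_one, ENNReal.mul_rpow_of_nonneg _ _ hq.le,
    lintegral_const_mul' _ _ (hEr q hq),
    ENNReal.mul_rpow_of_nonneg _ _ (one_div_pos.2 hq).le, mul_one_div_cancel hq.ne']

theorem exists_enorm_rieszCoeff_le {α : ℝ} (hα : 0 < α) (hαn : α < n) (φ : 𝓢(Rn n, ℂ)) (N : ℕ) :
    ∃ (k m : ℕ) (C : ℝ≥0), ∀ (θ : 𝓢(Rn n, ℂ)) (x η y η' : Rn n),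
      ‖rieszCoeff α φ (tfShift θ y (-η')) x η‖ₑ ≤ C * ENNReal.ofReal (schwartzNorm k m θ)
        * (polyWeight α η * polyWeight N (η - η') * polyWeight (n - α) (y - x)) := by
  obtain ⟨k, m, C, hC, h⟩ := exists_norm_rieszCoeff_le hα hαn φ N
  refine ⟨k, m, C.toNNReal, fun θ x η y η' => ?_⟩
  rw [← ofReal_norm]
  refine (ENNReal.ofReal_le_ofReal (h θ x η y η')).trans_eq ?_
  have h0 : 0 ≤ schwartzNorm k m θ := apply_nonneg _ _
  rw [polyWeight, polyWeight, polyWeight, ENNReal.ofReal_mul (by positivity),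
    ENNReal.ofReal_mul (by positivity), ENNReal.ofReal_mul (by positivity),
    ENNReal.ofReal_mul (by positivity)]
  simp only [mul_assoc]
  rfl

theorem rieszCoeff_add {α : ℝ} (hα : 0 < α) (hαn : α < n) (φ g h : 𝓢(Rn n, ℂ)) (x η : Rn n) :
    rieszCoeff α φ (g + h) x η = rieszCoeff α φ g x η + rieszCoeff α φ h x η := by
  unfold rieszCoeff
  rw [← integral_add (integrable_mul_fractionalIntegral hα hαn _ g.integrable)
    (integrable_mul_fractionalIntegral hα hαn _ h.integrable)]
  congr 1; funext t
  rw [_root_.add_apply, add_mul]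

theorem rieszCoeff_smul (α : ℝ) (φ g : 𝓢(Rn n, ℂ)) (c : ℂ) (x η : Rn n) :
    rieszCoeff α φ (c • g) x η = c * rieszCoeff α φ g x η := by
  unfold rieszCoeff
  rw [← integral_const_mul]
  congr 1; funext t
  rw [_root_.smul_apply, smul_eq_mul, mul_assoc]

theorem measurable_enorm_stft (φ : 𝓢(Rn n, ℂ)) (f : 𝓢'(Rn n, ℂ)) :
    Measurable (Function.uncurry fun x η : Rn n => ‖stft φ f x ((2 * Real.pi) • η)‖ₑ) :=
  ((measurable_stft_normalised φ f).comp measurable_swap).enorm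

theorem exists_lintegral_mul_rieszCoeff_le {α : ℝ} (hα : 0 < α) (hαn : α < n) (φ : 𝓢(Rn n, ℂ))
    {p q : ℝ} (hp : 1 < p) (hq : 1 < q) (hpα : α / n < 1 / p) :
    ∃ (k m : ℕ) (C : ℝ≥0), ∀ (f : 𝓢'(Rn n, ℂ)) (g : 𝓢(Rn n, ℂ)),
      ∫⁻ z : Rn n × Rn n, ‖stft φ f z.2 ((2 * Real.pi) • z.1) * rieszCoeff α φ g z.2 z.1‖ₑ
        ≤ C * ENNReal.ofReal (schwartzNorm k m g)
          * mixedNorm p q (fun x η => ‖stft φ f x ((2 * Real.pi) • η)‖ₑ) := by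
  have hn : (0 : ℝ) < n := hα.trans hαn
  have hp' := Real.HolderConjugate.conjExponent hp
  have hq' := Real.HolderConjugate.conjExponent hq
  obtain ⟨k, m, C, h⟩ := exists_enorm_rieszCoeff_le hα hαn φ (n + 1)
  have hw1 : (∫⁻ x : Rn n, polyWeight (n - α) x ^ p.conjExponent) ^ (1 / p.conjExponent) ≠ ∞ := by
    refine lintegral_polyWeight_rpow_ne_top ?_ hp'.symm.pos
    have h1 : 1 / p.conjExponent = 1 - 1 / p := by
      have := hp'.inv_add_inv_eq_one; simp only [one_div]; linarith
    have h2 : 1 / p.conjExponent < (n - α) / n := by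
      rw [h1, sub_div, div_self hn.ne']; linarith
    rw [div_lt_div_iff₀ hp'.symm.pos hn] at h2
    linarith
  have hw2 : (∫⁻ x : Rn n, polyWeight ((n + 1 : ℕ) : ℝ) x ^ q.conjExponent)
      ^ (1 / q.conjExponent) ≠ ∞ := by
    refine lintegral_polyWeight_rpow_ne_top ?_ hq'.symm.pos
    have := hq'.symm.lt
    push_cast; nlinarith
  obtain ⟨w1, hw1⟩ := exists_coe_eq hw1
  obtain ⟨w2, hw2⟩ := exists_coe_eq hw2
  refine ⟨k, m, C * (w1 * w2), fun f g => ?_⟩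
  set V : Rn n → Rn n → ℝ≥0∞ := fun x η => ‖stft φ f x ((2 * Real.pi) • η)‖ₑ with hV
  have hVm : Measurable (Function.uncurry V) := measurable_enorm_stft φ f
  have hWm : Measurable (Function.uncurry fun x η : Rn n =>
      polyWeight (n - α) x * polyWeight ((n + 1 : ℕ) : ℝ) η) :=
    ((measurable_polyWeight _).comp measurable_fst).mul
      ((measurable_polyWeight _).comp measurable_snd)
  have hb : ∀ x η : Rn n, ‖rieszCoeff α φ g x η‖ₑ ≤ C * ENNReal.ofReal (schwartzNorm k m g)
      * (polyWeight (n - α) x * polyWeight ((n + 1 : ℕ) : ℝ) η) := by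
    intro x η
    have h1 := h g x η 0 0
    rw [neg_zero, tfShift_zero_zero, sub_zero, zero_sub] at h1
    refine h1.trans ?_
    have h2 : polyWeight (n - α) (-x) = polyWeight (n - α) x := by simp only [polyWeight, norm_neg]
    rw [h2]
    refine mul_le_mul_right ?_ _
    calc polyWeight α η * polyWeight ((n + 1 : ℕ) : ℝ) η * polyWeight (n - α) x
        ≤ 1 * polyWeight ((n + 1 : ℕ) : ℝ) η * polyWeight (n - α) x := by
          gcongr; exact polyWeight_le_one hα.le η
      _ = _ := by ring
  have hRm : Measurable fun z : Rn n × Rn n =>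
      ‖stft φ f z.2 ((2 * Real.pi) • z.1) * rieszCoeff α φ g z.2 z.1‖ₑ :=
    ((measurable_stft_normalised φ f).mul (measurable_rieszCoeff hα hαn φ g)).enorm
  rw [Measure.volume_eq_prod, lintegral_prod _ hRm.aemeasurable]
  calc ∫⁻ η, ∫⁻ x, ‖stft φ f x ((2 * Real.pi) • η) * rieszCoeff α φ g x η‖ₑ
      ≤ ∫⁻ η, ∫⁻ x, C * ENNReal.ofReal (schwartzNorm k m g)
          * (V x η * (polyWeight (n - α) x * polyWeight ((n + 1 : ℕ) : ℝ) η)) := by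
        refine lintegral_mono fun η => lintegral_mono fun x => ?_
        rw [enorm_mul]
        refine (mul_le_mul_right (hb x η) _).trans_eq ?_
        simp only [hV]; ring
    _ = C * ENNReal.ofReal (schwartzNorm k m g) * ∫⁻ η, ∫⁻ x,
          V x η * (polyWeight (n - α) x * polyWeight ((n + 1 : ℕ) : ℝ) η) := by
        have hc : C * ENNReal.ofReal (schwartzNorm k m g) ≠ ∞ :=
          ENNReal.mul_ne_top ENNReal.coe_ne_top ENNReal.ofReal_ne_top
        simp only [lintegral_const_mul' _ _ hc]
    _ ≤ C * ENNReal.ofReal (schwartzNorm k m g) * (mixedNorm p q V * (w1 * w2)) := by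
        gcongr
        refine (lintegral_mul_le_mixedNorm hp hq hVm hWm).trans_eq ?_
        rw [mixedNorm_mul hp'.symm.pos hq'.symm.pos (measurable_polyWeight _)
          (measurable_polyWeight _), ← hw1, ← hw2]
    _ = _ := by push_cast; ring

theorem mixedNorm_stft_ne_top {φ : 𝓢(Rn n, ℂ)} {p q : ℝ} {hp : 1 ≤ p} {hq : 1 ≤ q}
    (f : modulationSpace φ p q hp hq) :
    mixedNorm p q (fun x η => ‖stft φ f x ((2 * Real.pi) • η)‖ₑ) ≠ ∞ := by
  have hf : modulationNorm φ p q f < ∞ := f.2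
  rw [modulationNorm_eq φ (by linarith)] at hf
  intro h
  rw [h, ENNReal.mul_top] at hf
  · exact lt_irrefl _ hf
  · refine (ENNReal.rpow_pos ?_ ENNReal.ofReal_ne_top).ne'
    rw [ENNReal.ofReal_pos]; positivity

theorem integrable_stft_mul_rieszCoeff {α : ℝ} (hα : 0 < α) (hαn : α < n) {φ : 𝓢(Rn n, ℂ)}
    {p q : ℝ} (hp : 1 < p) (hq : 1 < q) (hpα : α / n < 1 / p)
    (f : modulationSpace φ p q hp.le hq.le) (g : 𝓢(Rn n, ℂ)) :
    Integrable fun z : Rn n × Rn n =>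
      stft φ f z.2 ((2 * Real.pi) • z.1) * rieszCoeff α φ g z.2 z.1 := by
  obtain ⟨k, m, C, h⟩ := exists_lintegral_mul_rieszCoeff_le hα hαn φ hp hq hpα
  refine ⟨((measurable_stft_normalised φ f).mul
    (measurable_rieszCoeff hα hαn φ g)).aestronglyMeasurable, ?_⟩
  refine (h f g).trans_lt ?_
  exact ENNReal.mul_lt_top (ENNReal.mul_lt_top ENNReal.coe_lt_top ENNReal.ofReal_lt_top)
    (mixedNorm_stft_ne_top f).lt_top

/-- The fractional integral of `f`, paired with a Schwartz function `g`, in terms of the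
short-time Fourier transform of `f`. -/
noncomputable def fractionalPairing (α : ℝ) (φ : 𝓢(Rn n, ℂ)) (f : 𝓢'(Rn n, ℂ)) (g : 𝓢(Rn n, ℂ)) :
    ℂ :=
  (windowEnergy φ)⁻¹ * ∫ z : Rn n × Rn n,
    stft φ f z.2 ((2 * Real.pi) • z.1) * rieszCoeff α φ g z.2 z.1

theorem exists_norm_fractionalPairing_le {α : ℝ} (hα : 0 < α) (hαn : α < n) {φ : 𝓢(Rn n, ℂ)}
    {p q : ℝ} (hp : 1 < p) (hq : 1 < q) (hpα : α / n < 1 / p)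
    (f : modulationSpace φ p q hp.le hq.le) :
    ∃ (s : Finset (ℕ × ℕ)) (C : ℝ), 0 ≤ C ∧ ∀ g : 𝓢(Rn n, ℂ), ‖fractionalPairing α φ f g‖
      ≤ C * s.sup (schwartzSeminormFamily ℂ (Rn n) ℂ) g := by
  obtain ⟨k, m, C, h⟩ := exists_lintegral_mul_rieszCoeff_le hα hαn φ hp hq hpα
  obtain ⟨A, hA⟩ := exists_coe_eq (mixedNorm_stft_ne_top f)
  refine ⟨Finset.Iic (k, m), ‖(windowEnergy φ)⁻¹‖ * (C * A), by positivity, fun g => ?_⟩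
  have h0 : 0 ≤ schwartzNorm k m g := apply_nonneg _ _
  rw [fractionalPairing, norm_mul, mul_assoc]
  refine mul_le_mul_of_nonneg_left ?_ (norm_nonneg _)
  refine (norm_integral_le_lintegral_norm _).trans ?_
  refine ENNReal.toReal_le_of_le_ofReal (by positivity) ?_
  simp only [ofReal_norm]
  refine (h f g).trans_eq ?_
  rw [← hA, ENNReal.ofReal_mul (by positivity), ENNReal.ofReal_mul (by positivity),
    ENNReal.ofReal_coe_nnreal, ENNReal.ofReal_coe_nnreal]
  ring

/-- The extension of the fractional integral to the modulation space. -/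
noncomputable def fractionalDistribution {α : ℝ} (hα : 0 < α) (hαn : α < n) {φ : 𝓢(Rn n, ℂ)}
    {p q : ℝ} (hp : 1 < p) (hq : 1 < q) (hpα : α / n < 1 / p)
    (f : modulationSpace φ p q hp.le hq.le) : 𝓢'(Rn n, ℂ) :=
  ContinuousLinearMap.toPointwiseConvergenceCLM _ _ _ _ (mkCLMtoNormedSpace (𝕜 := ℂ) (σ := RingHom.id ℂ)
    (fractionalPairing α φ (f : 𝓢'(Rn n, ℂ)))
    (fun g h => by
      rw [fractionalPairing, fractionalPairing, fractionalPairing, ← mul_add, ← integral_add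
        (integrable_stft_mul_rieszCoeff hα hαn hp hq hpα f g)
        (integrable_stft_mul_rieszCoeff hα hαn hp hq hpα f h)]
      congr 2; funext z
      rw [rieszCoeff_add hα hαn, mul_add])
    (fun c g => by
      rw [fractionalPairing, fractionalPairing, RingHom.id_apply, smul_eq_mul, mul_left_comm,
        ← integral_const_mul c]
      congr 2; funext z
      rw [rieszCoeff_smul, mul_left_comm])
    (exists_norm_fractionalPairing_le hα hαn hp hq hpα f))

theorem fractionalDistribution_apply {α : ℝ} (hα : 0 < α) (hαn : α < n) {φ : 𝓢(Rn n, ℂ)}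
    {p q : ℝ} (hp : 1 < p) (hq : 1 < q) (hpα : α / n < 1 / p)
    (f : modulationSpace φ p q hp.le hq.le) (g : 𝓢(Rn n, ℂ)) :
    fractionalDistribution hα hαn hp hq hpα f g = fractionalPairing α φ f g := rfl

theorem exists_modulationNorm_fractionalDistribution_le {α : ℝ} (hα : 0 < α) (hαn : α < n)
    (φ : 𝓢(Rn n, ℂ)) {p₁ p₂ q₁ q₂ : ℝ} (hp₁ : 1 < p₁) (hp₂ : 1 < p₂) (hq₁ : 1 < q₁)
    (hq₂ : 1 < q₂) (hp : 1 / p₂ ≤ 1 / p₁ - α / n) (hq : 1 / q₂ < 1 / q₁ + α / n)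
    (hpα : α / n < 1 / p₁) :
    ∃ C : ℝ≥0, ∀ f : modulationSpace φ p₁ q₁ hp₁.le hq₁.le,
      modulationNorm φ p₂ q₂ (fractionalDistribution hα hαn hp₁ hq₁ hpα f)
        ≤ C * modulationNorm φ p₁ q₁ f := by
  have hnR : (0 : ℝ) < n := hα.trans hαn
  have hn : 0 < n := by exact_mod_cast hnR
  obtain ⟨k, m, C, h⟩ := exists_enorm_rieszCoeff_le hα hαn φ (n + 1)
  obtain ⟨C', h'⟩ := exists_mixedNorm_model_le (N := ((n + 1 : ℕ) : ℝ)) hn hα (by push_cast; linarith)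
    hp₁ hp₂ hq₁ hq₂ hp hq
  set E : ℝ≥0 := ‖(windowEnergy φ)⁻¹‖₊ * C * (schwartzNorm k m (conjSchwartz φ)).toNNReal with hE
  have hcpos : ∀ q : ℝ, ENNReal.ofReal ((2 * Real.pi) ^ n) ^ (1 / q) ≠ 0 := fun q => by
    refine (ENNReal.rpow_pos ?_ ENNReal.ofReal_ne_top).ne'
    rw [ENNReal.ofReal_pos]; positivity
  have hcfin : ∀ q : ℝ, 1 < q → ENNReal.ofReal ((2 * Real.pi) ^ n) ^ (1 / q) ≠ ∞ := fun q hq =>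
    ENNReal.rpow_ne_top_of_nonneg (by positivity) ENNReal.ofReal_ne_top
  obtain ⟨a, ha⟩ := exists_coe_eq (hcfin q₂ hq₂)
  obtain ⟨b, hb⟩ := exists_coe_eq (hcfin q₁ hq₁)
  have hb0 : b ≠ 0 := by
    intro h0; refine hcpos q₁ ?_; rw [← hb, h0]; rfl
  refine ⟨a * E * C' * b⁻¹, fun f => ?_⟩
  set V : Rn n → Rn n → ℝ≥0∞ := fun x η => ‖stft φ f x ((2 * Real.pi) • η)‖ₑ with hV
  have hVm : Measurable (Function.uncurry V) := measurable_enorm_stft φ f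
  have hpt : ∀ y η, ‖stft φ (fractionalDistribution hα hαn hp₁ hq₁ hpα f) y ((2 * Real.pi) • η)‖ₑ
      ≤ ∫⁻ ξ, ∫⁻ x, polyWeight α ξ * polyWeight ((n + 1 : ℕ) : ℝ) (ξ - η)
        * polyWeight (n - α) (y - x) * (E * V x ξ) := by
    intro y η
    rw [stft, fractionalDistribution_apply, conjTimeFreqShift_eq_tfShift, fractionalPairing,
      enorm_mul]
    have hRm : Measurable fun z : Rn n × Rn n => ‖stft φ f z.2 ((2 * Real.pi) • z.1)
        * rieszCoeff α φ (tfShift (conjSchwartz φ) y (-η)) z.2 z.1‖ₑ :=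
      ((measurable_stft_normalised φ f).mul (measurable_rieszCoeff hα hαn φ _)).enorm
    refine (mul_le_mul_right (enorm_integral_le_lintegral_enorm _) _).trans ?_
    rw [Measure.volume_eq_prod, lintegral_prod _ hRm.aemeasurable]
    rw [← lintegral_const_mul' _ _ enorm_ne_top]
    refine lintegral_mono fun ξ => ?_
    simp only
    rw [← lintegral_const_mul' _ _ enorm_ne_top]
    refine lintegral_mono fun x => ?_
    simp only
    rw [enorm_mul]
    refine (mul_le_mul_right (mul_le_mul_right (h _ x ξ y η) _) _).trans_eq ?_
    simp only [hE, hV, ENNReal.coe_mul, ENNReal.ofReal, enorm_eq_nnnorm]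
    ring
  rw [modulationNorm_eq φ (by linarith), modulationNorm_eq φ (by linarith), ← ha, ← hb]
  have h1 := mixedNorm_mono (p := p₂) (q := q₂) (by linarith) (by linarith) hpt
  have h2 := h1.trans (h' (fun x ξ => E * V x ξ) (hVm.const_mul _))
  rw [mixedNorm_const_mul (by linarith) (by linarith)] at h2
  refine (mul_le_mul_right h2 _).trans_eq ?_
  have h4 : ((b⁻¹ : ℝ≥0) : ℝ≥0∞) * b = 1 := by
    rw [← ENNReal.coe_mul, inv_mul_cancel₀ hb0, ENNReal.coe_one]
  push_cast
  change (a : ℝ≥0∞) * (C' * (E * mixedNorm p₁ q₁ V)) = a * E * C' * ((b⁻¹ : ℝ≥0) : ℝ≥0∞)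
    * (b * mixedNorm p₁ q₁ V)
  calc _ = (a : ℝ≥0∞) * E * C' * mixedNorm p₁ q₁ V * 1 := by ring
    _ = _ := by rw [← h4]; ring

/-- The product of `f` with a translate of the window. -/
noncomputable def windowed (φ f : 𝓢(Rn n, ℂ)) (x : Rn n) : 𝓢(Rn n, ℂ) :=
  smulLeftCLM ℂ (f : Rn n → ℂ) (compSubConstCLM ℂ x φ)

theorem windowed_apply (φ f : 𝓢(Rn n, ℂ)) (x t : Rn n) : windowed φ f x t = f t * φ (t - x) := by
  rw [windowed, smulLeftCLM_apply_apply f.hasTemperateGrowth, compSubConstCLM_apply, smul_eq_mul]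

theorem stft_schwartz (φ f : 𝓢(Rn n, ℂ)) (x η : Rn n) :
    stft φ (f : 𝓢'(Rn n, ℂ)) x ((2 * Real.pi) • η) = 𝓕 (windowed (conjSchwartz φ) f x) η := by
  rw [stft, conjTimeFreqShift_eq_tfShift, SchwartzMap.coe_apply, fourier_coe, fourier_eq_phase]
  congr 1; funext t
  rw [tfShift_apply, windowed_apply, smul_eq_mul, inner_neg_left, real_inner_comm]
  ring

theorem fractionalPairing_schwartz {α : ℝ} (hα : 0 < α) (hαn : α < n) {φ : 𝓢(Rn n, ℂ)}
    (hφ : φ ≠ 0) {p q : ℝ} (hp : 1 < p) (hq : 1 < q) (hpα : α / n < 1 / p) (f : 𝓢(Rn n, ℂ))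
    (hf : (f : 𝓢'(Rn n, ℂ)) ∈ modulationSpace φ p q hp.le hq.le) (g : 𝓢(Rn n, ℂ)) :
    fractionalPairing α φ (f : 𝓢'(Rn n, ℂ)) g = ∫ x, g x * fractionalIntegral α f x := by
  have hi := integrable_stft_mul_rieszCoeff hα hαn hp hq hpα ⟨_, hf⟩ g
  rw [fractionalPairing, Measure.volume_eq_prod, integral_prod_symm _ hi]
  have hx : ∀ x : Rn n, ∫ η, stft φ (f : 𝓢'(Rn n, ℂ)) x ((2 * Real.pi) • η) * rieszCoeff α φ g x η
      = ∫ t, (f t * fractionalIntegral α g t) * (φ (t - x) * (starRingEnd ℂ) (φ (t - x))) := by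
    intro x
    simp only [stft_schwartz, rieszCoeff_eq_fourierInv hα hαn]
    have hu : Integrable fun t => φ (t - x) * fractionalIntegral α g t :=
      integrable_mul_fractionalIntegral hα hαn g (φ.integrable.comp_sub_right x)
    rw [integral_fourier_mul_fourierInv _ hu]
    congr 1; funext t
    rw [windowed_apply, conjSchwartz_apply]
    ring
  simp only [hx]
  rw [integral_integral_window φ (integrable_mul_fractionalIntegral hα hαn g f.integrable),
    inv_mul_cancel_left₀ (windowEnergy_ne_zero hφ), integral_mul_fractionalIntegral_comm hα hαn]

theorem stft_add (φ : 𝓢(Rn n, ℂ)) (f g : 𝓢'(Rn n, ℂ)) (x ξ : Rn n) :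
    stft φ (f + g) x ξ = stft φ f x ξ + stft φ g x ξ := rfl

theorem stft_smul (φ : 𝓢(Rn n, ℂ)) (c : ℂ) (f : 𝓢'(Rn n, ℂ)) (x ξ : Rn n) :
    stft φ (c • f) x ξ = c * stft φ f x ξ := rfl

theorem fractionalIntegralBounded_of_exponents {α : ℝ} (hα : 0 < α) (hαn : α < n)
    {φ : 𝓢(Rn n, ℂ)} (hφ : φ ≠ 0) {p₁ p₂ q₁ q₂ : ℝ} (hp₁ : 1 < p₁) (hp₂ : 1 < p₂) (hq₁ : 1 < q₁)
    (hq₂ : 1 < q₂) (hp : 1 / p₂ ≤ 1 / p₁ - α / n) (hq : 1 / q₂ < 1 / q₁ + α / n) :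
    FractionalIntegralBounded φ α p₁ q₁ p₂ q₂ hp₁.le hq₁.le hp₂.le hq₂.le := by
  have hpα : α / n < 1 / p₁ := by
    have : 0 < 1 / p₂ := by positivity
    linarith
  obtain ⟨C, hC⟩ := exists_modulationNorm_fractionalDistribution_le hα hαn φ hp₁ hp₂ hq₁ hq₂ hp hq
    hpα
  refine ⟨{ toFun := fun f => ⟨fractionalDistribution hα hαn hp₁ hq₁ hpα f,
              (hC f).trans_lt (ENNReal.mul_lt_top ENNReal.coe_lt_top f.2)⟩
            map_add' := fun f g => ?_
            map_smul' := fun c f => ?_ }, ⟨C, hC⟩, fun f hf g => ?_⟩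
  · refine Subtype.ext (ContinuousLinearMap.ext fun h => ?_)
    change fractionalPairing α φ (f + g : 𝓢'(Rn n, ℂ)) h
      = fractionalPairing α φ (f : 𝓢'(Rn n, ℂ)) h + fractionalPairing α φ (g : 𝓢'(Rn n, ℂ)) h
    rw [fractionalPairing, fractionalPairing, fractionalPairing, ← mul_add, ← integral_add
      (integrable_stft_mul_rieszCoeff hα hαn hp₁ hq₁ hpα f h)
      (integrable_stft_mul_rieszCoeff hα hαn hp₁ hq₁ hpα g h)]
    congr 2; funext z
    rw [stft_add, add_mul]
  · refine Subtype.ext (ContinuousLinearMap.ext fun h => ?_)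
    change fractionalPairing α φ (c • f : 𝓢'(Rn n, ℂ)) h
      = c * fractionalPairing α φ (f : 𝓢'(Rn n, ℂ)) h
    rw [fractionalPairing, fractionalPairing, mul_left_comm, ← integral_const_mul c]
    congr 2; funext z
    rw [stft_smul, mul_assoc]
  · exact fractionalPairing_schwartz hα hαn hφ hp₁ hq₁ hpα f hf g

theorem conjSchwartz_conjSchwartz (φ : 𝓢(Rn n, ℂ)) : conjSchwartz (conjSchwartz φ) = φ := by
  ext t; simp only [conjSchwartz_apply, Complex.conj_conj]

theorem measurable_enorm_fourier_windowed (φ f : 𝓢(Rn n, ℂ)) :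
    Measurable (Function.uncurry fun x η : Rn n => ‖𝓕 (windowed φ f x) η‖ₑ) := by
  have h := measurable_enorm_stft (conjSchwartz φ) (f : 𝓢'(Rn n, ℂ))
  simpa only [stft_schwartz, conjSchwartz_conjSchwartz] using h

theorem mixedNorm_neg (p q : ℝ) (Φ : Rn n → Rn n → ℝ≥0∞) :
    mixedNorm p q (fun x η => Φ x (-η)) = mixedNorm p q Φ := by
  unfold mixedNorm
  congr 1
  exact lintegral_neg_eq_self (fun ξ => ((∫⁻ x, Φ x ξ ^ p) ^ (1 / p)) ^ q)

/-- Boundedness of the fractional integral implies a bound for its bilinear form. -/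
theorem FractionalIntegralBounded.exists_enorm_integral_le {α : ℝ} (hα : 0 < α) (hαn : α < n)
    {φ : 𝓢(Rn n, ℂ)} (hφ : φ ≠ 0) {p₁ p₂ q₁ q₂ : ℝ} (hp₁ : 1 < p₁) (hp₂ : 1 < p₂) (hq₁ : 1 < q₁)
    (hq₂ : 1 < q₂) (hb : FractionalIntegralBounded φ α p₁ q₁ p₂ q₂ hp₁.le hq₁.le hp₂.le hq₂.le) :
    ∃ C : ℝ≥0, ∀ f g : 𝓢(Rn n, ℂ),
      mixedNorm p₁ q₁ (fun x η => ‖𝓕 (windowed (conjSchwartz φ) f x) η‖ₑ) ≠ ∞ →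
      ‖∫ x, g x * fractionalIntegral α f x‖ₑ
        ≤ C * mixedNorm p₁ q₁ (fun x η => ‖𝓕 (windowed (conjSchwartz φ) f x) η‖ₑ)
          * mixedNorm p₂.conjExponent q₂.conjExponent (fun x η => ‖𝓕 (windowed φ g x) η‖ₑ) := by
  obtain ⟨T, ⟨C, hC⟩, hT⟩ := hb
  have hcpos : ∀ q : ℝ, ENNReal.ofReal ((2 * Real.pi) ^ n) ^ (1 / q) ≠ 0 := fun q => by
    refine (ENNReal.rpow_pos ?_ ENNReal.ofReal_ne_top).ne'
    rw [ENNReal.ofReal_pos]; positivity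
  have hcfin : ∀ q : ℝ, 1 < q → ENNReal.ofReal ((2 * Real.pi) ^ n) ^ (1 / q) ≠ ∞ := fun q hq =>
    ENNReal.rpow_ne_top_of_nonneg (by positivity) ENNReal.ofReal_ne_top
  obtain ⟨a, ha⟩ := exists_coe_eq (hcfin q₂ hq₂)
  obtain ⟨b, hb⟩ := exists_coe_eq (hcfin q₁ hq₁)
  have ha0 : a ≠ 0 := by
    intro h0; refine hcpos q₂ ?_; rw [← ha, h0]; rfl
  have hW := windowEnergy_ne_zero hφ
  refine ⟨‖(windowEnergy φ)⁻¹‖₊ * (a⁻¹ * C * b), fun f g hfin => ?_⟩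
  have hf : (f : 𝓢'(Rn n, ℂ)) ∈ modulationSpace φ p₁ q₁ hp₁.le hq₁.le := by
    change modulationNorm φ p₁ q₁ (f : 𝓢'(Rn n, ℂ)) < ∞
    rw [modulationNorm_eq φ (by linarith)]
    simp only [stft_schwartz]
    exact ENNReal.mul_lt_top (hcfin q₁ hq₁).lt_top hfin.lt_top
  set F : 𝓢'(Rn n, ℂ) := (T ⟨(f : 𝓢'(Rn n, ℂ)), hf⟩ : 𝓢'(Rn n, ℂ)) with hF
  have hu : ∀ x, Integrable fun t => conjSchwartz φ (t - x) * fractionalIntegral α f t := fun x =>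
    integrable_mul_fractionalIntegral hα hαn f ((conjSchwartz φ).integrable.comp_sub_right x)
  have hV : ∀ x η, stft φ F x ((2 * Real.pi) • η)
      = 𝓕 (fun t => conjSchwartz φ (t - x) * fractionalIntegral α f t) η := by
    intro x η
    rw [stft, conjTimeFreqShift_eq_tfShift, hF, hT, fourier_eq_phase]
    congr 1; funext t
    rw [tfShift_apply, inner_neg_left, real_inner_comm, mul_assoc]
  have h1 : windowEnergy φ * ∫ x, g x * fractionalIntegral α f x
      = ∫ x, ∫ η, 𝓕⁻ (windowed φ g x) η * stft φ F x ((2 * Real.pi) • η) := by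
    rw [← integral_integral_window φ (integrable_mul_fractionalIntegral hα hαn f g.integrable)]
    congr 1; funext x
    simp only [hV]
    rw [integral_fourierInv_mul_fourier _ (hu x)]
    congr 1; funext t
    rw [windowed_apply, conjSchwartz_apply]; ring
  have hΨ : ∀ x η, ‖𝓕⁻ (windowed φ g x) η‖ₑ = ‖𝓕 (windowed φ g x) (-η)‖ₑ := fun x η => by
    rw [← ofReal_norm, norm_fourierInv_schwartz, ofReal_norm]
  have hm1 := measurable_enorm_stft φ F
  have hm2 : Measurable (Function.uncurry fun x η : Rn n => ‖𝓕 (windowed φ g x) (-η)‖ₑ) := by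
    have h1 : Continuous fun z : Rn n × Rn n => (z.1, -z.2) := by fun_prop
    have h2 := Measurable.comp (measurable_enorm_fourier_windowed φ g) h1.measurable
    simpa only [Function.comp_def, Function.uncurry_def] using h2
  have h2 : ‖windowEnergy φ * ∫ x, g x * fractionalIntegral α f x‖ₑ
      ≤ mixedNorm p₂ q₂ (fun x η => ‖stft φ F x ((2 * Real.pi) • η)‖ₑ)
        * mixedNorm p₂.conjExponent q₂.conjExponent (fun x η => ‖𝓕 (windowed φ g x) η‖ₑ) := by
    rw [h1]
    calc _ ≤ ∫⁻ x, ∫⁻ η, ‖𝓕⁻ (windowed φ g x) η * stft φ F x ((2 * Real.pi) • η)‖ₑ :=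
          (enorm_integral_le_lintegral_enorm _).trans
            (lintegral_mono fun x => enorm_integral_le_lintegral_enorm _)
      _ = ∫⁻ x, ∫⁻ η, ‖stft φ F x ((2 * Real.pi) • η)‖ₑ * ‖𝓕 (windowed φ g x) (-η)‖ₑ := by
          congr! 4 with x η
          rw [enorm_mul, hΨ, mul_comm]
      _ = ∫⁻ η, ∫⁻ x, ‖stft φ F x ((2 * Real.pi) • η)‖ₑ * ‖𝓕 (windowed φ g x) (-η)‖ₑ :=
          lintegral_lintegral_swap (hm1.mul hm2).aemeasurable
      _ ≤ _ := lintegral_mul_le_mixedNorm hp₂ hq₂ hm1 hm2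
      _ = _ := by rw [mixedNorm_neg _ _ fun x η => ‖𝓕 (windowed φ g x) η‖ₑ]
  have h3 := hC ⟨(f : 𝓢'(Rn n, ℂ)), hf⟩
  rw [modulationNorm_eq φ (by linarith), modulationNorm_eq φ (by linarith), ← ha, ← hb] at h3
  simp only [stft_schwartz] at h3
  have h4 : ((a⁻¹ : ℝ≥0) : ℝ≥0∞) * a = 1 := by
    rw [← ENNReal.coe_mul, inv_mul_cancel₀ ha0, ENNReal.coe_one]
  generalize mixedNorm p₁ q₁ (fun x η => ‖𝓕 (windowed (conjSchwartz φ) f x) η‖ₑ) = X at h3 ⊢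
  generalize mixedNorm p₂.conjExponent q₂.conjExponent (fun x η => ‖𝓕 (windowed φ g x) η‖ₑ) = Y
    at h2 ⊢
  have h5 : mixedNorm p₂ q₂ (fun x η => ‖stft φ F x ((2 * Real.pi) • η)‖ₑ)
      ≤ (a⁻¹ : ℝ≥0) * (C * (b * X)) := by
    calc _ = ((a⁻¹ : ℝ≥0) : ℝ≥0∞) * (a * mixedNorm p₂ q₂
          (fun x η => ‖stft φ F x ((2 * Real.pi) • η)‖ₑ)) := by rw [← mul_assoc, h4, one_mul]
      _ ≤ _ := mul_le_mul_right h3 _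
  calc ‖∫ x, g x * fractionalIntegral α f x‖ₑ
      = ‖(windowEnergy φ)⁻¹‖ₑ * ‖windowEnergy φ * ∫ x, g x * fractionalIntegral α f x‖ₑ := by
        rw [← enorm_mul, inv_mul_cancel_left₀ hW]
    _ ≤ ‖(windowEnergy φ)⁻¹‖ₑ * ((a⁻¹ : ℝ≥0) * (C * (b * X)) * Y) :=
        mul_le_mul_right (h2.trans (mul_le_mul_left h5 _)) _
    _ = _ := by rw [enorm_eq_nnnorm]; push_cast; ring

/-- The dilation `t ↦ f(c t)`. -/
noncomputable def dilate {c : ℝ} (hc : c ≠ 0) (f : 𝓢(Rn n, ℂ)) : 𝓢(Rn n, ℂ) :=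
  compCLMOfContinuousLinearEquiv ℂ (ContinuousLinearEquiv.smulLeft (Units.mk0 c hc)) f

theorem dilate_apply {c : ℝ} (hc : c ≠ 0) (f : 𝓢(Rn n, ℂ)) (t : Rn n) :
    dilate hc f t = f (c • t) := rfl

theorem derivBound_dilate {c : ℝ} (hc : 0 < c) (hc1 : c ≤ 1) (m L : ℕ) (f : 𝓢(Rn n, ℂ)) :
    DerivBound m (dilate hc.ne' f)
      (fun w => 2 ^ L * schwartzNorm L m f * (1 + ‖c • w‖) ^ (-(L : ℝ))) := by
  have h := derivBound_schwartz m L f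
  refine ⟨(dilate hc.ne' f).smooth _, fun j hj w => ?_⟩
  have h1 : (dilate hc.ne' f : Rn n → ℂ) = fun t => f (c • t) := rfl
  rw [h1, iteratedFDeriv_comp_const_smul c (f.smooth j), norm_smul, norm_pow,
    Real.norm_of_nonneg hc.le]
  exact (mul_le_of_le_one_left (norm_nonneg _) (pow_le_one₀ hc.le hc1)).trans (h.2 j hj _)

theorem norm_fourier_translate (S S' : 𝓢(Rn n, ℂ)) (x : Rn n) (h : ∀ t, S t = S' (t - x))
    (η : Rn n) : ‖𝓕 S η‖ = ‖𝓕 S' η‖ := by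
  have h1 : S = tfShift S' x 0 := by
    ext t; rw [h, tfShift_apply, inner_zero_left, phase_zero, one_mul]
  rw [h1, fourier_tfShift, sub_zero, norm_mul, norm_phase, one_mul]

theorem one_add_norm_smul_rpow_le {c : ℝ} (hc : 0 < c) (hc1 : c ≤ 1) (L : ℕ) (w X : Rn n) :
    (1 + ‖c • (w + X)‖) ^ (-(L : ℝ)) ≤ (1 + ‖c • X‖) ^ (-(L : ℝ)) * (1 + ‖w‖) ^ L := by
  have h := one_add_norm_rpow_le (Nat.cast_nonneg L) (le_refl (L : ℝ)) (c • w) (c • X)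
  rw [← smul_add] at h
  refine h.trans ?_
  gcongr
  rw [norm_smul, Real.norm_of_nonneg hc.le]
  exact mul_le_of_le_one_left (norm_nonneg _) hc1

theorem exists_enorm_fourier_windowed_dilate_le (ψ f : 𝓢(Rn n, ℂ)) (L : ℕ) :
    ∃ C : ℝ≥0, ∀ (c : ℝ) (hc : 0 < c), c ≤ 1 → ∀ x η,
      ‖𝓕 (windowed ψ (dilate hc.ne' f) x) η‖ₑ ≤ C * (polyWeight L (c • x) * polyWeight L η) := by
  obtain ⟨k, m, C, hC, h⟩ := exists_norm_fourier_translate_mul_le (n := n) L L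
  have h0 : 0 ≤ schwartzNorm k m ψ := apply_nonneg _ _
  have h0' : 0 ≤ schwartzNorm L m f := apply_nonneg _ _
  refine ⟨(C * (2 ^ L * schwartzNorm L m f) * schwartzNorm k m ψ).toNNReal,
    fun c hc hc1 x η => ?_⟩
  set S : 𝓢(Rn n, ℂ) := windowed ψ (dilate hc.ne' f) x with hS
  set S' : 𝓢(Rn n, ℂ) := tfShift S (-x) 0 with hS'
  have hS'a : ∀ t, S' t = dilate hc.ne' f (t + x) * ψ t := fun t => by
    rw [hS', tfShift_apply, inner_zero_left, phase_zero, one_mul, hS, windowed_apply,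
      sub_neg_eq_add, add_sub_cancel_right]
  have h1 := h (dilate hc.ne' f) _ x (2 ^ L * schwartzNorm L m f * (1 + ‖c • x‖) ^ (-(L : ℝ))) ψ S'
    (derivBound_dilate hc hc1 m L f) (fun w => by
      have := one_add_norm_smul_rpow_le hc hc1 L w x
      calc _ ≤ 2 ^ L * schwartzNorm L m f
            * ((1 + ‖c • x‖) ^ (-(L : ℝ)) * (1 + ‖w‖) ^ L) := by gcongr
        _ = _ := by ring) hS'a η
  rw [← norm_fourier_translate S S' x (fun t => by
    rw [hS', tfShift_apply, inner_zero_left, phase_zero, one_mul, sub_neg_eq_add,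
      sub_add_cancel])] at h1
  rw [← ofReal_norm]
  refine (ENNReal.ofReal_le_ofReal h1).trans_eq ?_
  rw [polyWeight, polyWeight, ← ENNReal.ofReal_mul (by positivity), ← ENNReal.ofReal.eq_1,
    ← ENNReal.ofReal_mul (by positivity)]
  congr 1; ring

theorem exists_mixedNorm_fourier_windowed_dilate_le (ψ f : 𝓢(Rn n, ℂ)) {p q : ℝ} (hp : 1 < p)
    (hq : 1 < q) :
    ∃ C : ℝ≥0, ∀ (c : ℝ) (hc : 0 < c), c ≤ 1 →
      mixedNorm p q (fun x η => ‖𝓕 (windowed ψ (dilate hc.ne' f) x) η‖ₑ)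
        ≤ C * ENNReal.ofReal (c ^ (-(n / p))) := by
  have hp0 : 0 < p := by linarith
  have hq0 : 0 < q := by linarith
  obtain ⟨C, h⟩ := exists_enorm_fourier_windowed_dilate_le ψ f (n + 1)
  have hfin : ∀ r : ℝ, 1 < r → (∫⁻ x : Rn n, polyWeight ((n + 1 : ℕ) : ℝ) x ^ r) ^ (1 / r) ≠ ∞ :=
    fun r hr => lintegral_polyWeight_rpow_ne_top (by
      have : (0 : ℝ) ≤ n := Nat.cast_nonneg n
      push_cast; nlinarith) (by linarith)
  obtain ⟨a, ha⟩ := exists_coe_eq (hfin p hp)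
  obtain ⟨b, hb⟩ := exists_coe_eq (hfin q hq)
  refine ⟨C * (a * b), fun c hc hc1 => ?_⟩
  refine (mixedNorm_mono hp0.le hq0.le (h c hc hc1)).trans_eq ?_
  have hmc : Measurable fun x : Rn n => polyWeight ((n + 1 : ℕ) : ℝ) (c • x) :=
    (measurable_polyWeight _).comp (measurable_const_smul c)
  rw [mixedNorm_const_mul hp0 hq0, mixedNorm_mul hp0 hq0 hmc (measurable_polyWeight _), ← hb,
    lintegral_comp_smul hc (fun x : Rn n => polyWeight ((n + 1 : ℕ) : ℝ) x ^ p),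
    ENNReal.mul_rpow_of_nonneg _ _ (by positivity), ← ha,
    ENNReal.ofReal_rpow_of_pos (by positivity)]
  have h1 : ((c ^ n)⁻¹) ^ (1 / p) = c ^ (-(n / p)) := by
    rw [← Real.rpow_natCast, ← Real.rpow_neg hc.le, ← Real.rpow_mul hc.le]
    congr 1; ring
  rw [h1]; push_cast; ring

theorem fractionalIntegral_comp_smul {α c : ℝ} (hc : 0 < c) (f : Rn n → ℂ) (x : Rn n) :
    fractionalIntegral α (fun t => f (c • t)) x
      = ((c ^ (-α) : ℝ) : ℂ) * fractionalIntegral α f (c • x) := by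
  unfold fractionalIntegral
  have h1 : ∀ y : Rn n, f (c • y) / ((‖x - y‖ ^ (n - α) : ℝ) : ℂ)
      = ((c ^ (n - α) : ℝ) : ℂ) * (f (c • y) / ((‖c • x - c • y‖ ^ (n - α) : ℝ) : ℂ)) := by
    intro y
    rw [← smul_sub, norm_smul, Real.norm_of_nonneg hc.le,
      Real.mul_rpow hc.le (norm_nonneg _), Complex.ofReal_mul]
    have : ((c ^ (n - α) : ℝ) : ℂ) ≠ 0 := by
      exact_mod_cast (Real.rpow_pos_of_pos hc _).ne'
    rw [mul_div_assoc', mul_div_mul_left _ _ this]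
  simp only [h1]
  rw [integral_const_mul, Measure.integral_comp_smul volume
    (fun y => f y / ((‖c • x - y‖ ^ (n - α) : ℝ) : ℂ)), finrank_euclideanSpace_fin,
    abs_of_pos (by positivity), Complex.real_smul]
  have h2 : ((c ^ (n - α) : ℝ) : ℂ) * (((c ^ n)⁻¹ : ℝ) : ℂ) = ((c ^ (-α) : ℝ) : ℂ) := by
    rw [← Complex.ofReal_mul, ← Real.rpow_natCast, ← Real.rpow_neg hc.le, ← Real.rpow_add hc]
    congr 2; ring
  rw [← h2]; ring

theorem integral_dilate_mul_fractionalIntegral {α c : ℝ} (hc : 0 < c) (f g : 𝓢(Rn n, ℂ)) :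
    ∫ x, dilate hc.ne' g x * fractionalIntegral α (dilate hc.ne' f) x
      = ((c ^ (-(n + α)) : ℝ) : ℂ) * ∫ x, g x * fractionalIntegral α f x := by
  have h1 : (dilate hc.ne' f : Rn n → ℂ) = fun t => f (c • t) := rfl
  have h2 : ∀ x, dilate hc.ne' g x * fractionalIntegral α (dilate hc.ne' f) x
      = ((c ^ (-α) : ℝ) : ℂ) * (g (c • x) * fractionalIntegral α f (c • x)) := fun x => by
    rw [h1, fractionalIntegral_comp_smul hc, dilate_apply]; ring
  simp only [h2]
  rw [integral_const_mul, Measure.integral_comp_smul volume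
    (fun y => g y * fractionalIntegral α f y), finrank_euclideanSpace_fin,
    abs_of_pos (by positivity), Complex.real_smul, ← mul_assoc, ← Complex.ofReal_mul,
    ← Real.rpow_natCast, ← Real.rpow_neg hc.le, ← Real.rpow_add hc]
  congr 4; ring

/-- The scaling condition on the space exponents. -/
theorem FractionalIntegralBounded.space_exponents {α : ℝ} (hα : 0 < α) (hαn : α < n)
    {φ : 𝓢(Rn n, ℂ)} (hφ : φ ≠ 0) {p₁ p₂ q₁ q₂ : ℝ} (hp₁ : 1 < p₁) (hp₂ : 1 < p₂) (hq₁ : 1 < q₁)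
    (hq₂ : 1 < q₂) (hb : FractionalIntegralBounded φ α p₁ q₁ p₂ q₂ hp₁.le hq₁.le hp₂.le hq₂.le)
    {f g : 𝓢(Rn n, ℂ)} (hfg : ∫ x, g x * fractionalIntegral α f x ≠ 0) :
    1 / p₂ ≤ 1 / p₁ - α / n := by
  have hn : (0 : ℝ) < n := hα.trans hαn
  have hp' := Real.HolderConjugate.conjExponent hp₂
  have hq' := Real.HolderConjugate.conjExponent hq₂
  obtain ⟨C, hC⟩ := hb.exists_enorm_integral_le hα hαn hφ hp₁ hp₂ hq₁ hq₂
  obtain ⟨C₁, h₁⟩ := exists_mixedNorm_fourier_windowed_dilate_le (conjSchwartz φ) f hp₁ hq₁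
  obtain ⟨C₂, h₂⟩ := exists_mixedNorm_fourier_windowed_dilate_le φ g hp'.symm.lt hq'.symm.lt
  set B : ℝ := ‖∫ x, g x * fractionalIntegral α f x‖ with hB
  have hB0 : 0 < B := norm_pos_iff.2 hfg
  have key : ∀ c : ℝ, 0 < c → c ≤ 1 →
      c ^ (-(n + α)) * B ≤ C * (C₁ * c ^ (-(n / p₁))) * (C₂ * c ^ (-(n / p₂.conjExponent))) := by
    intro c hc hc1
    have h3 := hC (dilate hc.ne' f) (dilate hc.ne' g) (ne_top_of_le_ne_top
      (ENNReal.mul_ne_top ENNReal.coe_ne_top ENNReal.ofReal_ne_top) (h₁ c hc hc1))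
    rw [integral_dilate_mul_fractionalIntegral hc, ← ofReal_norm, norm_mul, Complex.norm_real,
      Real.norm_of_nonneg (by positivity), ← hB] at h3
    have h4 := h3.trans (mul_le_mul' (mul_le_mul_right (h₁ c hc hc1) _) (h₂ c hc hc1))
    rw [← ENNReal.ofReal_coe_nnreal, ← ENNReal.ofReal_coe_nnreal, ← ENNReal.ofReal_coe_nnreal,
      ← ENNReal.ofReal_mul (by positivity), ← ENNReal.ofReal_mul (by positivity),
      ← ENNReal.ofReal_mul (by positivity), ← ENNReal.ofReal_mul (by positivity)] at h4
    exact (ENNReal.ofReal_le_ofReal_iff (by positivity)).1 h4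
  by_contra hcon
  push Not at hcon
  have hinv : 1 / p₂.conjExponent = 1 - 1 / p₂ := by
    have := hp'.inv_add_inv_eq_one; simp only [one_div]; linarith
  set δ : ℝ := n + α - n / p₁ - n / p₂.conjExponent with hδ
  have hδ0 : 0 < δ := by
    have h1 : δ = n * (α / n - 1 / p₁ + 1 / p₂) := by
      have h2 : (n : ℝ) / p₂.conjExponent = n * (1 - 1 / p₂) := by rw [← hinv]; ring
      rw [hδ, h2]; field_simp; ring
    rw [h1]; exact mul_pos hn (by linarith)
  have key2 : ∀ c : ℝ, 0 < c → c ≤ 1 → B ≤ C * C₁ * C₂ * c ^ δ := by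
    intro c hc hc1
    have h1 := mul_le_mul_of_nonneg_left (key c hc hc1) (Real.rpow_nonneg hc.le (n + α))
    have h2 : c ^ (n + α) * (c ^ (-(n + α)) * B) = B := by
      rw [← mul_assoc, ← Real.rpow_add hc, add_neg_cancel, Real.rpow_zero, one_mul]
    have h3 : c ^ δ = c ^ (n + α) * c ^ (-(n / p₁)) * c ^ (-(n / p₂.conjExponent)) := by
      rw [← Real.rpow_add hc, ← Real.rpow_add hc]
      congr 1
    rw [h2] at h1
    rw [h3]; linarith
  have hlim : Tendsto (fun c : ℝ => C * C₁ * C₂ * c ^ δ) (𝓝[>] 0) (𝓝 0) := by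
    have h1 : Tendsto (fun c : ℝ => c ^ δ) (𝓝[>] 0) (𝓝 0) := by
      have := (Real.continuousAt_rpow_const 0 δ (Or.inr hδ0.le)).tendsto
      rw [Real.zero_rpow hδ0.ne'] at this
      exact this.mono_left nhdsWithin_le_nhds
    simpa using h1.const_mul (C * C₁ * C₂ : ℝ)
  have hle : B ≤ 0 := by
    refine ge_of_tendsto hlim ?_
    filter_upwards [Ioc_mem_nhdsGT (zero_lt_one' ℝ)] with c hc
    exact key2 c hc.1 hc.2
  linarith

/-- The standard bump function as a complex valued Schwartz function. -/
noncomputable def bumpSchwartz (n : ℕ) : 𝓢(Rn n, ℂ) :=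
  (HasCompactSupport.comp_left (g := Complex.ofReal)
    (unitBump n).hasCompactSupport Complex.ofReal_zero).toSchwartzMap
    (Complex.ofRealCLM.contDiff.comp (unitBump n).contDiff)

theorem bumpSchwartz_apply (ζ : Rn n) : bumpSchwartz n ζ = (unitBump n ζ : ℝ) := rfl

/-- The truncated power `|ζ|^{-s}`, restricted smoothly to `1 ≲ |ζ| ≲ 1 / c`. -/
noncomputable def truncatedPower (s : ℝ) {c : ℝ} (hc : c ≠ 0) : 𝓢(Rn n, ℂ) :=
  smulLeftCLM ℂ (highPass s) (dilate hc (bumpSchwartz n))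

theorem truncatedPower_apply {s : ℝ} (hs : 0 ≤ s) {c : ℝ} (hc : c ≠ 0) (ζ : Rn n) :
    truncatedPower s hc ζ = highPass s ζ * dilate hc (bumpSchwartz n) ζ := by
  rw [truncatedPower, smulLeftCLM_apply_apply (hasTemperateGrowth_highPass hs), smul_eq_mul]

theorem truncatedPower_eq_ofReal {s : ℝ} (hs : 0 ≤ s) {c : ℝ} (hc : c ≠ 0) (ζ : Rn n) :
    truncatedPower s hc ζ
      = (((1 - unitBump n ζ) * ‖ζ‖ ^ (-s) * unitBump n (c • ζ) : ℝ) : ℂ) := by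
  rw [truncatedPower_apply hs, dilate_apply, bumpSchwartz_apply, highPass, ← Complex.ofReal_mul]

theorem truncatedPower_neg {s : ℝ} (hs : 0 ≤ s) {c : ℝ} (hc : c ≠ 0) (ζ : Rn n) :
    truncatedPower s hc (-ζ) = truncatedPower s hc ζ := by
  rw [truncatedPower_eq_ofReal hs, truncatedPower_eq_ofReal hs, smul_neg, ContDiffBump.neg,
    ContDiffBump.neg, norm_neg]

theorem fourier_truncatedPower {s : ℝ} (hs : 0 ≤ s) {c : ℝ} (hc : c ≠ 0) :
    𝓕 (truncatedPower (n := n) s hc) = 𝓕⁻ (truncatedPower (n := n) s hc) := by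
  ext ζ
  rw [fourier_coe, fourierInv_coe, fourier_eq_phase, fourierInv_eq_phase, ← integral_neg_eq_self]
  congr 1; funext t
  rw [truncatedPower_neg hs, inner_neg_left, neg_neg]

/-- The Schwartz function whose Fourier transform is a truncated power. -/
noncomputable abbrev truncatedRiesz (s : ℝ) {c : ℝ} (hc : c ≠ 0) : 𝓢(Rn n, ℂ) :=
  𝓕⁻ (truncatedPower s hc)

theorem exists_enorm_fourier_windowed_truncatedPower_le (ψ : 𝓢(Rn n, ℂ)) {s : ℝ} (hs : 0 ≤ s)
    (M : ℕ) :
    ∃ C : ℝ≥0, ∀ (c : ℝ) (hc : 0 < c), c ≤ 1 → ∀ x η,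
      ‖𝓕 (windowed ψ (truncatedRiesz s hc.ne') x) η‖ₑ
        ≤ C * (polyWeight M x * (polyWeight s η * polyWeight M (c • η))) := by
  obtain ⟨L, hL⟩ := exists_nat_ge s
  obtain ⟨k, m, C, hC, h⟩ := exists_norm_fourier_translate_mul_le (n := n) M (L + M)
  obtain ⟨D, hD, hDb⟩ := exists_derivBound_highPass (n := n) hs m
  set E : ℝ := 2 ^ M * schwartzNorm M m (bumpSchwartz n) with hE
  have hE0 : 0 ≤ E := by
    have : 0 ≤ schwartzNorm M m (bumpSchwartz n) := apply_nonneg _ _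
    positivity
  have h0 : 0 ≤ schwartzNorm k m (𝓕⁻ ψ) := apply_nonneg _ _
  refine ⟨(C * (2 ^ m * D * E) * schwartzNorm k m (𝓕⁻ ψ)).toNNReal, fun c hc hc1 x η => ?_⟩
  set u : 𝓢(Rn n, ℂ) := truncatedPower s hc.ne' with hu
  set S : 𝓢(Rn n, ℂ) := tfShift (windowed (𝓕⁻ ψ) u η) (-η) 0 with hS
  have hSa : ∀ w, S w = u (w + η) * (𝓕⁻ ψ) w := fun w => by
    rw [hS, tfShift_apply, inner_zero_left, phase_zero, one_mul, windowed_apply, sub_neg_eq_add,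
      add_sub_cancel_right]
  have hub : DerivBound m u (fun w => 2 ^ m * (D * (1 + ‖w‖) ^ (-s)
      * (E * (1 + ‖c • w‖) ^ (-(M : ℝ))))) := by
    have h1 := hDb.mul (derivBound_dilate hc hc1 m M (bumpSchwartz n))
    have h2 : (u : Rn n → ℂ) = fun w => highPass s w * dilate hc.ne' (bumpSchwartz n) w :=
      funext fun w => truncatedPower_apply hs hc.ne' w
    rw [h2]
    exact h1
  have h1 := h u _ η (2 ^ m * (D * (1 + ‖η‖) ^ (-s) * (E * (1 + ‖c • η‖) ^ (-(M : ℝ))))) (𝓕⁻ ψ) S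
    hub (fun w => by
      have e1 := one_add_norm_rpow_le hs hL w η
      have e2 := one_add_norm_smul_rpow_le hc hc1 M w η
      calc _ ≤ 2 ^ m * (D * ((1 + ‖η‖) ^ (-s) * (1 + ‖w‖) ^ L)
              * (E * ((1 + ‖c • η‖) ^ (-(M : ℝ)) * (1 + ‖w‖) ^ M))) := by
            gcongr
        _ = _ := by rw [pow_add]; ring) hSa (-x)
  have h2 : 𝓕 (windowed ψ (𝓕⁻ u) x) η = 𝓕⁻ S x := by
    have e1 : 𝓕 (windowed ψ (𝓕⁻ u) x) η = ∫ t, (𝓕⁻ u) t * tfShift ψ x (-η) t := by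
      rw [fourier_coe, fourier_eq_phase]
      congr 1; funext t
      rw [windowed_apply, tfShift_apply, inner_neg_left, real_inner_comm]; ring
    have e2 := integral_fourierInv_mul_eq_flip u.integrable (tfShift ψ x (-η)).integrable
    rw [← fourierInv_coe, ← fourierInv_coe] at e2
    rw [e1, e2, fourierInv_coe S, fourierInv_eq_phase, ← integral_add_right_eq_self _ η]
    congr 1; funext w
    rw [fourierInv_tfShift, hSa, add_neg_cancel_right, real_inner_comm]; ring
  rw [h2, ← ofReal_norm, norm_fourierInv_schwartz]
  refine (ENNReal.ofReal_le_ofReal h1).trans_eq ?_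
  rw [polyWeight, polyWeight, polyWeight, ← ENNReal.ofReal_mul (by positivity),
    ← ENNReal.ofReal_mul (by positivity), ← ENNReal.ofReal.eq_1,
    ← ENNReal.ofReal_mul (by positivity), norm_neg]
  congr 1; ring

/-- The integral of `|ζ|^{-σ}`, cut off smoothly at `|ζ| ∼ 1 / c`. -/
noncomputable def cutoffMass (n : ℕ) (σ c : ℝ) : ℝ≥0∞ :=
  ∫⁻ η : Rn n, polyWeight σ η * polyWeight ((n + 1 : ℕ) : ℝ) (c • η)

theorem exists_mixedNorm_fourier_windowed_truncatedPower_le (ψ : 𝓢(Rn n, ℂ)) {s : ℝ} (hs : 0 ≤ s)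
    {p q : ℝ} (hp : 1 < p) (hq : 1 < q) :
    ∃ C : ℝ≥0, ∀ (c : ℝ) (hc : 0 < c), c ≤ 1 →
      mixedNorm p q (fun x η => ‖𝓕 (windowed ψ (truncatedRiesz s hc.ne') x) η‖ₑ)
        ≤ C * cutoffMass n (s * q) c ^ (1 / q) := by
  have hp0 : 0 < p := by linarith
  have hq0 : 0 < q := by linarith
  have hn0 : (0 : ℝ) ≤ n := Nat.cast_nonneg n
  obtain ⟨C, h⟩ := exists_enorm_fourier_windowed_truncatedPower_le ψ hs (n + 1)
  have hfin : (∫⁻ x : Rn n, polyWeight ((n + 1 : ℕ) : ℝ) x ^ p) ^ (1 / p) ≠ ∞ :=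
    lintegral_polyWeight_rpow_ne_top (by push_cast; nlinarith) hp0
  obtain ⟨a, ha⟩ := exists_coe_eq hfin
  refine ⟨C * a, fun c hc hc1 => ?_⟩
  refine (mixedNorm_mono hp0.le hq0.le (h c hc hc1)).trans ?_
  have hmc : Measurable fun x : Rn n => polyWeight s x * polyWeight ((n + 1 : ℕ) : ℝ) (c • x) :=
    (measurable_polyWeight _).mul ((measurable_polyWeight _).comp (measurable_const_smul c))
  rw [mixedNorm_const_mul hp0 hq0, mixedNorm_mul hp0 hq0 (measurable_polyWeight _) hmc, ← ha,
    ENNReal.coe_mul, mul_assoc]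
  gcongr
  unfold cutoffMass
  gcongr with η
  rw [ENNReal.mul_rpow_of_nonneg _ _ hq0.le, polyWeight_rpow, polyWeight_rpow]
  gcongr
  refine ENNReal.ofReal_le_ofReal (Real.rpow_le_rpow_of_exponent_le (by simp) ?_)
  push_cast; nlinarith

/-- The integral of `|ζ|^{-σ}` over the shell `a < |ζ| ≤ b`. -/
noncomputable def shellMass (n : ℕ) (σ a b : ℝ) : ℝ≥0∞ :=
  ∫⁻ ζ : Rn n in {ζ | a < ‖ζ‖ ∧ ‖ζ‖ ≤ b}, powerKernel σ ζ

theorem measurableSet_shell (a b : ℝ) : MeasurableSet {ζ : Rn n | a < ‖ζ‖ ∧ ‖ζ‖ ≤ b} :=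
  (measurableSet_lt measurable_const measurable_norm).inter
    (measurableSet_le measurable_norm measurable_const)

theorem shellMass_add (σ : ℝ) {a b d : ℝ} (hab : a ≤ b) (hbd : b ≤ d) :
    shellMass n σ a b + shellMass n σ b d = shellMass n σ a d := by
  unfold shellMass
  rw [← lintegral_union (measurableSet_shell b d)]
  · congr 2
    ext ζ
    simp only [Set.mem_union, Set.mem_ofPred_eq]
    constructor
    · rintro (⟨h1, h2⟩ | ⟨h1, h2⟩)
      · exact ⟨h1, h2.trans hbd⟩
      · exact ⟨hab.trans_lt h1, h2⟩
    · rintro ⟨h1, h2⟩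
      rcases le_or_gt ‖ζ‖ b with h | h
      · exact Or.inl ⟨h1, h⟩
      · exact Or.inr ⟨h, h2⟩
  · refine Set.disjoint_left.2 ?_
    rintro ζ ⟨-, h⟩ ⟨h', -⟩
    exact absurd h' (not_lt.2 h)

theorem shellMass_ne_top {σ : ℝ} (hσ : 0 ≤ σ) (R : ℝ) : shellMass n σ 2 R ≠ ∞ := by
  unfold shellMass
  refine ne_top_of_le_ne_top (b := volume (Metric.closedBall (0 : Rn n) R))
    (measure_closedBall_lt_top).ne ?_
  calc _ ≤ ∫⁻ ζ : Rn n in {ζ | 2 < ‖ζ‖ ∧ ‖ζ‖ ≤ R}, 1 := by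
        refine setLIntegral_mono measurable_const fun ζ hζ => ?_
        rw [powerKernel, ENNReal.ofReal_le_one]
        exact Real.rpow_le_one_of_one_le_of_nonpos (by linarith [hζ.1]) (by linarith)
    _ = volume {ζ : Rn n | 2 < ‖ζ‖ ∧ ‖ζ‖ ≤ R} := by rw [setLIntegral_one]
    _ ≤ _ := measure_mono fun ζ hζ => by simpa using hζ.2

/-- The volume of the shell `1/2 < |ζ| ≤ 1`. -/
noncomputable def unitShellVolume (n : ℕ) : ℝ≥0∞ := volume {ζ : Rn n | 1 / 2 < ‖ζ‖ ∧ ‖ζ‖ ≤ 1}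

theorem unitShellVolume_ne_top (n : ℕ) : unitShellVolume n ≠ ∞ :=
  ne_top_of_le_ne_top (b := volume (Metric.closedBall (0 : Rn n) 1)) (measure_closedBall_lt_top).ne
    (measure_mono fun ζ hζ => by simpa using hζ.2)

theorem unitShellVolume_ne_zero (hn : 0 < n) : unitShellVolume n ≠ 0 := by
  have := nontrivial_Rn hn
  have ho : IsOpen {ζ : Rn n | 1 / 2 < ‖ζ‖ ∧ ‖ζ‖ < 1} :=
    (isOpen_lt continuous_const continuous_norm).inter (isOpen_lt continuous_norm continuous_const)
  obtain ⟨v, hv⟩ := exists_norm_eq (Rn n) (show (0 : ℝ) ≤ 3 / 4 by norm_num)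
  have hpos := ho.measure_pos volume ⟨v, by rw [Set.mem_ofPred_eq, hv]; norm_num⟩
  have hle : volume {ζ : Rn n | 1 / 2 < ‖ζ‖ ∧ ‖ζ‖ < 1} ≤ unitShellVolume n :=
    measure_mono fun ζ hζ => ⟨hζ.1, hζ.2.le⟩
  exact (hpos.trans_le hle).ne'

theorem ofReal_mul_unitShellVolume_le {σ : ℝ} (hσ : 0 ≤ σ) {R : ℝ} (hR : 0 < R) :
    ENNReal.ofReal (R ^ (n - σ)) * unitShellVolume n ≤ shellMass n σ (R / 2) R := by
  have h1 : ENNReal.ofReal (R ^ n) * unitShellVolume n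
      = volume {ζ : Rn n | R / 2 < ‖ζ‖ ∧ ‖ζ‖ ≤ R} := by
    have hRi : 0 < R⁻¹ := by positivity
    have h2 := lintegral_comp_smul hRi
      (({ζ : Rn n | 1 / 2 < ‖ζ‖ ∧ ‖ζ‖ ≤ 1}).indicator (1 : Rn n → ℝ≥0∞))
    rw [lintegral_indicator_one (measurableSet_shell _ _), inv_pow, inv_inv] at h2
    rw [unitShellVolume, ← h2, ← lintegral_indicator_one (measurableSet_shell _ _)]
    congr 1; funext ζ
    simp only [Set.indicator, Set.mem_ofPred_eq, norm_smul, Real.norm_of_nonneg hRi.le]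
    have e1 : 1 / 2 < R⁻¹ * ‖ζ‖ ↔ R / 2 < ‖ζ‖ := by
      rw [inv_mul_eq_div, lt_div_iff₀ hR]; constructor <;> intro h <;> linarith
    have e2 : R⁻¹ * ‖ζ‖ ≤ 1 ↔ ‖ζ‖ ≤ R := by rw [inv_mul_eq_div, div_le_one hR]
    simp only [e1, e2, Pi.one_apply]
  have h3 : ENNReal.ofReal (R ^ (n - σ)) * unitShellVolume n
      = ENNReal.ofReal (R ^ (-σ)) * volume {ζ : Rn n | R / 2 < ‖ζ‖ ∧ ‖ζ‖ ≤ R} := by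
    rw [← h1, ← mul_assoc, ← ENNReal.ofReal_mul (by positivity), ← Real.rpow_natCast,
      ← Real.rpow_add hR]
    congr 3; ring
  rw [h3, shellMass, ← setLIntegral_const]
  refine setLIntegral_mono (measurable_powerKernel σ) fun ζ hζ => ?_
  refine ENNReal.ofReal_le_ofReal ?_
  have : 0 < ‖ζ‖ := by linarith [hζ.1]
  exact Real.rpow_le_rpow_of_nonpos this hζ.2 (by linarith)

theorem natCast_mul_unitShellVolume_le {σ : ℝ} (hσ : 0 ≤ σ) (hσn : σ ≤ n) (j : ℕ) :
    (j : ℝ≥0∞) * unitShellVolume n ≤ shellMass n σ 2 (2 ^ (j + 1)) := by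
  induction j with
  | zero => simp
  | succ j ih =>
    have h2 : (2 : ℝ) ≤ 2 ^ (j + 1) := by
      simpa using pow_le_pow_right₀ (one_le_two (α := ℝ)) (Nat.succ_le_succ (Nat.zero_le j))
    have h3 : (2 : ℝ) ^ (j + 1) ≤ 2 ^ (j + 1 + 1) := pow_le_pow_right₀ one_le_two (Nat.le_succ _)
    rw [← shellMass_add σ h2 h3, Nat.cast_succ, add_mul, one_mul]
    refine add_le_add ih ?_
    have h4 := ofReal_mul_unitShellVolume_le (n := n) hσ (R := 2 ^ (j + 1 + 1)) (by positivity)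
    have h5 : (2 : ℝ) ^ (j + 1 + 1) / 2 = 2 ^ (j + 1) := by rw [pow_succ]; ring
    rw [h5] at h4
    refine le_trans ?_ h4
    refine le_mul_of_one_le_left' ?_
    rw [ENNReal.one_le_ofReal]
    exact Real.one_le_rpow (h2.trans h3 |>.trans' one_le_two) (by linarith)

theorem exists_cutoffMass_le (hn : 0 < n) {σ : ℝ} (hσ : 0 ≤ σ) :
    ∃ V K : ℝ≥0, ∀ R : ℝ, 4 ≤ R → cutoffMass n σ R⁻¹ ≤ V + K * shellMass n σ 2 R := by
  set c₁ : ℝ≥0∞ := ∫⁻ x : Rn n, polyWeight ((n + 1 : ℕ) : ℝ) x with hc₁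
  have hc₁f : c₁ ≠ ∞ := (lintegral_polyWeight_lt_top (by push_cast; linarith)).ne
  obtain ⟨V, hV⟩ := exists_coe_eq
    (measure_closedBall_lt_top (μ := volume) (x := (0 : Rn n)) (r := 2)).ne
  have hu0 := unitShellVolume_ne_zero hn
  have huf := unitShellVolume_ne_top n
  obtain ⟨K, hK⟩ := exists_coe_eq (ENNReal.div_ne_top hc₁f hu0)
  refine ⟨V, 1 + K, fun R hR => ?_⟩
  have hR0 : 0 < R := by linarith
  have hRi : 0 < R⁻¹ := by positivity
  set F : Rn n → ℝ≥0∞ := fun η => polyWeight σ η * polyWeight ((n + 1 : ℕ) : ℝ) (R⁻¹ • η) with hF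
  have hpt : ∀ η, F η ≤ (Metric.closedBall (0 : Rn n) 2).indicator 1 η
      + ({ζ : Rn n | 2 < ‖ζ‖ ∧ ‖ζ‖ ≤ R}.indicator (powerKernel σ) η
        + ENNReal.ofReal (R ^ (-σ)) * polyWeight ((n + 1 : ℕ) : ℝ) (R⁻¹ • η)) := by
    intro η
    have hn1 : (0 : ℝ) ≤ ((n + 1 : ℕ) : ℝ) := Nat.cast_nonneg _
    rcases le_or_gt ‖η‖ 2 with h | h
    · refine le_add_right ?_
      rw [Set.indicator_of_mem (by simpa using h)]
      exact mul_le_one' (polyWeight_le_one hσ _) (polyWeight_le_one hn1 _)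
    · have hη : 0 < ‖η‖ := by linarith
      have hle : polyWeight σ η ≤ powerKernel σ η :=
        ENNReal.ofReal_le_ofReal (Real.rpow_le_rpow_of_nonpos hη (by linarith) (by linarith))
      refine le_add_left ?_
      rcases le_or_gt ‖η‖ R with h' | h'
      · refine le_add_right ?_
        rw [Set.indicator_of_mem (show η ∈ {ζ : Rn n | 2 < ‖ζ‖ ∧ ‖ζ‖ ≤ R} from ⟨h, h'⟩)]
        exact (mul_le_mul' hle (polyWeight_le_one hn1 _)).trans_eq (mul_one _)
      · refine le_add_left (mul_le_mul' (hle.trans ?_) le_rfl)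
        exact ENNReal.ofReal_le_ofReal
          (Real.rpow_le_rpow_of_nonpos hR0 h'.le (by linarith))
  have hm1 : Measurable ((Metric.closedBall (0 : Rn n) 2).indicator (1 : Rn n → ℝ≥0∞)) :=
    measurable_one.indicator measurableSet_closedBall
  have hm2 : Measurable ({ζ : Rn n | 2 < ‖ζ‖ ∧ ‖ζ‖ ≤ R}.indicator (powerKernel σ)) :=
    (measurable_powerKernel σ).indicator (measurableSet_shell _ _)
  have htail : ENNReal.ofReal (R ^ (-σ)) * (ENNReal.ofReal ((R⁻¹ ^ n)⁻¹) * c₁)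
      ≤ K * shellMass n σ 2 R := by
    have h1 := ofReal_mul_unitShellVolume_le (n := n) hσ hR0
    have h2 : shellMass n σ (R / 2) R ≤ shellMass n σ 2 R := by
      rw [← shellMass_add σ (show 2 ≤ R / 2 by linarith) (show R / 2 ≤ R by linarith)]
      exact le_add_self
    have h3 : ENNReal.ofReal (R ^ (-σ)) * ENNReal.ofReal ((R⁻¹ ^ n)⁻¹)
        = ENNReal.ofReal (R ^ (n - σ)) := by
      rw [← ENNReal.ofReal_mul (by positivity), inv_pow, inv_inv, ← Real.rpow_natCast,
        ← Real.rpow_add hR0]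
      congr 2; ring
    calc _ = ENNReal.ofReal (R ^ (n - σ)) * c₁ := by rw [← mul_assoc, h3]
      _ = ENNReal.ofReal (R ^ (n - σ)) * (K * unitShellVolume n) := by
          rw [hK, ENNReal.div_mul_cancel hu0 huf]
      _ = K * (ENNReal.ofReal (R ^ (n - σ)) * unitShellVolume n) := by ring
      _ ≤ _ := mul_le_mul_right (h1.trans h2) _
  calc cutoffMass n σ R⁻¹ ≤ _ := lintegral_mono hpt
    _ = V + (shellMass n σ 2 R + ENNReal.ofReal (R ^ (-σ)) * (ENNReal.ofReal ((R⁻¹ ^ n)⁻¹) * c₁)) := by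
        rw [lintegral_add_left hm1, lintegral_add_left hm2,
          lintegral_const_mul' _ _ ENNReal.ofReal_ne_top, lintegral_comp_smul hRi,
          lintegral_indicator_one measurableSet_closedBall,
          lintegral_indicator (measurableSet_shell _ _), hV, shellMass]
    _ ≤ V + (shellMass n σ 2 R + K * shellMass n σ 2 R) := by gcongr
    _ = _ := by push_cast; ring

theorem exists_mul_shellMass_le {α : ℝ} (hα : 0 < α) (hαn : α < n) :
    ∃ κ : ℝ, 0 < κ ∧ ∀ (s₁ s₂ : ℝ), 0 ≤ s₁ → 0 ≤ s₂ → ∀ (R : ℝ) (hR : 0 < R),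
      ENNReal.ofReal κ * shellMass n (α + s₁ + s₂) 2 R
        ≤ ‖∫ x, truncatedRiesz (n := n) s₂ (inv_pos.2 hR).ne' x
            * fractionalIntegral α (truncatedRiesz (n := n) s₁ (inv_pos.2 hR).ne') x‖ₑ := by
  obtain ⟨κ, hκ, h⟩ := exists_integral_mul_fractionalIntegral_eq (n := n) hα hαn
  refine ⟨κ, hκ, fun s₁ s₂ hs₁ hs₂ R hR => ?_⟩
  have hc : R⁻¹ ≠ 0 := (inv_pos.2 hR).ne'
  set a : Rn n → ℝ := fun ζ => ‖ζ‖ ^ (-α) *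
    (((1 - unitBump n ζ) * ‖ζ‖ ^ (-s₁) * unitBump n (R⁻¹ • ζ))
      * ((1 - unitBump n ζ) * ‖ζ‖ ^ (-s₂) * unitBump n (R⁻¹ • ζ))) with ha
  have ha0 : ∀ ζ, 0 ≤ a ζ := fun ζ => by
    have h1 : 0 ≤ 1 - unitBump n ζ := sub_nonneg.2 (unitBump n).le_one
    have h2 : 0 ≤ unitBump n (R⁻¹ • ζ) := (unitBump n).nonneg
    positivity
  have hval : ∀ ζ, ((‖ζ‖ ^ (-α) : ℝ) : ℂ) * (𝓕 (truncatedRiesz (n := n) s₁ hc) ζ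
      * 𝓕⁻ (truncatedRiesz (n := n) s₂ hc) ζ) = (a ζ : ℂ) := by
    intro ζ
    rw [truncatedRiesz, truncatedRiesz, ← fourier_truncatedPower hs₂, FourierTransform.fourier_fourierInv_eq,
      FourierTransform.fourierInv_fourier_eq, truncatedPower_eq_ofReal hs₁,
      truncatedPower_eq_ofReal hs₂, ← Complex.ofReal_mul, ← Complex.ofReal_mul]
  have hInt : Integrable a := by
    have h1 := integrable_rieszSymbol_mul hα hαn
      (windowed (truncatedPower (n := n) s₁ hc) (truncatedPower (n := n) s₂ hc) 0)
    refine h1.re.congr (ae_of_all _ fun ζ => ?_)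
    simp only
    rw [windowed_apply, sub_zero, truncatedPower_eq_ofReal hs₁, truncatedPower_eq_ofReal hs₂,
      ← Complex.ofReal_mul, ← Complex.ofReal_mul]
    simp only [ha, RCLike.re_to_complex, Complex.ofReal_re]
    ring
  rw [h, enorm_mul]
  simp only [hval]
  rw [integral_complex_ofReal, ← ofReal_norm, ← ofReal_norm, Complex.norm_real, Complex.norm_real,
    Real.norm_of_nonneg hκ.le, Real.norm_of_nonneg (integral_nonneg ha0),
    ofReal_integral_eq_lintegral_ofReal hInt (ae_of_all _ ha0)]
  refine mul_le_mul_right ?_ _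
  refine le_trans ?_ (setLIntegral_le_lintegral {ζ : Rn n | 2 < ‖ζ‖ ∧ ‖ζ‖ ≤ R} _)
  refine le_of_eq (setLIntegral_congr_fun (measurableSet_shell _ _) fun ζ hζ => ?_)
  have hζ0 : 0 < ‖ζ‖ := by linarith [hζ.1]
  have h1 : unitBump n (R⁻¹ • ζ) = 1 := unitBump_eq_one (by
    rw [norm_smul, Real.norm_of_nonneg (inv_pos.2 hR).le, inv_mul_eq_div, div_le_one hR]
    exact hζ.2)
  simp only [powerKernel, ha, h1, unitBump_eq_zero hζ.1.le, sub_zero, one_mul, mul_one]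
  rw [← Real.rpow_add hζ0, ← Real.rpow_add hζ0]
  congr 2; ring

theorem exists_integral_mul_fractionalIntegral_ne_zero {α : ℝ} (hα : 0 < α) (hαn : α < n) :
    ∃ f g : 𝓢(Rn n, ℂ), ∫ x, g x * fractionalIntegral α f x ≠ 0 := by
  have hn : 0 < n := by
    have : (0 : ℝ) < n := hα.trans hαn
    exact_mod_cast this
  obtain ⟨κ, hκ, h⟩ := exists_mul_shellMass_le (n := n) hα hαn
  have hR : (0 : ℝ) < 2 ^ (1 + 1) := by positivity
  have h1 := h 0 0 le_rfl le_rfl _ hR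
  have h2 := natCast_mul_unitShellVolume_le (n := n) hα.le hαn.le 1
  rw [add_zero, add_zero] at h1
  refine ⟨truncatedRiesz 0 (inv_pos.2 hR).ne', truncatedRiesz 0 (inv_pos.2 hR).ne', fun h0 => ?_⟩
  rw [h0, enorm_zero, nonpos_iff_eq_zero, mul_eq_zero] at h1
  rcases h1 with h1 | h1
  · exact absurd h1 (ENNReal.ofReal_pos.2 hκ).ne'
  · rw [h1, Nat.cast_one, one_mul, nonpos_iff_eq_zero] at h2
    exact unitShellVolume_ne_zero hn h2

/-- A sequence tending to infinity does not satisfy a sublinear self-improving bound. -/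
theorem not_le_mul_rpow_of_tendsto_atTop {P : ℕ → ℝ} (hP : Tendsto P atTop atTop) {κ D V K τ : ℝ}
    (hκ : 0 < κ) (hV : 0 ≤ V) (hK : 0 ≤ K) (hD : 0 ≤ D) (hτ : 0 < τ) (hτ1 : τ < 1)
    (h : ∀ᶠ j in atTop, κ * P j ≤ D * (V + K * P j) ^ (1 - τ)) : False := by
  have h1 := ((tendsto_rpow_atTop hτ).comp hP).eventually_gt_atTop (D * (1 + K) ^ (1 - τ) / κ)
  obtain ⟨j, h, h1, hV', h0⟩ := (h.and (h1.and ((hP.eventually_ge_atTop V).and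
    (hP.eventually_gt_atTop 0)))).exists
  have h2 : (V + K * P j) ^ (1 - τ) ≤ (1 + K) ^ (1 - τ) * P j ^ (1 - τ) := by
    rw [← Real.mul_rpow (by positivity) h0.le]
    exact Real.rpow_le_rpow (by positivity) (by linarith) (by linarith)
  have h3 : P j = P j ^ τ * P j ^ (1 - τ) := by
    rw [← Real.rpow_add h0, add_sub_cancel, Real.rpow_one]
  have h4 : 0 < P j ^ (1 - τ) := Real.rpow_pos_of_pos h0 _
  rw [Function.comp_apply, div_lt_iff₀ hκ] at h1
  have h5 := mul_lt_mul_of_pos_right h1 h4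
  have h6 := mul_le_mul_of_nonneg_left h2 hD
  have h7 : P j ^ τ * κ * P j ^ (1 - τ) = κ * P j := by
    conv_rhs => rw [h3]
    ring
  linarith

/-- The condition on the frequency exponents. -/
theorem FractionalIntegralBounded.frequency_exponents {α : ℝ} (hα : 0 < α) (hαn : α < n)
    {φ : 𝓢(Rn n, ℂ)} (hφ : φ ≠ 0) {p₁ p₂ q₁ q₂ : ℝ} (hp₁ : 1 < p₁) (hp₂ : 1 < p₂) (hq₁ : 1 < q₁)
    (hq₂ : 1 < q₂) (hb : FractionalIntegralBounded φ α p₁ q₁ p₂ q₂ hp₁.le hq₁.le hp₂.le hq₂.le) :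
    1 / q₂ < 1 / q₁ + α / n := by
  by_contra! hcon
  have hnR : (0 : ℝ) < n := hα.trans hαn
  have hn : 0 < n := by exact_mod_cast hnR
  have hp' := Real.HolderConjugate.conjExponent hp₂
  have hq' := Real.HolderConjugate.conjExponent hq₂
  have hq₁0 : 0 < q₁ := by linarith
  set q' := q₂.conjExponent with hq'def
  have hq'0 : 0 < q' := hq'.symm.pos
  have hinv : 1 / q' = 1 - 1 / q₂ := by
    have := hq'.inv_add_inv_eq_one; simp only [one_div]; linarith
  set τ : ℝ := 1 / q₂ - 1 / q₁ with hτ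
  have hατ : α / n ≤ τ := by rw [hτ]; linarith
  have hτ0 : 0 < τ := lt_of_lt_of_le (by positivity) hατ
  have hτ1 : τ < 1 := by
    have h1 : 1 / q₂ < 1 := (div_lt_one (by linarith)).2 hq₂
    have h2 : 0 < 1 / q₁ := by positivity
    rw [hτ]; linarith
  set σ : ℝ := α / τ with hσ
  have hσ0 : 0 ≤ σ := by positivity
  have hσn : σ ≤ n := by
    rw [hσ, div_le_iff₀ hτ0]; rwa [div_le_iff₀ hnR, mul_comm] at hατ
  have hsum : α + σ / q₁ + σ / q' = σ := by
    have h1 : α = σ * τ := by rw [hσ, div_mul_cancel₀ _ hτ0.ne']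
    have h2 : σ / q' = σ * (1 / q') := by ring
    rw [h2, hinv, h1, hτ]; ring
  obtain ⟨C, hC⟩ := hb.exists_enorm_integral_le hα hαn hφ hp₁ hp₂ hq₁ hq₂
  obtain ⟨C₁, h₁⟩ := exists_mixedNorm_fourier_windowed_truncatedPower_le (conjSchwartz φ)
    (s := σ / q₁) (by positivity) hp₁ hq₁
  obtain ⟨C₂, h₂⟩ := exists_mixedNorm_fourier_windowed_truncatedPower_le φ
    (s := σ / q') (by positivity) hp'.symm.lt hq'.symm.lt
  rw [div_mul_cancel₀ _ hq₁0.ne'] at h₁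
  rw [div_mul_cancel₀ _ hq'0.ne'] at h₂
  obtain ⟨V, K, hS⟩ := exists_cutoffMass_le hn hσ0
  obtain ⟨κ, hκ, hlow⟩ := exists_mul_shellMass_le (n := n) hα hαn
  set P : ℕ → ℝ := fun j => (shellMass n σ 2 (2 ^ (j + 1))).toReal with hP
  have hPe : ∀ j, shellMass n σ 2 (2 ^ (j + 1)) = ENNReal.ofReal (P j) := fun j =>
    (ENNReal.ofReal_toReal (shellMass_ne_top hσ0 _)).symm
  have hP0 : ∀ j, 0 ≤ P j := fun j => ENNReal.toReal_nonneg
  have hPtop : Tendsto P atTop atTop := by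
    have hv : 0 < (unitShellVolume n).toReal :=
      ENNReal.toReal_pos (unitShellVolume_ne_zero hn) (unitShellVolume_ne_top n)
    refine tendsto_atTop_mono (fun j => ?_) (tendsto_natCast_atTop_atTop.atTop_mul_const hv)
    have h1 := natCast_mul_unitShellVolume_le (n := n) hσ0 hσn j
    have h2 := ENNReal.toReal_mono (shellMass_ne_top hσ0 _) h1
    rwa [ENNReal.toReal_mul, ENNReal.toReal_natCast] at h2
  refine not_le_mul_rpow_of_tendsto_atTop hPtop (D := C * C₁ * C₂) hκ V.coe_nonneg K.coe_nonneg (by positivity) hτ0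
    hτ1 ?_
  filter_upwards [eventually_ge_atTop 1] with j hj
  have hR : (0 : ℝ) < 2 ^ (j + 1) := by positivity
  have hR4 : (4 : ℝ) ≤ 2 ^ (j + 1) := by
    have := pow_le_pow_right₀ (one_le_two (α := ℝ)) (Nat.succ_le_succ hj)
    norm_num at this ⊢; linarith
  have hc : 0 < ((2 : ℝ) ^ (j + 1))⁻¹ := inv_pos.2 hR
  have hc1 : ((2 : ℝ) ^ (j + 1))⁻¹ ≤ 1 := inv_le_one_of_one_le₀ (by linarith)
  have hA : 0 ≤ V + K * P j := by have := hP0 j; positivity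
  have hSj : cutoffMass n σ ((2 : ℝ) ^ (j + 1))⁻¹ ≤ ENNReal.ofReal (V + K * P j) := by
    refine (hS _ hR4).trans_eq ?_
    rw [hPe, ENNReal.ofReal_add V.coe_nonneg (mul_nonneg K.coe_nonneg (hP0 j)), ENNReal.ofReal_mul K.coe_nonneg,
      ENNReal.ofReal_coe_nnreal, ENNReal.ofReal_coe_nnreal]
  have hpow : ∀ q : ℝ, 0 < q → cutoffMass n σ ((2 : ℝ) ^ (j + 1))⁻¹ ^ (1 / q)
      ≤ ENNReal.ofReal ((V + K * P j) ^ (1 / q)) := fun q hq => by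
    rw [← ENNReal.ofReal_rpow_of_nonneg hA (by positivity)]
    exact ENNReal.rpow_le_rpow hSj (by positivity)
  have hf := (h₁ _ hc hc1).trans (mul_le_mul_right (hpow q₁ hq₁0) _)
  have hg := (h₂ _ hc hc1).trans (mul_le_mul_right (hpow q' hq'0) _)
  have h3 := hC (truncatedRiesz (σ / q₁) hc.ne') (truncatedRiesz (σ / q') hc.ne')
    (ne_top_of_le_ne_top (ENNReal.mul_ne_top ENNReal.coe_ne_top ENNReal.ofReal_ne_top) hf)
  have h4 := (hlow (σ / q₁) (σ / q') (by positivity) (by positivity) _ hR).trans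
    (h3.trans (mul_le_mul' (mul_le_mul_right hf _) hg))
  rw [hsum, hPe, ← ENNReal.ofReal_coe_nnreal, ← ENNReal.ofReal_coe_nnreal,
    ← ENNReal.ofReal_coe_nnreal, ← ENNReal.ofReal_mul hκ.le, ← ENNReal.ofReal_mul (by positivity),
    ← ENNReal.ofReal_mul (by positivity), ← ENNReal.ofReal_mul (by positivity),
    ← ENNReal.ofReal_mul (by positivity), ENNReal.ofReal_le_ofReal_iff (by positivity)] at h4
  refine h4.trans_eq ?_
  have h5 : 1 - τ = 1 / q₁ + 1 / q' := by rw [hinv, hτ]; ring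
  rw [h5, Real.rpow_add_of_nonneg hA (by positivity) (by positivity)]
  ring

end FracMod

theorem theorem1p1 (n : ℕ) (α : ℝ) (hα : 0 < α) (hαn : α < n)
    (p₁ p₂ q₁ q₂ : ℝ) (hp₁ : 1 < p₁) (hp₂ : 1 < p₂) (hq₁ : 1 < q₁) (hq₂ : 1 < q₂)
    (φ : SchwartzMap (FracMod.Rn n) ℂ) (hφ : φ ≠ 0) :
    FracMod.FractionalIntegralBounded φ α p₁ q₁ p₂ q₂ hp₁.le hq₁.le hp₂.le hq₂.le ↔
      1 / p₂ ≤ 1 / p₁ - α / n ∧ 1 / q₂ < 1 / q₁ + α / n := by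
  constructor
  · intro h
    obtain ⟨f, g, hfg⟩ := FracMod.exists_integral_mul_fractionalIntegral_ne_zero hα hαn
    exact ⟨h.space_exponents hα hαn hφ hp₁ hp₂ hq₁ hq₂ hfg,
      h.frequency_exponents hα hαn hφ hp₁ hp₂ hq₁ hq₂⟩
  · rintro ⟨hp, hq⟩
    exact FracMod.fractionalIntegralBounded_of_exponents hα hαn hφ hp₁ hp₂ hq₁ hq₂ hp hq
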